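/- There is an absolute constant $\varepsilon>0$ with the following property. Let $u$ be complex-valued and let $n,v$ be real-valued, with $$(u,n,v)\in C\big([0,\infty),\,H^1(\mathbb R)\times L^2(\mathbb R)\times L^2(\mathbb R)\big),$$ and suppose that $(u,n,v)$ is a solution, in the sense of distributions for $t>0$, of the one-dimensional Zakharov system in first-order form $$i u_t+u_{xx}=nu,\qquad n_t+v_x=0,\qquad v_t+\big(n+|u|^2\big)_x=0 .$$ (For every such $(u,n,v)$ and every $t \ge 0$, the energy $\int_{\mathbb R}|u_x|^2+\tfrac12(|n|^2+|v|^2)+n|u|^2\,dx$ is finite.) Assume that $u(t,\cdot)$ is odd for every $t\ge 0$ and that $$\sup_{t\ge 0}\|u(t)\|_{H^1(\mathbb R)}<\varepsilon .$$ Then for every compact interval $I\subset\mathbb R$, $$\lim_{t\to\infty}\Big(\|u(t)\|_{L^\infty(I)}+\|u(t)\|_{L^2(I)}+\|n(t)\|_{L^2(I)}+\|v(t)\|_{L^2(I)}\Big)=0 .$$ -/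

import Mathlib

open MeasureTheory Filter Topology
open scoped ENNReal ContDiff

namespace Zakharov

/-- The Lebesgue space `L²(ℝ; E)` with its usual norm. -/
abbrev L2 (E : Type) [NormedAddCommGroup E] : Type := Lp E 2 (volume : Measure ℝ)

/-- Real test functions on the line: smooth with compact support. -/
def IsTest (η : ℝ → ℝ) : Prop := ContDiff ℝ ∞ η ∧ HasCompactSupport η

/-- `g` is the weak (distributional) derivative of `f` on `ℝ`. -/
def IsWeakDeriv (f g : L2 ℂ) : Prop :=
  ∀ η : ℝ → ℝ, IsTest η → ∫ x, ((deriv η x : ℝ) : ℂ) * f x = -∫ x, ((η x : ℝ) : ℂ) * g x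

theorem IsTest.deriv {η : ℝ → ℝ} (h : IsTest η) : IsTest (deriv η) :=
  ⟨((contDiff_infty_iff_deriv (𝕜 := ℝ)).1 h.1).2, h.2.deriv⟩

theorem IsTest.integrable_mul {η : ℝ → ℝ} (h : IsTest η) (f : L2 ℂ) :
    Integrable (fun x => ((η x : ℝ) : ℂ) * f x) := by
  have hc : Continuous fun x => ((η x : ℝ) : ℂ) := Complex.continuous_ofReal.comp h.1.continuous
  have hs : HasCompactSupport fun x => ((η x : ℝ) : ℂ) :=
    h.2.comp_left (g := fun r : ℝ => (r : ℂ)) Complex.ofReal_zero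
  exact MemLp.integrable_mul (p := 2) (q := 2) (hc.memLp_of_hasCompactSupport hs) (Lp.memLp f)

theorem IsWeakDeriv.add {f g f' g' : L2 ℂ} (h : IsWeakDeriv f g) (h' : IsWeakDeriv f' g') :
    IsWeakDeriv (f + f') (g + g') := by
  have key : ∀ (η : ℝ → ℝ), IsTest η → ∀ a b : L2 ℂ,
      ∫ x, ((η x : ℝ) : ℂ) * (a + b : L2 ℂ) x
        = (∫ x, ((η x : ℝ) : ℂ) * a x) + ∫ x, ((η x : ℝ) : ℂ) * b x := by
    intro η hη a b
    rw [← integral_add (hη.integrable_mul a) (hη.integrable_mul b)]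
    refine integral_congr_ae ?_
    filter_upwards [Lp.coeFn_add a b] with x hx
    rw [hx, Pi.add_apply, mul_add]
  intro η hη
  rw [key _ hη.deriv, key _ hη, h η hη, h' η hη, neg_add]

theorem IsWeakDeriv.smul (c : ℂ) {f g : L2 ℂ} (h : IsWeakDeriv f g) :
    IsWeakDeriv (c • f) (c • g) := by
  have key : ∀ (η : ℝ → ℝ) (a : L2 ℂ),
      ∫ x, ((η x : ℝ) : ℂ) * (c • a : L2 ℂ) x = c * ∫ x, ((η x : ℝ) : ℂ) * a x := by
    intro η a
    rw [← integral_const_mul]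
    refine integral_congr_ae ?_
    filter_upwards [Lp.coeFn_smul c a] with x hx
    rw [hx, Pi.smul_apply, smul_eq_mul]
    ring
  intro η hη
  rw [key, key, h η hη, mul_neg]

theorem IsWeakDeriv.zero : IsWeakDeriv 0 0 := by
  have key : ∀ ζ : ℝ → ℝ, ∫ x, ((ζ x : ℝ) : ℂ) * (0 : L2 ℂ) x = 0 := by
    intro ζ
    refine integral_eq_zero_of_ae ?_
    filter_upwards [Lp.coeFn_zero ℂ 2 (volume : Measure ℝ)] with x hx
    rw [hx, Pi.zero_apply, mul_zero]
  intro η _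
  rw [key, key, neg_zero]

/-- The Sobolev space `H¹(ℝ; ℂ)`, realised as the space of pairs `(f, f')` in `L² × L²` such that
`f'` is the weak derivative of `f`. The inherited norm is
`‖f‖_{H¹} = (‖f‖_{L²}² + ‖f'‖_{L²}²)^{1/2}`. -/
def H1 : Submodule ℂ (WithLp 2 (L2 ℂ × L2 ℂ)) where
  carrier := {p | IsWeakDeriv p.fst p.snd}
  add_mem' ha hb := IsWeakDeriv.add ha hb
  zero_mem' := IsWeakDeriv.zero
  smul_mem' c _ h := IsWeakDeriv.smul c h

/-- The underlying function of an element of `H¹`. -/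
def H1.toL2 (f : H1) : L2 ℂ := f.1.fst

/-- `(u, n, v)` solves, for `t > 0`, in the sense of distributions,
`i u_t + u_xx = n u`, `n_t + v_x = 0`, `v_t + (n + |u|²)_x = 0`.
Each equation is tested against functions of `x`; for continuous `(u, n, v)` this is the same as
testing against functions of `(t, x)` supported in `t > 0`, since all the pairings below are
continuous functions of `t`. The first equation is written as `u_t = i (u_xx - n u)`. -/
structure IsSolution (u : ℝ → H1) (n v : ℝ → L2 ℝ) : Prop where
  schrodinger : ∀ η : ℝ → ℝ, IsTest η → ∀ t : ℝ, 0 < t →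
    HasDerivAt (fun s => ∫ x, ((η x : ℝ) : ℂ) * H1.toL2 (u s) x)
      (Complex.I * ((∫ x, ((deriv (deriv η) x : ℝ) : ℂ) * H1.toL2 (u t) x)
        - ∫ x, ((η x : ℝ) : ℂ) * (((n t x : ℝ) : ℂ) * H1.toL2 (u t) x))) t
  density : ∀ η : ℝ → ℝ, IsTest η → ∀ t : ℝ, 0 < t →
    HasDerivAt (fun s => ∫ x, η x * n s x) (∫ x, deriv η x * v t x) t
  velocity : ∀ η : ℝ → ℝ, IsTest η → ∀ t : ℝ, 0 < t →
    HasDerivAt (fun s => ∫ x, η x * v s x)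
      (∫ x, deriv η x * (n t x + ‖H1.toL2 (u t) x‖ ^ 2)) t

/-- An element of `L²` is odd, as an almost-everywhere class. -/
def IsOdd (f : L2 ℂ) : Prop := ∀ᵐ x : ℝ, f (-x) = -f x

end Zakharov

/-! The proof is a virial argument. Take ψ bounded and odd with ψ' = e^{-2|x|}, and differentiate
⟨iu, ψ u_x⟩ + ∫ψ n v in time. The terms carrying ψ times a derivative of |u|² cancel between the
Schrödinger and wave parts. What remains is a quadratic form in u, the term (1/2)∫e^{-2|x|}(n² +
v²), and the cross term ∫e^{-2|x|} n|u|².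

Oddness enters only through u(t,0) = 0. For functions vanishing at the origin, multiplication by sgn
x commutes with the weak derivative. This gives the Hardy identity ‖e^{-|x|}u‖² = Re∫ sgn(x)
e^{-2|x|} ū u_x, which turns the quadratic form into exactly 2‖(e^{-|x|}u)_x‖² (`virial_quadratic`).
The same identity applied to |u|² gives ‖e^{-|x|}|u|²‖ ≤ 2‖u‖_{H¹}‖(e^{-|x|}u)_x‖ (`norm_Z_sq_le`),
so smallness of u lets the quadratic terms absorb the cross term (`dissipation_le`).

Energy conservation bounds n and v in L², so the virial functional is bounded and the dissipation is
integrable in time. The local mass, with weight e^{-4|x|}, and its time derivative are both bounded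
by multiples of the dissipation; hence the local mass tends to 0 (`tendsto_localMass`). The local
sup norm of u follows from Agmon's inequality.

Since u is only in H¹ and n, v only in L², the identities are first derived for quantities
regularized by the resolvents R_k = (1 − s_k²D²)⁻¹ with s_k → 0. These are symmetric contractions
commuting with D. The limit is taken by dominated convergence in time (`hasDerivAt_of_tendsto`). -/

namespace Zakharov

/-! ### Primitives of locally integrable functions -/

/-- `F` is a primitive of the locally integrable function `f`. -/
structure IsPrimitive (F f : ℝ → ℂ) : Prop where
  locallyIntegrable : LocallyIntegrable f
  eq_add : ∀ x, F x = F 0 + ∫ t in (0 : ℝ)..x, f t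

namespace IsPrimitive

variable {F G f g : ℝ → ℂ}

theorem intervalIntegrable (h : IsPrimitive F f) (a b : ℝ) : IntervalIntegrable f volume a b :=
  intervalIntegrable_iff.mpr <|
    (h.locallyIntegrable.integrableOn_isCompact isCompact_uIcc).mono_set Set.uIoc_subset_uIcc

theorem eq_primitive (h : IsPrimitive F f) : F = fun x => F 0 + ∫ t in (0 : ℝ)..x, f t :=
  funext h.eq_add

theorem sub_eq (h : IsPrimitive F f) (a b : ℝ) : F b - F a = ∫ t in a..b, f t := by
  rw [h.eq_add a, h.eq_add b,
    ← intervalIntegral.integral_add_adjacent_intervals (h.intervalIntegrable 0 a)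
      (h.intervalIntegrable a b)]
  ring

theorem continuous (h : IsPrimitive F f) : Continuous F := by
  rw [h.eq_primitive]
  exact continuous_const.add (intervalIntegral.continuous_primitive h.intervalIntegrable 0)

theorem ae_hasDerivAt (h : IsPrimitive F f) : ∀ᵐ x, HasDerivAt F (f x) x := by
  filter_upwards [_root_.LocallyIntegrable.ae_hasDerivAt_integral h.locallyIntegrable] with x hx
  rw [h.eq_primitive]
  exact (hx 0).const_add _

theorem _root_.Zakharov.absolutelyContinuousOnInterval_const {E : Type*} [NormedAddCommGroup E]
    (c : E) (a b : ℝ) : AbsolutelyContinuousOnInterval (fun _ : ℝ => c) a b :=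
  ((LipschitzWith.const c).lipschitzOnWith (s := Set.uIcc a b)).absolutelyContinuousOnInterval

/-- The real and imaginary parts are integrals of real functions, recombined as scalar multiples of
the constants 1 and i. -/
theorem absolutelyContinuousOnInterval (h : IsPrimitive F f) (R : ℝ) :
    AbsolutelyContinuousOnInterval F (-R) R := by
  have h0 : (0 : ℝ) ∈ Set.uIcc (-R) R := by
    rcases le_total 0 R with hR | hR
    · rw [Set.uIcc_of_le (by linarith)]; constructor <;> linarith
    · rw [Set.uIcc_of_ge (by linarith)]; constructor <;> linarith
  have hre : IntervalIntegrable (fun x => (f x).re) volume (-R) R :=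
    ⟨(h.intervalIntegrable (-R) R).1.re, (h.intervalIntegrable (-R) R).2.re⟩
  have him : IntervalIntegrable (fun x => (f x).im) volume (-R) R :=
    ⟨(h.intervalIntegrable (-R) R).1.im, (h.intervalIntegrable (-R) R).2.im⟩
  have key : F = (fun _ => F 0) + (((fun x => ∫ t in (0 : ℝ)..x, (f t).re) • fun _ => (1 : ℂ))
      + ((fun x => ∫ t in (0 : ℝ)..x, (f t).im) • fun _ => Complex.I)) := by
    funext x
    have h1 := Complex.reCLM.intervalIntegral_comp_comm (h.intervalIntegrable 0 x)
    have h2 := Complex.imCLM.intervalIntegral_comp_comm (h.intervalIntegrable 0 x)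
    simp only [Complex.reCLM_apply, Complex.imCLM_apply] at h1 h2
    simp only [Pi.add_apply, Pi.smul_apply', h1, h2, Complex.real_smul, mul_one,
      Complex.re_add_im]
    exact h.eq_add x
  rw [key]
  exact (absolutelyContinuousOnInterval_const _ _ _).add
    (((hre.absolutelyContinuousOnInterval_intervalIntegral h0).smul
        (absolutelyContinuousOnInterval_const _ _ _)).add
      ((him.absolutelyContinuousOnInterval_intervalIntegral h0).smul
        (absolutelyContinuousOnInterval_const _ _ _)))

theorem mul (hF : IsPrimitive F f) (hG : IsPrimitive G g) :
    IsPrimitive (fun x => F x * G x) (fun x => f x * G x + F x * g x) := by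
  have hint : LocallyIntegrable (fun x => f x * G x + F x * g x) :=
    (hF.locallyIntegrable.mul_continuous hG.continuous).add
      (hG.locallyIntegrable.continuous_mul hF.continuous)
  refine ⟨hint, fun x => ?_⟩
  have hP : IsPrimitive (fun x => ∫ t in (0 : ℝ)..x, (f t * G t + F t * g t))
      (fun x => f x * G x + F x * g x) := ⟨hint, fun x => by simp⟩
  -- FG minus the integral of the product-rule expression is absolutely continuous with derivative
  -- zero almost everywhere, hence constant on [-|x|, |x|], an interval containing both x and 0.
  have hac := ((hF.absolutelyContinuousOnInterval |x|).smul
    (hG.absolutelyContinuousOnInterval |x|)).sub (hP.absolutelyContinuousOnInterval |x|)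
  obtain ⟨C, hC⟩ := hac.const_of_ae_hasDerivAt_zero (by
    filter_upwards [hF.ae_hasDerivAt, hG.ae_hasDerivAt, hP.ae_hasDerivAt] with y h1 h2 h3 _
    simpa using (h1.mul h2).sub h3)
  have hm : ∀ y, |y| ≤ |x| → y ∈ Set.uIcc (-|x|) |x| := fun y hy => by
    rw [Set.uIcc_of_le (by linarith [abs_nonneg x])]
    exact abs_le.1 hy
  have e1 := hC x (hm x le_rfl)
  have e2 := hC 0 (hm 0 (by simp))
  simp only [Pi.sub_apply, Pi.mul_apply, smul_eq_mul, intervalIntegral.integral_same,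
    sub_zero] at e1 e2
  rw [← e2] at e1
  linear_combination e1

theorem conj (h : IsPrimitive F f) : IsPrimitive (fun x => star (F x)) (fun x => star (f x)) := by
  refine ⟨?_, fun x => ?_⟩
  · intro x
    obtain ⟨s, hs, hi⟩ := h.locallyIntegrable x
    exact ⟨s, hs, Complex.conjCLE.toContinuousLinearMap.integrable_comp hi⟩
  · have h1 := Complex.conjCLE.toContinuousLinearMap.intervalIntegral_comp_comm
      (h.intervalIntegrable 0 x)
    simp only [ContinuousLinearEquiv.coe_coe, Complex.conjCLE_apply] at h1
    simp only [Complex.star_def]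
    rw [h1, h.eq_add x, map_add]

theorem of_hasDerivAt (hF : ∀ x, HasDerivAt F (f x) x) (hf : Continuous f) : IsPrimitive F f :=
  ⟨hf.locallyIntegrable, fun x => by
    rw [intervalIntegral.integral_eq_sub_of_hasDerivAt (fun y _ => hF y)
      (hf.intervalIntegrable _ _)]; ring⟩

/-- The jump of the sign at the origin would contribute a point mass 2F(0); it is absent because
F(0) = 0. This is the only mechanism through which oddness acts. -/
theorem sgn_mul (h : IsPrimitive F f) (h0 : F 0 = 0) :
    IsPrimitive (fun x => ((SignType.sign x : ℝ) : ℂ) * F x)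
      (fun x => ((SignType.sign x : ℝ) : ℂ) * f x) := by
  have hs : ∀ x : ℝ, ‖((SignType.sign x : ℝ) : ℂ)‖ ≤ 1 := fun x => by
    rcases lt_trichotomy x 0 with hx | hx | hx <;> simp [hx]
  have hmeas : Measurable fun x : ℝ => ((SignType.sign x : ℝ) : ℂ) := by
    refine Complex.measurable_ofReal.comp ?_
    have : (fun x : ℝ => (SignType.sign x : ℝ)) =
        fun x => if x < 0 then -1 else if 0 < x then 1 else 0 := by
      funext x
      rcases lt_trichotomy x 0 with hx | hx | hx <;> simp [hx, not_lt_of_gt]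
    rw [this]
    exact Measurable.ite measurableSet_Iio measurable_const
      (Measurable.ite measurableSet_Ioi measurable_const measurable_const)
  refine ⟨?_, fun x => ?_⟩
  · intro x
    obtain ⟨s, hs', hi⟩ := h.locallyIntegrable x
    exact ⟨s, hs', hi.bdd_mul (c := 1) hmeas.aestronglyMeasurable (Eventually.of_forall hs)⟩
  · rw [h.eq_add x, h0]
    rcases lt_trichotomy x 0 with hx | hx | hx
    · have : ∫ t in (0 : ℝ)..x, ((SignType.sign t : ℝ) : ℂ) * f t
          = ∫ t in (0 : ℝ)..x, -1 * f t := by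
        refine intervalIntegral.integral_congr_ae ?_
        have : ∀ᵐ t : ℝ, t ≠ 0 := by simp [ae_iff, measure_singleton]
        filter_upwards [this] with t ht0 ht
        rw [Set.uIoc_of_ge hx.le] at ht
        have : t < 0 := lt_of_le_of_ne ht.2 ht0
        simp [this]
      rw [this, intervalIntegral.integral_const_mul]
      simp [hx]
    · simp [hx]
    · have : ∫ t in (0 : ℝ)..x, ((SignType.sign t : ℝ) : ℂ) * f t
          = ∫ t in (0 : ℝ)..x, f t := by
        refine intervalIntegral.integral_congr_ae ?_
        refine Eventually.of_forall fun t ht => ?_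
        rw [Set.uIoc_of_le hx.le] at ht
        simp [ht.1]
      rw [this]
      simp [hx]

/-- An integrable function with integrable derivative has derivative of zero mean. -/
theorem integral_eq_zero (h : IsPrimitive F f) (hF : Integrable F) (hf : Integrable f) :
    ∫ x, f x = 0 := by
  have top : Tendsto F atTop (𝓝 (F 0 + ∫ t in Set.Ioi 0, f t)) := by
    rw [h.eq_primitive]
    simpa using tendsto_const_nhds.add
      (intervalIntegral_tendsto_integral_Ioi 0 hf.integrableOn tendsto_id)
  have bot : Tendsto F atBot (𝓝 (F 0 - ∫ t in Set.Iic 0, f t)) := by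
    rw [h.eq_primitive]
    have := intervalIntegral_tendsto_integral_Iic 0 hf.integrableOn tendsto_id
    simp only [id] at this
    have h2 : (fun x => F 0 + ∫ t in (0 : ℝ)..x, f t) = fun x => F 0 - ∫ t in x..(0 : ℝ), f t := by
      funext x
      rw [intervalIntegral.integral_symm]; ring
    rw [h2]
    simpa using tendsto_const_nhds.sub this
  -- Half-lines have infinite measure, so an integrable function that has a limit at infinity has
  -- limit 0 there.
  have z1 := IntegrableAtFilter.eq_zero_of_tendsto (μ := volume)
    ⟨Set.univ, univ_mem, hF.integrableOn⟩ (fun s hs => by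
      rcases mem_atTop_sets.1 hs with ⟨b, hb⟩
      rw [← top_le_iff, ← Real.volume_Ici (a := b)]
      exact measure_mono hb) top
  have z2 := IntegrableAtFilter.eq_zero_of_tendsto (μ := volume)
    ⟨Set.univ, univ_mem, hF.integrableOn⟩ (fun s hs => by
      rcases mem_atBot_sets.1 hs with ⟨b, hb⟩
      rw [← top_le_iff, ← Real.volume_Iic (a := b)]
      exact measure_mono hb) bot
  rw [← intervalIntegral.integral_Iic_add_Ioi (b := 0) hf.integrableOn hf.integrableOn]
  linear_combination z1 - z2

theorem eq_integral_Iic (h : IsPrimitive F f) (hF : Integrable F) (hf : Integrable f) (x : ℝ) :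
    F x = ∫ t in Set.Iic x, f t := by
  have bot : Tendsto F atBot (𝓝 (F x - ∫ t in Set.Iic x, f t)) := by
    have := intervalIntegral_tendsto_integral_Iic x hf.integrableOn tendsto_id
    simp only [id] at this
    have h2 : F = fun y => F x - ∫ t in y..x, f t := by
      funext y
      rw [← h.sub_eq]; ring
    rw [h2]
    simpa using tendsto_const_nhds.sub this
  have z2 := IntegrableAtFilter.eq_zero_of_tendsto (μ := volume)
    ⟨Set.univ, univ_mem, hF.integrableOn⟩ (fun s hs => by
      rcases mem_atBot_sets.1 hs with ⟨b, hb⟩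
      rw [← top_le_iff, ← Real.volume_Iic (a := b)]
      exact measure_mono hb) bot
  linear_combination z2

theorem integral_test (h : IsPrimitive F f) {η : ℝ → ℝ} (hη : IsTest η) :
    ∫ x, ((deriv η x : ℝ) : ℂ) * F x = -∫ x, ((η x : ℝ) : ℂ) * f x := by
  have hp : IsPrimitive (fun x => ((η x : ℝ) : ℂ)) (fun x => ((deriv η x : ℝ) : ℂ)) :=
    of_hasDerivAt (fun x => ((hη.1.differentiable (by simp)) x).hasDerivAt.ofReal_comp)
      (Complex.continuous_ofReal.comp hη.deriv.1.continuous)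
  have hsupp : ∀ {θ : ℝ → ℝ}, IsTest θ → HasCompactSupport fun x => ((θ x : ℝ) : ℂ) := fun hθ =>
    hθ.2.comp_left (g := fun r : ℝ => (r : ℂ)) Complex.ofReal_zero
  have i1 : Integrable fun x => ((deriv η x : ℝ) : ℂ) * F x :=
    ((Complex.continuous_ofReal.comp hη.deriv.1.continuous).mul
      h.continuous).integrable_of_hasCompactSupport (hsupp hη.deriv).mul_right
  have i2 : Integrable fun x => ((η x : ℝ) : ℂ) * f x := by
    have := h.locallyIntegrable.integrable_smul_left_of_hasCompactSupport
      (Complex.continuous_ofReal.comp hη.1.continuous) (hsupp hη)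
    simpa using this
  have i3 : Integrable fun x => ((η x : ℝ) : ℂ) * F x :=
    ((Complex.continuous_ofReal.comp hη.1.continuous).mul
      h.continuous).integrable_of_hasCompactSupport (hsupp hη).mul_right
  have := (hp.mul h).integral_eq_zero i3 (i1.add i2)
  rw [integral_add i1 i2] at this
  linear_combination this

end IsPrimitive

/-! ### Test functions and the lemma of du Bois-Reymond. -/

theorem IsTest.ofReal_integrable_mul {η : ℝ → ℝ} (hη : IsTest η) {f : ℝ → ℂ}
    (hf : LocallyIntegrable f) : Integrable fun x => ((η x : ℝ) : ℂ) * f x := by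
  have hsupp : HasCompactSupport fun x => ((η x : ℝ) : ℂ) :=
    hη.2.comp_left (g := fun r : ℝ => (r : ℂ)) Complex.ofReal_zero
  have := hf.integrable_smul_left_of_hasCompactSupport
    (Complex.continuous_ofReal.comp hη.1.continuous) hsupp
  simpa using this

/-- A test function of zero mean is the derivative of a test function. -/
theorem IsTest.exists_deriv_eq {φ : ℝ → ℝ} (hφ : IsTest φ) (h0 : ∫ x, φ x = 0) :
    ∃ η : ℝ → ℝ, IsTest η ∧ _root_.deriv η = φ := by
  obtain ⟨R, hR⟩ := hφ.2.isCompact.isBounded.subset_closedBall 0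
  have hz : ∀ x, R < |x| → φ x = 0 := fun x hx => by
    by_contra hne
    have := hR (subset_tsupport _ hne)
    rw [Metric.mem_closedBall, dist_zero_right, Real.norm_eq_abs] at this
    linarith
  have hi : Integrable φ := hφ.1.continuous.integrable_of_hasCompactSupport hφ.2
  -- Integrating from -∞ makes η vanish to the left of the support; to its right η is the total
  -- integral, which is zero.
  set η : ℝ → ℝ := fun x => ∫ t in Set.Iic x, φ t with hη
  have hd : ∀ x, HasDerivAt η (φ x) x := by
    intro x
    have h1 : HasDerivAt (fun x => (∫ t in Set.Iic 0, φ t) + ∫ t in (0 : ℝ)..x, φ t) (φ x) x :=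
      (intervalIntegral.integral_hasDerivAt_right (hφ.1.continuous.intervalIntegrable _ _)
        (hφ.1.continuous.stronglyMeasurableAtFilter _ _) hφ.1.continuous.continuousAt).const_add _
    refine h1.congr_of_eventuallyEq (Eventually.of_forall fun y => ?_)
    simp only [hη]
    rw [← intervalIntegral.integral_Iic_sub_Iic hi.integrableOn hi.integrableOn]
    ring
  have hderiv : _root_.deriv η = φ := funext fun x => (hd x).deriv
  refine ⟨η, ⟨?_, ?_⟩, hderiv⟩
  · rw [contDiff_infty_iff_deriv]
    exact ⟨fun x => (hd x).differentiableAt, hderiv ▸ hφ.1⟩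
  · refine HasCompactSupport.of_support_subset_isCompact
      (isCompact_closedBall (0 : ℝ) R) fun x hx => ?_
    rw [Metric.mem_closedBall, dist_zero_right, Real.norm_eq_abs]
    by_contra hxR
    rw [not_le] at hxR
    refine hx ?_
    rcases le_or_gt x 0 with hx0 | hx0
    · refine setIntegral_eq_zero_of_forall_eq_zero fun t ht => hz t ?_
      rw [abs_of_nonpos hx0] at hxR
      have : t ≤ x := ht
      rw [abs_of_nonpos (by linarith)]
      linarith
    · have h2 : ∫ t in Set.Ioi x, φ t = 0 := by
        refine setIntegral_eq_zero_of_forall_eq_zero fun t ht => hz t ?_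
        rw [abs_of_pos hx0] at hxR
        have : x < t := ht
        rw [abs_of_pos (by linarith)]
        linarith
      have h3 := intervalIntegral.integral_Iic_add_Ioi (b := x) hi.integrableOn hi.integrableOn
      rw [h0, h2, add_zero] at h3
      exact h3

theorem exists_isTest_integral_eq_one : ∃ θ : ℝ → ℝ, IsTest θ ∧ ∫ x, θ x = 1 := by
  let b : ContDiffBump (0 : ℝ) := ⟨1, 2, one_pos, one_lt_two⟩
  exact ⟨b.normed volume, ⟨b.contDiff_normed, b.hasCompactSupport_normed⟩, b.integral_normed⟩

theorem IsTest.sub_const_mul {φ θ : ℝ → ℝ} (hφ : IsTest φ) (hθ : IsTest θ) (m : ℝ) :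
    IsTest fun x => φ x - m * θ x :=
  ⟨hφ.1.sub (contDiff_const.mul hθ.1), by
    have : HasCompactSupport fun x => m * θ x := hθ.2.mul_left
    exact hφ.2.sub this⟩

/-- The lemma of du Bois-Reymond: a distribution with zero derivative is constant. -/
theorem ae_eq_const_of_integral_deriv_eq_zero {h : ℝ → ℂ} (hh : LocallyIntegrable h)
    (h0 : ∀ η, IsTest η → ∫ x, ((deriv η x : ℝ) : ℂ) * h x = 0) : ∃ c, h =ᵐ[volume] fun _ => c := by
  obtain ⟨θ, hθ, hθ1⟩ := exists_isTest_integral_eq_one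
  refine ⟨∫ x, ((θ x : ℝ) : ℂ) * h x, ?_⟩
  refine ae_eq_of_integral_contDiff_smul_eq hh continuous_const.locallyIntegrable
    fun φ hφ1 hφ2 => ?_
  have hφ : IsTest φ := ⟨hφ1, hφ2⟩
  have iφ : Integrable φ := hφ1.continuous.integrable_of_hasCompactSupport hφ2
  have iθ : Integrable θ := hθ.1.continuous.integrable_of_hasCompactSupport hθ.2
  -- Subtracting (∫φ)θ leaves mean zero, so the hypothesis says that h pairs with φ as the constant
  -- ∫θh does.
  obtain ⟨η, hη, hηd⟩ := (hφ.sub_const_mul hθ (∫ x, φ x)).exists_deriv_eq (by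
    rw [integral_sub iφ (iθ.const_mul _), integral_const_mul, hθ1]; ring)
  have key := h0 η hη
  rw [hηd] at key
  have e : (fun x => ((φ x - (∫ y, φ y) * θ x : ℝ) : ℂ) * h x) = fun x =>
      ((φ x : ℝ) : ℂ) * h x - ((∫ y, φ y : ℝ) : ℂ) * (((θ x : ℝ) : ℂ) * h x) := by
    funext x; push_cast; ring
  rw [e, integral_sub (hφ.ofReal_integrable_mul hh) ((hθ.ofReal_integrable_mul hh).const_mul _),
    integral_const_mul] at key
  have e2 : ∫ x, φ x • h x = ∫ x, ((φ x : ℝ) : ℂ) * h x := by simp only [Complex.real_smul]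
  rw [e2, integral_smul_const, Complex.real_smul]
  linear_combination key

/-- The difference between f and the integral of g has zero distributional derivative, so it is a
constant. This supplies the continuous representative of an H¹ function. -/
theorem exists_isPrimitive {f g : ℝ → ℂ} (hf : LocallyIntegrable f) (hg : LocallyIntegrable g)
    (h : ∀ η, IsTest η →
      ∫ x, ((deriv η x : ℝ) : ℂ) * f x = -∫ x, ((η x : ℝ) : ℂ) * g x) :
    ∃ F, IsPrimitive F g ∧ f =ᵐ[volume] F := by
  have hG : IsPrimitive (fun x => ∫ t in (0 : ℝ)..x, g t) g := ⟨hg, by simp⟩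
  obtain ⟨c, hc⟩ := ae_eq_const_of_integral_deriv_eq_zero
    (hf.sub hG.continuous.locallyIntegrable) fun η hη => by
      simp only [Pi.sub_apply, mul_sub]
      rw [integral_sub (hη.deriv.ofReal_integrable_mul hf)
        (hη.deriv.ofReal_integrable_mul hG.continuous.locallyIntegrable), h η hη,
        hG.integral_test hη, sub_self]
  refine ⟨fun x => c + ∫ t in (0 : ℝ)..x, g t, ⟨hg, by simp⟩, ?_⟩
  filter_upwards [hc] with x hx
  rw [← hx]; simp

open scoped InnerProductSpace

/-! ### Weak derivatives in `L²` -/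

theorem L2.locallyIntegrable (f : L2 ℂ) : LocallyIntegrable f :=
  (Lp.memLp f).locallyIntegrable one_le_two

theorem L2.inner_eq_integral (f g : L2 ℂ) : ⟪f, g⟫_ℂ = ∫ x, star (f x) * g x := by
  rw [MeasureTheory.L2.inner_def]
  refine integral_congr_ae (Eventually.of_forall fun x => ?_)
  simp only [RCLike.inner_apply, Complex.star_def]
  exact mul_comm _ _

theorem L2.integrable_star_mul (f g : L2 ℂ) : Integrable fun x => star (f x) * g x := by
  refine (MeasureTheory.L2.integrable_inner f g (𝕜 := ℂ)).congr (Eventually.of_forall fun x => ?_)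
  simp only [RCLike.inner_apply, Complex.star_def]
  exact mul_comm _ _

theorem L2.inner_self (f : L2 ℂ) : ⟪f, f⟫_ℂ = ((‖f‖ ^ 2 : ℝ) : ℂ) := by
  rw [inner_self_eq_norm_sq_to_K]; push_cast; rfl

theorem IsWeakDeriv.exists_rep {f g : L2 ℂ} (h : IsWeakDeriv f g) :
    ∃ F, IsPrimitive F g ∧ f =ᵐ[volume] F :=
  exists_isPrimitive f.locallyIntegrable g.locallyIntegrable h

theorem IsPrimitive.isWeakDeriv {F G : ℝ → ℂ} {f g : L2 ℂ} (h : IsPrimitive F G)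
    (hf : f =ᵐ[volume] F) (hg : g =ᵐ[volume] G) : IsWeakDeriv f g := by
  intro η hη
  have e1 : ∫ x, ((deriv η x : ℝ) : ℂ) * f x = ∫ x, ((deriv η x : ℝ) : ℂ) * F x :=
    integral_congr_ae (by filter_upwards [hf] with x hx; rw [hx])
  have e2 : ∫ x, ((η x : ℝ) : ℂ) * g x = ∫ x, ((η x : ℝ) : ℂ) * G x :=
    integral_congr_ae (by filter_upwards [hg] with x hx; rw [hx])
  rw [e1, e2]
  exact h.integral_test hη

theorem IsPrimitive.congr {F G G' : ℝ → ℂ} (h : IsPrimitive F G) (hG : G =ᵐ[volume] G') :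
    IsPrimitive F G' :=
  ⟨fun x => by
    obtain ⟨s, hs, hi⟩ := h.locallyIntegrable x
    exact ⟨s, hs, hi.congr (ae_restrict_of_ae hG)⟩, fun x => by
    rw [h.eq_add x]
    congr 1
    exact intervalIntegral.integral_congr_ae (by filter_upwards [hG] with t ht _ using ht)⟩

theorem IsPrimitive.conj_mul {F G : ℝ → ℂ} {f g : L2 ℂ} (hF : IsPrimitive F f)
    (hG : IsPrimitive G g) :
    IsPrimitive (fun x => star (F x) * G x) (fun x => star (f x) * G x + star (F x) * g x) :=
  hF.conj.mul hG

/-- Integration by parts. -/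
theorem IsWeakDeriv.inner_left {f f' g g' : L2 ℂ} (hf : IsWeakDeriv f f')
    (hg : IsWeakDeriv g g') : ⟪f', g⟫_ℂ = -⟪f, g'⟫_ℂ := by
  obtain ⟨F, hF, hfF⟩ := hf.exists_rep
  obtain ⟨G, hG, hgG⟩ := hg.exists_rep
  have i1 := (L2.integrable_star_mul f g).congr (g := fun x => star (F x) * G x) (by
    filter_upwards [hfF, hgG] with x h1 h2; rw [h1, h2])
  have e2 : (fun x => star (f' x) * g x) =ᵐ[volume] fun x => star (f' x) * G x := by
    filter_upwards [hgG] with x h1; rw [h1]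
  have e3 : (fun x => star (f x) * g' x) =ᵐ[volume] fun x => star (F x) * g' x := by
    filter_upwards [hfF] with x h1; rw [h1]
  have i2 := (L2.integrable_star_mul f' g).congr e2
  have i3 := (L2.integrable_star_mul f g').congr e3
  have := (hF.conj_mul hG).integral_eq_zero i1 (i2.add i3)
  rw [integral_add i2 i3] at this
  rw [L2.inner_eq_integral, L2.inner_eq_integral, integral_congr_ae e2, integral_congr_ae e3]
  linear_combination this

theorem L2.norm_sq_eq_integral (f : L2 ℂ) : ‖f‖ ^ 2 = ∫ x, ‖f x‖ ^ 2 := by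
  have h := L2.inner_eq_integral f f
  rw [L2.inner_self] at h
  have e : ∀ x, star (f x) * f x = ((‖f x‖ ^ 2 : ℝ) : ℂ) := fun x => by
    rw [Complex.star_def, Complex.conj_mul']; push_cast; rfl
  simp only [e] at h
  rw [integral_complex_ofReal] at h
  exact Complex.ofReal_injective h

theorem L2.integral_norm_mul_norm_le (f g : L2 ℂ) : ∫ x, ‖f x‖ * ‖g x‖ ≤ ‖f‖ * ‖g‖ := by
  have h := integral_mul_norm_le_Lp_mul_Lq (μ := volume) (f := f) (g := g)
    (p := 2) (q := 2) (by constructor <;> norm_num)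
    (by simpa using Lp.memLp f) (by simpa using Lp.memLp g)
  have e : ∀ k : L2 ℂ, (∫ x, ‖k x‖ ^ (2 : ℝ)) ^ (1 / 2 : ℝ) = ‖k‖ := fun k => by
    have : ∫ x, ‖k x‖ ^ (2 : ℝ) = ‖k‖ ^ 2 := by
      rw [L2.norm_sq_eq_integral]; norm_cast
    rw [this, ← Real.sqrt_eq_rpow, Real.sqrt_sq (norm_nonneg _)]
  rwa [e, e] at h

/-- The one-dimensional Sobolev (Agmon) inequality. -/
theorem IsPrimitive.norm_sq_le {F : ℝ → ℂ} {f f' : L2 ℂ} (hF : IsPrimitive F f')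
    (hf : f =ᵐ[volume] F) (x : ℝ) : ‖F x‖ ^ 2 ≤ 2 * ‖f‖ * ‖f'‖ := by
  have i1 := (L2.integrable_star_mul f f).congr (g := fun x => star (F x) * F x) (by
    filter_upwards [hf] with x h1; rw [h1])
  have i2 := (L2.integrable_star_mul f' f).congr (g := fun x => star (f' x) * F x) (by
    filter_upwards [hf] with x h1; rw [h1])
  have i3 := (L2.integrable_star_mul f f').congr (g := fun x => star (F x) * f' x) (by
    filter_upwards [hf] with x h1; rw [h1])
  have key := (hF.conj_mul hF).eq_integral_Iic i1 (i2.add i3) x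
  have e : ‖F x‖ ^ 2 = ‖star (F x) * F x‖ := by simp [sq]
  have i4 : Integrable fun x => 2 * (‖f x‖ * ‖f' x‖) := by
    have := (L2.integrable_star_mul f f').norm
    simp only [norm_mul, norm_star] at this
    exact this.const_mul 2
  rw [e, key]
  calc ‖∫ t in Set.Iic x, (star (f' t) * F t + star (F t) * f' t)‖
      ≤ ∫ t in Set.Iic x, ‖star (f' t) * F t + star (F t) * f' t‖ :=
        norm_integral_le_integral_norm _
    _ ≤ ∫ t, ‖star (f' t) * F t + star (F t) * f' t‖ :=
        setIntegral_le_integral (i2.add i3).norm (Eventually.of_forall fun _ => norm_nonneg _)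
    _ ≤ ∫ t, 2 * (‖f t‖ * ‖f' t‖) := by
        refine integral_mono_ae (i2.add i3).norm i4 ?_
        filter_upwards [hf] with t ht
        rw [ht]
        refine (norm_add_le _ _).trans (le_of_eq ?_)
        simp only [norm_mul, norm_star]; ring
    _ = 2 * ∫ t, ‖f t‖ * ‖f' t‖ := integral_const_mul _ _
    _ ≤ 2 * ‖f‖ * ‖f'‖ := by
        rw [mul_assoc]
        exact mul_le_mul_of_nonneg_left (L2.integral_norm_mul_norm_le f f') zero_le_two

/-! ### Test functions as elements of `L²` -/

theorem IsTest.memLp {η : ℝ → ℝ} (h : IsTest η) : MemLp (fun x => ((η x : ℝ) : ℂ)) 2 volume :=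
  (Complex.continuous_ofReal.comp h.1.continuous).memLp_of_hasCompactSupport
    (h.2.comp_left (g := fun r : ℝ => (r : ℂ)) Complex.ofReal_zero)

/-- The class of a test function in `L²`. -/
noncomputable def IsTest.toL2 {η : ℝ → ℝ} (h : IsTest η) : L2 ℂ := h.memLp.toLp _

theorem IsTest.coeFn_toL2 {η : ℝ → ℝ} (h : IsTest η) :
    h.toL2 =ᵐ[volume] fun x => ((η x : ℝ) : ℂ) := h.memLp.coeFn_toLp

theorem IsTest.inner_toL2 {η : ℝ → ℝ} (h : IsTest η) (f : L2 ℂ) :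
    ⟪h.toL2, f⟫_ℂ = ∫ x, ((η x : ℝ) : ℂ) * f x := by
  rw [L2.inner_eq_integral]
  refine integral_congr_ae ?_
  filter_upwards [h.coeFn_toL2] with x hx
  simp [hx]

theorem isWeakDeriv_iff {f g : L2 ℂ} : IsWeakDeriv f g ↔
    ∀ (η : ℝ → ℝ) (h : IsTest η), ⟪h.deriv.toL2, f⟫_ℂ = -⟪h.toL2, g⟫_ℂ := by
  refine forall₂_congr fun η h => ?_
  rw [h.inner_toL2, h.deriv.inner_toL2]

theorem IsTest.isPrimitive {η : ℝ → ℝ} (h : IsTest η) :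
    IsPrimitive (fun x => ((η x : ℝ) : ℂ)) (fun x => ((_root_.deriv η x : ℝ) : ℂ)) :=
  IsPrimitive.of_hasDerivAt
    (fun x => ((h.1.differentiable (by simp)) x).hasDerivAt.ofReal_comp)
    (Complex.continuous_ofReal.comp h.deriv.1.continuous)

theorem IsTest.isWeakDeriv {η : ℝ → ℝ} (h : IsTest η) : IsWeakDeriv h.toL2 h.deriv.toL2 :=
  h.isPrimitive.isWeakDeriv h.coeFn_toL2 h.deriv.coeFn_toL2

theorem L2.eq_zero_of_inner_test {f : L2 ℂ} (h : ∀ (η : ℝ → ℝ) (h : IsTest η), ⟪h.toL2, f⟫_ℂ = 0) :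
    f = 0 := by
  refine (Lp.eq_zero_iff_ae_eq_zero).2 ?_
  refine ae_eq_zero_of_integral_contDiff_smul_eq_zero f.locallyIntegrable fun g g1 g2 => ?_
  have hg : IsTest g := ⟨g1, g2⟩
  have := h g hg
  rw [hg.inner_toL2] at this
  simpa only [Complex.real_smul] using this

theorem IsWeakDeriv.unique {f g g' : L2 ℂ} (h : IsWeakDeriv f g) (h' : IsWeakDeriv f g') :
    g = g' := by
  rw [isWeakDeriv_iff] at h h'
  refine sub_eq_zero.1 (L2.eq_zero_of_inner_test fun η hη => ?_)
  rw [inner_sub_right]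
  linear_combination h η hη - h' η hη

theorem IsWeakDeriv.neg {f g : L2 ℂ} (h : IsWeakDeriv f g) : IsWeakDeriv (-f) (-g) := by
  have := h.smul (-1)
  simpa using this

theorem IsWeakDeriv.sub {f g f' g' : L2 ℂ} (h : IsWeakDeriv f g) (h' : IsWeakDeriv f' g') :
    IsWeakDeriv (f - f') (g - g') := by
  rw [sub_eq_add_neg, sub_eq_add_neg]
  exact h.add h'.neg

/-- The equation `D² f = c f` with `c > 0` has no nonzero solution in `L²`. -/
theorem IsWeakDeriv.eq_zero_of_second {f f' : L2 ℂ} {c : ℝ} (hc : 0 < c) (h : IsWeakDeriv f f')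
    (h' : IsWeakDeriv f' ((c : ℂ) • f)) : f = 0 := by
  -- Pairing the equation with f and integrating by parts gives c‖f‖² = -‖f'‖².
  have key := h.inner_left h'
  rw [inner_smul_right, L2.inner_self, L2.inner_self] at key
  have : ‖f'‖ ^ 2 = -(c * ‖f‖ ^ 2) := by exact_mod_cast key
  have h1 : ‖f‖ ^ 2 = 0 := by nlinarith [sq_nonneg ‖f'‖, sq_nonneg ‖f‖]
  simpa using h1

/-! ### The graph of the derivative -/

/-- The graph of `c D`, where `D` is the weak derivative. -/
def scaledGraph (c : ℂ) : Submodule ℂ (WithLp 2 (L2 ℂ × L2 ℂ)) where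
  carrier := {p | ∃ g, IsWeakDeriv p.fst g ∧ p.snd = c • g}
  add_mem' := by
    rintro a b ⟨g, hg, hg'⟩ ⟨k, hk, hk'⟩
    exact ⟨g + k, hg.add hk, by rw [WithLp.add_snd, hg', hk', smul_add]⟩
  zero_mem' := ⟨0, IsWeakDeriv.zero, by simp⟩
  smul_mem' := by
    rintro z a ⟨g, hg, hg'⟩
    exact ⟨z • g, hg.smul z, by rw [WithLp.smul_snd, hg', smul_comm]⟩

theorem mem_scaledGraph_iff {c : ℂ} (hc : c ≠ 0) (p : WithLp 2 (L2 ℂ × L2 ℂ)) :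
    p ∈ scaledGraph c ↔ IsWeakDeriv p.fst (c⁻¹ • p.snd) := by
  constructor
  · rintro ⟨g, hg, hg'⟩
    rwa [hg', inv_smul_smul₀ hc]
  · intro h
    exact ⟨_, h, by rw [smul_inv_smul₀ hc]⟩

theorem isClosed_scaledGraph {c : ℂ} (hc : c ≠ 0) :
    IsClosed (scaledGraph c : Set (WithLp 2 (L2 ℂ × L2 ℂ))) := by
  have : (scaledGraph c : Set (WithLp 2 (L2 ℂ × L2 ℂ))) =
      ⋂ (η : ℝ → ℝ), ⋂ (h : IsTest η), {p | ⟪h.deriv.toL2, p.fst⟫_ℂ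
        = -⟪h.toL2, c⁻¹ • p.snd⟫_ℂ} := by
    ext p
    simp only [SetLike.mem_coe, mem_scaledGraph_iff hc, isWeakDeriv_iff, Set.mem_iInter,
      Set.mem_ofPred_eq]
  rw [this]
  refine isClosed_iInter fun η => isClosed_iInter fun h => isClosed_eq ?_ ?_
  · exact Continuous.inner (𝕜 := ℂ) continuous_const (WithLp.prod_continuous_ofLp _ _ _).fst
  · exact (Continuous.inner (𝕜 := ℂ) continuous_const
      ((WithLp.prod_continuous_ofLp _ _ _).snd.const_smul c⁻¹)).neg

instance : CompleteSpace H1 := by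
  have : (H1 : Submodule ℂ _) = scaledGraph 1 := by
    ext p
    rw [mem_scaledGraph_iff one_ne_zero, inv_one, one_smul]
    rfl
  rw [this]
  exact (isClosed_scaledGraph one_ne_zero).completeSpace_coe

/-! ### The space `H¹` -/

namespace H1

/-- The derivative of an element of `H¹`. -/
noncomputable def D (f : H1) : L2 ℂ := f.1.snd

theorem isWeakDeriv (f : H1) : IsWeakDeriv (H1.toL2 f) (H1.D f) := f.2

/-- The element of `H¹` given by a function and its weak derivative. -/
noncomputable def mk (f g : L2 ℂ) (h : IsWeakDeriv f g) : H1 := ⟨WithLp.toLp 2 (f, g), h⟩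

@[simp] theorem toL2_mk (f g : L2 ℂ) (h : IsWeakDeriv f g) : (H1.toL2 (mk f g h)) = f := rfl

@[simp] theorem D_mk (f g : L2 ℂ) (h : IsWeakDeriv f g) : (H1.D (mk f g h)) = g := rfl

/-- The inclusion of `H¹` in `L²`. -/
noncomputable def toL2L : H1 →L[ℂ] L2 ℂ := (WithLp.fstL 2 ℂ (L2 ℂ) (L2 ℂ)).comp H1.subtypeL

/-- The derivative, from `H¹` to `L²`. -/
noncomputable def DL : H1 →L[ℂ] L2 ℂ := (WithLp.sndL 2 ℂ (L2 ℂ) (L2 ℂ)).comp H1.subtypeL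

@[simp] theorem toL2L_apply (f : H1) : toL2L f = (H1.toL2 f) := rfl

theorem norm_sq (f : H1) : ‖f‖ ^ 2 = ‖(H1.toL2 f)‖ ^ 2 + ‖(H1.D f)‖ ^ 2 :=
  WithLp.prod_norm_sq_eq_of_L2 (f : WithLp 2 (L2 ℂ × L2 ℂ))

theorem inner_def (f g : H1) : ⟪f, g⟫_ℂ = ⟪(H1.toL2 f), (H1.toL2 g)⟫_ℂ + ⟪(H1.D f), (H1.D g)⟫_ℂ :=
  WithLp.prod_inner_apply _ _

theorem norm_toL2_le (f : H1) : ‖(H1.toL2 f)‖ ≤ ‖f‖ :=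
  abs_le_of_sq_le_sq' (by nlinarith [norm_sq f, sq_nonneg ‖(H1.D f)‖]) (norm_nonneg _) |>.2

theorem norm_D_le (f : H1) : ‖(H1.D f)‖ ≤ ‖f‖ :=
  abs_le_of_sq_le_sq' (by nlinarith [norm_sq f, sq_nonneg ‖(H1.toL2 f)‖]) (norm_nonneg _) |>.2

theorem tendsto_iff {α : Type*} {l : Filter α} {f : α → H1} {g : H1} :
    Tendsto f l (𝓝 g) ↔
      Tendsto (fun a => (H1.toL2 (f a))) l (𝓝 (H1.toL2 g)) ∧
        Tendsto (fun a => (H1.D (f a))) l (𝓝 (H1.D g)) := by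
  constructor
  · intro h
    exact ⟨(toL2L.continuous.tendsto g).comp h, (DL.continuous.tendsto g).comp h⟩
  · rintro ⟨h1, h2⟩
    rw [tendsto_iff_norm_sub_tendsto_zero]
    have h3 : ∀ a, ‖f a - g‖ = √(‖(H1.toL2 (f a)) - (H1.toL2 g)‖ ^ 2
        + ‖(H1.D (f a)) - (H1.D g)‖ ^ 2) := fun a => by
      rw [← Real.sqrt_sq (norm_nonneg (f a - g)), norm_sq]; rfl
    simp only [h3]
    rw [tendsto_iff_norm_sub_tendsto_zero] at h1 h2
    have := ((h1.pow 2).add (h2.pow 2)).sqrt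
    simpa using this

/-- Agmon's inequality combined with 2ab ≤ a² + b²: the embedding of H¹ in L^∞ has norm at most 1.
-/
theorem norm_sq_rep_le (f : H1) {F : ℝ → ℂ} (hF : IsPrimitive F (H1.D f))
    (hf : (H1.toL2 f) =ᵐ[volume] F)
    (x : ℝ) : ‖F x‖ ≤ ‖f‖ := by
  have := hF.norm_sq_le hf x
  refine abs_le_of_sq_le_sq' ?_ (norm_nonneg _) |>.2
  nlinarith [norm_sq f, sq_nonneg (‖(H1.toL2 f)‖ - ‖(H1.D f)‖)]

theorem ae_norm_le (f : H1) : ∀ᵐ x, ‖(H1.toL2 f) x‖ ≤ ‖f‖ := by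
  obtain ⟨F, hF, hf⟩ := (H1.isWeakDeriv f).exists_rep
  filter_upwards [hf] with x hx
  rw [hx]
  exact (H1.norm_sq_rep_le f) hF hf x

theorem memLp_top (f : H1) : MemLp (H1.toL2 f) ∞ volume :=
  memLp_top_of_bound (Lp.memLp (H1.toL2 f)).1 ‖f‖ (H1.ae_norm_le f)

/-- The Sobolev embedding of `H¹` in `L^∞`. -/
noncomputable def toLinf : H1 →L[ℂ] Lp ℂ ∞ (volume : Measure ℝ) :=
  LinearMap.mkContinuous
    { toFun := fun f => (H1.memLp_top f).toLp _
      map_add' := fun f g => by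
        rw [← MemLp.toLp_add, MemLp.toLp_eq_toLp_iff]
        exact Lp.coeFn_add (H1.toL2 f) (H1.toL2 g)
      map_smul' := fun c f => by
        rw [RingHom.id_apply, ← MemLp.toLp_const_smul, MemLp.toLp_eq_toLp_iff]
        exact Lp.coeFn_smul c (H1.toL2 f) } 1 (fun f => by
        rw [one_mul]
        simp only [LinearMap.coe_mk, AddHom.coe_mk, Lp.norm_toLp, eLpNorm_exponent_top]
        refine ENNReal.toReal_le_of_le_ofReal (norm_nonneg _) ?_
        refine (eLpNormEssSup_le_of_ae_bound (H1.ae_norm_le f)))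

theorem coeFn_toLinf (f : H1) : toLinf f =ᵐ[volume] (H1.toL2 f) := (H1.memLp_top f).coeFn_toLp

end H1

/-! ### Multiplication -/

/-- Multiplication of bounded functions with square integrable functions. -/
noncomputable def bmul : Lp ℂ ∞ (volume : Measure ℝ) →L[ℂ] L2 ℂ →L[ℂ] L2 ℂ :=
  (ContinuousLinearMap.mul ℂ ℂ).holderL volume ∞ 2 2

theorem coeFn_bmul (φ : Lp ℂ ∞ (volume : Measure ℝ)) (f : L2 ℂ) :
    bmul φ f =ᵐ[volume] fun x => φ x * f x :=
  (ContinuousLinearMap.mul ℂ ℂ).coeFn_holder φ f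

/-- Multiplication of a function in `H¹` with a function in `L²`. -/
noncomputable def H1.mul : H1 →L[ℂ] L2 ℂ →L[ℂ] L2 ℂ := bmul.comp H1.toLinf

theorem H1.coeFn_mul (f : H1) (g : L2 ℂ) : H1.mul f g =ᵐ[volume] fun x => (H1.toL2 f) x * g x := by
  filter_upwards [coeFn_bmul (H1.toLinf f) g, (H1.coeFn_toLinf f)] with x h1 h2
  rw [← h2]; exact h1

theorem H1.norm_mul_le (f : H1) (g : L2 ℂ) : ‖H1.mul f g‖ ≤ ‖f‖ * ‖g‖ := by
  refine Lp.norm_le_mul_norm_of_ae_le_mul ?_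
  filter_upwards [(H1.coeFn_mul f) g, (H1.ae_norm_le f)] with x h1 h2
  rw [h1, norm_mul]
  gcongr

/-- A bounded measurable weight. -/
structure Weight where
  toFun : ℝ → ℝ
  measurable : Measurable toFun
  bound : ∃ C, ∀ x, |toFun x| ≤ C

namespace Weight

theorem memLp (φ : Weight) : MemLp (fun x => ((φ.toFun x : ℝ) : ℂ)) ∞ volume := by
  obtain ⟨C, hC⟩ := φ.bound
  exact memLp_top_of_bound (Complex.measurable_ofReal.comp φ.measurable).aestronglyMeasurable C
    (Eventually.of_forall fun x => by simpa using hC x)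

/-- Multiplication with a weight, as an operator on `L²`. -/
noncomputable def op (φ : Weight) : L2 ℂ →L[ℂ] L2 ℂ := bmul (φ.memLp.toLp _)

theorem coeFn_op (φ : Weight) (f : L2 ℂ) :
    φ.op f =ᵐ[volume] fun x => ((φ.toFun x : ℝ) : ℂ) * f x := by
  filter_upwards [coeFn_bmul (φ.memLp.toLp _) f, φ.memLp.coeFn_toLp] with x h1 h2
  rw [← h2]; exact h1

theorem norm_op_le (φ : Weight) {C : ℝ} (hC : ∀ x, |φ.toFun x| ≤ C) (f : L2 ℂ) :
    ‖φ.op f‖ ≤ C * ‖f‖ := by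
  refine Lp.norm_le_mul_norm_of_ae_le_mul ?_
  filter_upwards [φ.coeFn_op f] with x h1
  rw [h1, norm_mul, Complex.norm_real, Real.norm_eq_abs]
  gcongr
  exact hC x

theorem inner_op (φ : Weight) (f g : L2 ℂ) : ⟪φ.op f, g⟫_ℂ = ⟪f, φ.op g⟫_ℂ := by
  rw [L2.inner_eq_integral, L2.inner_eq_integral]
  refine integral_congr_ae ?_
  filter_upwards [φ.coeFn_op f, φ.coeFn_op g] with x h1 h2
  rw [h1, h2]
  simp only [Complex.star_def, map_mul, Complex.conj_ofReal]
  ring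

theorem op_op (φ χ κ : Weight) (h : ∀ x, φ.toFun x * χ.toFun x = κ.toFun x) (f : L2 ℂ) :
    φ.op (χ.op f) = κ.op f := by
  refine Lp.ext ?_
  filter_upwards [φ.coeFn_op (χ.op f), χ.coeFn_op f, κ.coeFn_op f] with x h1 h2 h3
  rw [h1, h2, h3, ← h x]
  push_cast; ring

theorem op_comm (φ χ : Weight) (f : L2 ℂ) : φ.op (χ.op f) = χ.op (φ.op f) := by
  refine Lp.ext ?_
  filter_upwards [φ.coeFn_op (χ.op f), χ.coeFn_op f, χ.coeFn_op (φ.op f), φ.coeFn_op f]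
    with x h1 h2 h3 h4
  rw [h1, h2, h3, h4]
  ring

/-- The second weight is the derivative of the first one. -/
def HasDeriv (φ φ' : Weight) : Prop :=
  IsPrimitive (fun x => ((φ.toFun x : ℝ) : ℂ)) (fun x => ((φ'.toFun x : ℝ) : ℂ))

theorem HasDeriv.isWeakDeriv {φ φ' : Weight} (h : φ.HasDeriv φ') {f g : L2 ℂ}
    (hf : IsWeakDeriv f g) : IsWeakDeriv (φ.op f) (φ'.op f + φ.op g) := by
  obtain ⟨F, hF, hfF⟩ := hf.exists_rep
  refine (IsPrimitive.mul h hF).isWeakDeriv ?_ ?_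
  · filter_upwards [φ.coeFn_op f, hfF] with x h1 h2
    rw [h1, h2]
  · filter_upwards [Lp.coeFn_add (φ'.op f) (φ.op g), φ'.coeFn_op f, φ.coeFn_op g, hfF]
      with x h1 h2 h3 h4
    rw [h1, Pi.add_apply, h2, h3, h4]

end Weight

/-! ### Conjugation and the Leibniz rule in H¹. -/

/-- Complex conjugation on `L²`. -/
noncomputable def L2.conj : L2 ℂ →L[ℝ] L2 ℂ :=
  Complex.conjCLE.toContinuousLinearMap.compLpL 2 volume

theorem L2.coeFn_conj (f : L2 ℂ) : L2.conj f =ᵐ[volume] fun x => star (f x) :=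
  Complex.conjCLE.toContinuousLinearMap.coeFn_compLpL f

theorem L2.inner_conj_conj (f g : L2 ℂ) : ⟪L2.conj f, L2.conj g⟫_ℂ = ⟪g, f⟫_ℂ := by
  rw [L2.inner_eq_integral, L2.inner_eq_integral]
  refine integral_congr_ae ?_
  filter_upwards [L2.coeFn_conj f, L2.coeFn_conj g] with x h1 h2
  rw [h1, h2, star_star, mul_comm]

theorem L2.norm_conj (f : L2 ℂ) : ‖L2.conj f‖ = ‖f‖ := by
  have h := L2.inner_conj_conj f f
  rw [L2.inner_self, L2.inner_self, Complex.ofReal_inj] at h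
  exact (pow_left_inj₀ (norm_nonneg _) (norm_nonneg _) two_ne_zero).1 h

theorem IsWeakDeriv.conj {f g : L2 ℂ} (h : IsWeakDeriv f g) :
    IsWeakDeriv (L2.conj f) (L2.conj g) := by
  obtain ⟨F, hF, hfF⟩ := h.exists_rep
  refine hF.conj.isWeakDeriv ?_ (L2.coeFn_conj g)
  filter_upwards [L2.coeFn_conj f, hfF] with x h1 h2
  rw [h1, h2]

theorem H1.isWeakDeriv_mul (f g : H1) :
    IsWeakDeriv (H1.mul f (H1.toL2 g)) (H1.mul f (H1.D g) + H1.mul g (H1.D f)) := by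
  obtain ⟨F, hF, hfF⟩ := (H1.isWeakDeriv f).exists_rep
  obtain ⟨G, hG, hgG⟩ := (H1.isWeakDeriv g).exists_rep
  refine (hF.mul hG).isWeakDeriv ?_ ?_
  · filter_upwards [(H1.coeFn_mul f) (H1.toL2 g), hfF, hgG] with x h1 h2 h3
    rw [h1, h2, h3]
  · filter_upwards [Lp.coeFn_add (H1.mul f (H1.D g)) (H1.mul g (H1.D f)), (H1.coeFn_mul f) (H1.D g),
      (H1.coeFn_mul g) (H1.D f),
      hfF, hgG] with x h1 h2 h3 h4 h5
    rw [h1, Pi.add_apply, h2, h3, h4, h5]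
    ring

/-! ### Density of test functions -/

/-- A test function as an element of `H¹`. -/
noncomputable def IsTest.toH1 {η : ℝ → ℝ} (h : IsTest η) : H1 :=
  H1.mk h.toL2 h.deriv.toL2 h.isWeakDeriv

/-- A closed linear condition on `H¹` which holds for test functions holds everywhere. -/
theorem H1.test_induction {p : H1 → Prop}
    (test : ∀ (η : ℝ → ℝ) (h : IsTest η), p h.toH1)
    (zero : p 0) (add : ∀ f g, p f → p g → p (f + g)) (smul : ∀ (c : ℂ) f, p f → p (c • f))
    (closed : IsClosed {f | p f}) (f : H1) : p f := by
  let K : Submodule ℂ H1 := Submodule.span ℂ {f | ∃ (η : ℝ → ℝ) (h : IsTest η), f = h.toH1}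
  have hK : K.topologicalClosure = ⊤ := by
    rw [Submodule.topologicalClosure_eq_top_iff, Submodule.eq_bot_iff]
    intro h hh
    -- Orthogonality to all test functions in H¹ is the weak form of h'' = h, which has only the
    -- zero solution in L².
    have key : IsWeakDeriv (H1.D h) (((1 : ℝ) : ℂ) • H1.toL2 h) := by
      rw [isWeakDeriv_iff]
      intro η hη
      have := (Submodule.mem_orthogonal K h).1 hh hη.toH1 (Submodule.subset_span ⟨η, hη, rfl⟩)
      rw [H1.inner_def] at this
      simp only [IsTest.toH1, H1.toL2_mk, H1.D_mk] at this
      rw [Complex.ofReal_one, one_smul]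
      linear_combination this
    have h0 := (H1.isWeakDeriv h).eq_zero_of_second one_pos key
    have h1 : H1.D h = 0 := by
      have := H1.isWeakDeriv h
      rw [h0] at this
      exact this.unique IsWeakDeriv.zero
    have := H1.norm_sq h
    rw [h0, h1] at this
    simpa using this
  have hf : f ∈ K.topologicalClosure := hK ▸ Submodule.mem_top
  have hKp : (K : Set H1) ⊆ {f | p f} := by
    intro g hg
    refine Submodule.span_induction (p := fun g _ => p g) ?_ zero (fun f g _ _ => add f g)
      (fun c f _ => smul c f) hg
    rintro _ ⟨η, h, rfl⟩
    exact test η h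
  exact closure_minimal hKp closed hf

theorem H1.denseRange_toL2 : DenseRange H1.toL2L := by
  have : (LinearMap.range (H1.toL2L : H1 →ₗ[ℂ] L2 ℂ)).topologicalClosure = ⊤ := by
    rw [Submodule.topologicalClosure_eq_top_iff, Submodule.eq_bot_iff]
    intro h hh
    refine L2.eq_zero_of_inner_test fun η hη => ?_
    exact (Submodule.mem_orthogonal _ h).1 hh _ ⟨hη.toH1, rfl⟩
  have h2 := congrArg (fun K : Submodule ℂ (L2 ℂ) => (K : Set (L2 ℂ))) this
  simp only [Submodule.topologicalClosure_coe, Submodule.top_coe] at h2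
  exact dense_iff_closure_eq.2 h2

/-! ### The resolvent of the Laplacian -/

/-- The regularization scales. -/
noncomputable def scale (k : ℕ) : ℝ := 1 / ((k : ℝ) + 1)

theorem scale_pos (k : ℕ) : 0 < scale k := Nat.one_div_pos_of_nat

theorem tendsto_scale : Tendsto scale atTop (𝓝 0) := tendsto_one_div_add_atTop_nhds_zero_nat

theorem scale_ne (k : ℕ) : ((scale k : ℝ) : ℂ) ≠ 0 := Complex.ofReal_ne_zero.2 (scale_pos k).ne'

instance (k : ℕ) : CompleteSpace (scaledGraph ((scale k : ℝ) : ℂ)) :=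
  (isClosed_scaledGraph (scale_ne k)).completeSpace_coe

/-- The projection of `(f, 0)` to the graph of `scale k • D`. -/
noncomputable def graphProj (k : ℕ) : L2 ℂ →L[ℂ] WithLp 2 (L2 ℂ × L2 ℂ) :=
  (scaledGraph ((scale k : ℝ) : ℂ)).starProjection.comp
    ((WithLp.prodContinuousLinearEquiv 2 ℂ (L2 ℂ) (L2 ℂ)).symm.toContinuousLinearMap.comp
      (ContinuousLinearMap.inl ℂ (L2 ℂ) (L2 ℂ)))

/-- The resolvent `(1 - (scale k)² D²)⁻¹`. -/
noncomputable def res (k : ℕ) : L2 ℂ →L[ℂ] L2 ℂ :=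
  (WithLp.fstL 2 ℂ (L2 ℂ) (L2 ℂ)).comp (graphProj k)

/-- The derivative of the resolvent. -/
noncomputable def resD (k : ℕ) : L2 ℂ →L[ℂ] L2 ℂ :=
  (((scale k : ℝ) : ℂ)⁻¹) • (WithLp.sndL 2 ℂ (L2 ℂ) (L2 ℂ)).comp (graphProj k)

/-- The Laplacian of the resolvent. -/
noncomputable def resDD (k : ℕ) : L2 ℂ →L[ℂ] L2 ℂ :=
  (((scale k ^ 2)⁻¹ : ℝ) : ℂ) • (res k - ContinuousLinearMap.id ℂ (L2 ℂ))

theorem resDD_apply (k : ℕ) (f : L2 ℂ) :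
    resDD k f = (((scale k ^ 2)⁻¹ : ℝ) : ℂ) • (res k f - f) := rfl

theorem isWeakDeriv_res (k : ℕ) (f : L2 ℂ) : IsWeakDeriv (res k f) (resD k f) :=
  (mem_scaledGraph_iff (scale_ne k) _).1 (Submodule.starProjection_apply_mem _ _)

theorem norm_res_le (k : ℕ) (f : L2 ℂ) : ‖res k f‖ ≤ ‖f‖ := by
  have h1 : ‖graphProj k f‖ ≤ ‖f‖ := by
    refine (Submodule.norm_starProjection_apply_le _ _).trans (le_of_eq ?_)
    have := WithLp.prod_norm_sq_eq_of_L2 (WithLp.toLp 2 (f, (0 : L2 ℂ)))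
    refine (pow_left_inj₀ (norm_nonneg _) (norm_nonneg _) two_ne_zero).1 (this.trans ?_)
    simp
  have h2 := WithLp.prod_norm_sq_eq_of_L2 (graphProj k f)
  refine le_trans ?_ h1
  change ‖(graphProj k f).fst‖ ≤ _
  exact abs_le_of_sq_le_sq' (by nlinarith [sq_nonneg ‖(graphProj k f).snd‖]) (norm_nonneg _) |>.2

/-- With s the scale and r = R_k f, the projection of (f, 0) on the graph is (r, s r'), and the
residual (f − r, −s r') is orthogonal to every (g, s g'). This is the weak form of r − s² r'' = f.
-/
theorem inner_sub_res (k : ℕ) (f : L2 ℂ) {g g' : L2 ℂ} (h : IsWeakDeriv g g') :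
    ⟪f - res k f, g⟫_ℂ = ((scale k ^ 2 : ℝ) : ℂ) * ⟪resD k f, g'⟫_ℂ := by
  have hmem : WithLp.toLp 2 (g, ((scale k : ℝ) : ℂ) • g') ∈ scaledGraph ((scale k : ℝ) : ℂ) :=
    ⟨g', h, rfl⟩
  have key := Submodule.starProjection_inner_eq_zero (WithLp.toLp 2 (f, (0 : L2 ℂ))) _ hmem
  rw [WithLp.prod_inner_apply] at key
  have e1 : (WithLp.toLp 2 (f, (0 : L2 ℂ)) -
      (scaledGraph ((scale k : ℝ) : ℂ)).starProjection (WithLp.toLp 2 (f, 0))).ofLp.1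
      = f - res k f := rfl
  have e2 : (WithLp.toLp 2 (f, (0 : L2 ℂ)) -
      (scaledGraph ((scale k : ℝ) : ℂ)).starProjection (WithLp.toLp 2 (f, 0))).ofLp.2
      = -(((scale k : ℝ) : ℂ) • resD k f) := by
    change (0 : L2 ℂ) - (graphProj k f).snd = -(((scale k : ℝ) : ℂ) •
      (((scale k : ℝ) : ℂ)⁻¹ • (graphProj k f).snd))
    rw [smul_inv_smul₀ (scale_ne k), zero_sub]
  rw [e1, e2] at key
  simp only [inner_neg_left, inner_smul_left, inner_smul_right, Complex.conj_ofReal] at key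
  push_cast
  linear_combination key

theorem isWeakDeriv_resD (k : ℕ) (f : L2 ℂ) : IsWeakDeriv (resD k f) (resDD k f) := by
  rw [isWeakDeriv_iff]
  intro η hη
  have h1 := inner_sub_res k f hη.isWeakDeriv
  have h2 := congrArg (starRingEnd ℂ) h1
  rw [map_mul, inner_conj_symm, inner_conj_symm, Complex.conj_ofReal] at h2
  rw [resDD_apply, inner_smul_right, ← neg_sub f, inner_neg_right, h2]
  have := scale_ne k
  push_cast
  field_simp

theorem inner_res (k : ℕ) (f g : L2 ℂ) : ⟪res k f, g⟫_ℂ = ⟪f, res k g⟫_ℂ := by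
  have h := Submodule.inner_starProjection_left_eq_right (scaledGraph ((scale k : ℝ) : ℂ))
    (WithLp.toLp 2 (f, (0 : L2 ℂ))) (WithLp.toLp 2 (g, (0 : L2 ℂ)))
  rw [WithLp.prod_inner_apply, WithLp.prod_inner_apply] at h
  simp only [inner_zero_left, inner_zero_right, add_zero] at h
  exact h

theorem res_eq (k : ℕ) (f : L2 ℂ) : f = res k f - ((scale k ^ 2 : ℝ) : ℂ) • resDD k f := by
  rw [resDD_apply, smul_smul, ← Complex.ofReal_mul,
    mul_inv_cancel₀ (pow_ne_zero 2 (scale_pos k).ne')]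
  simp

/-- The non-regularized argument is rewritten on each side as R − s²D²R; integration by parts then
applies to the regularized functions. -/
theorem inner_resD (k : ℕ) (f g : L2 ℂ) : ⟪resD k f, g⟫_ℂ = -⟪f, resD k g⟫_ℂ := by
  conv_lhs => rw [res_eq k g]
  conv_rhs => rw [res_eq k f]
  have h2 := (isWeakDeriv_res k f).inner_left (isWeakDeriv_res k g)
  have h3 := (isWeakDeriv_resD k f).inner_left (isWeakDeriv_resD k g)
  simp only [inner_sub_left, inner_sub_right, inner_smul_left, inner_smul_right,
    Complex.conj_ofReal]
  linear_combination h2 - ((scale k ^ 2 : ℝ) : ℂ) * h3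

/-- The resolvent commutes with D because the commutator applied to f is an L² solution of D²h =
s⁻²h, hence zero. -/
theorem resD_eq_res (k : ℕ) {f f' : L2 ℂ} (h : IsWeakDeriv f f') : resD k f = res k f' := by
  have h1 := (isWeakDeriv_resD k f).sub (isWeakDeriv_res k f')
  have h2 : IsWeakDeriv (resDD k f - resD k f')
      ((((scale k ^ 2)⁻¹ : ℝ) : ℂ) • (resD k f - res k f')) := by
    have := (((isWeakDeriv_res k f).sub h).smul (((scale k ^ 2)⁻¹ : ℝ) : ℂ)).sub
      (isWeakDeriv_resD k f')
    have e : (((scale k ^ 2)⁻¹ : ℝ) : ℂ) • (resD k f - res k f')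
        = (((scale k ^ 2)⁻¹ : ℝ) : ℂ) • (resD k f - f') - resDD k f' := by
      rw [resDD_apply, ← smul_sub]; congr 1; abel
    rw [e]
    exact this
  exact sub_eq_zero.1 (h1.eq_zero_of_second (inv_pos.2 (pow_pos (scale_pos k) 2)) h2)

/-- Testing the resolvent equation with R_k f gives s²‖(R_k f)'‖² = Re⟨f, R_k f⟩ − ‖R_k f‖². -/
theorem norm_resD_le (k : ℕ) (f : L2 ℂ) : scale k * ‖resD k f‖ ≤ ‖f‖ := by
  have h := inner_sub_res k f (isWeakDeriv_res k f)
  have h2 := congrArg Complex.re h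
  rw [inner_sub_left, L2.inner_self, L2.inner_self, ← Complex.ofReal_mul, Complex.sub_re,
    Complex.ofReal_re, Complex.ofReal_re] at h2
  have h3 : (⟪f, res k f⟫_ℂ).re ≤ ‖f‖ * ‖f‖ :=
    (Complex.re_le_norm _).trans ((norm_inner_le_norm _ _).trans
      (mul_le_mul_of_nonneg_left (norm_res_le k f) (norm_nonneg _)))
  refine abs_le_of_sq_le_sq' ?_ (norm_nonneg _) |>.2
  nlinarith [sq_nonneg ‖res k f‖]

theorem norm_res_sub_le (k : ℕ) {f f' : L2 ℂ} (h : IsWeakDeriv f f') :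
    ‖res k f - f‖ ≤ scale k * ‖f'‖ := by
  have h1 : res k f - f = ((scale k ^ 2 : ℝ) : ℂ) • resD k f' := by
    have e1 : resDD k f = resD k f' := by
      refine (isWeakDeriv_resD k f).unique ?_
      rw [resD_eq_res k h]
      exact isWeakDeriv_res k f'
    have := res_eq k f
    rw [e1] at this
    nth_rewrite 2 [this]
    abel
  rw [h1, norm_smul, Complex.norm_real, Real.norm_eq_abs, abs_of_pos (pow_pos (scale_pos k) 2),
    sq, mul_assoc]
  exact mul_le_mul_of_nonneg_left (norm_resD_le k f') (scale_pos k).le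

/-- Convergence holds at rate s_k on the dense subspace H¹ and extends to L² because the resolvents
are contractions. -/
theorem tendsto_res (f : L2 ℂ) : Tendsto (fun k => res k f) atTop (𝓝 f) := by
  rw [Metric.tendsto_atTop]
  intro ε hε
  obtain ⟨g, hg⟩ := H1.denseRange_toL2.exists_dist_lt f (show 0 < ε / 3 by positivity)
  have h0 : Tendsto (fun k => scale k * ‖H1.D g‖) atTop (𝓝 0) := by
    simpa using tendsto_scale.mul_const ‖H1.D g‖
  obtain ⟨N, hN⟩ := (h0.eventually (gt_mem_nhds (show 0 < ε / 3 by positivity))).exists_forall_of_atTop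
  refine ⟨N, fun k hk => ?_⟩
  rw [dist_eq_norm] at hg ⊢
  have h1 := norm_res_le k (f - H1.toL2L g)
  have h2 := norm_res_sub_le k (H1.isWeakDeriv g)
  have h3 := hN k hk
  have e : res k f - f = res k (f - H1.toL2L g) + (res k (H1.toL2 g) - H1.toL2 g)
      - (f - H1.toL2L g) := by
    rw [map_sub, H1.toL2L_apply]; abel
  rw [e]
  calc _ ≤ ‖res k (f - H1.toL2L g)‖ + ‖res k (H1.toL2 g) - H1.toL2 g‖ + ‖f - H1.toL2L g‖ :=
        (norm_sub_le _ _).trans (by gcongr; exact norm_add_le _ _)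
    _ < ε := by linarith

/-- The resolvent, with values in `H¹`. -/
noncomputable def resH1 (k : ℕ) (f : L2 ℂ) : H1 := H1.mk (res k f) (resD k f) (isWeakDeriv_res k f)

theorem continuous_resH1 (k : ℕ) : Continuous (resH1 k) := by
  rw [continuous_iff_continuousAt]
  intro f
  exact H1.tendsto_iff.2 ⟨(res k).continuous.tendsto f, (resD k).continuous.tendsto f⟩

theorem tendsto_resH1 (f : H1) : Tendsto (fun k => resH1 k (H1.toL2 f)) atTop (𝓝 f) := by
  rw [H1.tendsto_iff]
  refine ⟨tendsto_res _, ?_⟩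
  have : ∀ k, H1.D (resH1 k (H1.toL2 f)) = res k (H1.D f) := fun k =>
    resD_eq_res k (H1.isWeakDeriv f)
  simp only [this]
  exact tendsto_res _

theorem norm_resH1_le (k : ℕ) (f : H1) : ‖resH1 k (H1.toL2 f)‖ ≤ ‖f‖ := by
  refine abs_le_of_sq_le_sq' ?_ (norm_nonneg _) |>.2
  rw [H1.norm_sq, H1.norm_sq f]
  have : H1.D (resH1 k (H1.toL2 f)) = res k (H1.D f) := resD_eq_res k (H1.isWeakDeriv f)
  rw [this]
  change ‖res k _‖ ^ 2 + _ ≤ _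
  gcongr <;> exact norm_res_le _ _

/-! ### The real inner product -/

theorem L2.real_inner_eq_re (f g : L2 ℂ) : ⟪f, g⟫_ℝ = (⟪f, g⟫_ℂ).re := by
  rw [MeasureTheory.L2.inner_def, L2.inner_eq_integral]
  have h := Complex.reCLM.integral_comp_comm (L2.integrable_star_mul f g)
  simp only [Complex.reCLM_apply] at h
  rw [← h]
  refine integral_congr_ae (Eventually.of_forall fun x => ?_)
  simp only [Complex.inner, Complex.star_def]
  rw [mul_comm]

theorem L2.real_inner_eq_integral (f g : L2 ℂ) : ⟪f, g⟫_ℝ = ∫ x, (star (f x) * g x).re := by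
  rw [MeasureTheory.L2.inner_def]
  refine integral_congr_ae (Eventually.of_forall fun x => ?_)
  simp only [Complex.inner, Complex.star_def]
  rw [mul_comm]

theorem L2.inner_I_left (f g : L2 ℂ) : ⟪Complex.I • f, g⟫_ℝ = -⟪f, Complex.I • g⟫_ℝ := by
  rw [real_inner_eq_re, real_inner_eq_re, inner_smul_left, inner_smul_right]
  simp

/-- A symmetric operator has real quadratic form. -/
theorem L2.inner_I_of_symm {A : L2 ℂ →L[ℂ] L2 ℂ} (hA : ∀ f g, ⟪A f, g⟫_ℝ = ⟪f, A g⟫_ℝ) (f : L2 ℂ) :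
    ⟪A f, Complex.I • f⟫_ℝ = 0 := by
  have h := hA f (Complex.I • f)
  rw [map_smul, ← neg_eq_iff_eq_neg.2 (L2.inner_I_left f (A f)), real_inner_comm (A f)] at h
  linarith

theorem L2.inner_I_self (f : L2 ℂ) : ⟪f, Complex.I • f⟫_ℝ = 0 :=
  L2.inner_I_of_symm (A := ContinuousLinearMap.id ℂ _) (fun _ _ => rfl) f

theorem Weight.real_inner_op (φ : Weight) (f g : L2 ℂ) : ⟪φ.op f, g⟫_ℝ = ⟪f, φ.op g⟫_ℝ := by
  rw [L2.real_inner_eq_re, φ.inner_op, L2.real_inner_eq_re]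

theorem real_inner_res (k : ℕ) (f g : L2 ℂ) : ⟪res k f, g⟫_ℝ = ⟪f, res k g⟫_ℝ := by
  rw [L2.real_inner_eq_re, inner_res, L2.real_inner_eq_re]

theorem IsWeakDeriv.real_inner_left {f f' g g' : L2 ℂ} (hf : IsWeakDeriv f f')
    (hg : IsWeakDeriv g g') : ⟪f', g⟫_ℝ = -⟪f, g'⟫_ℝ := by
  rw [L2.real_inner_eq_re, hf.inner_left hg, L2.real_inner_eq_re, Complex.neg_re]

theorem Weight.HasDeriv.two_mul_inner {φ φ' : Weight} (h : φ.HasDeriv φ') {f f' : L2 ℂ}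
    (hf : IsWeakDeriv f f') : 2 * ⟪φ.op f, f'⟫_ℝ = -⟪φ'.op f, f⟫_ℝ := by
  have h1 := (h.isWeakDeriv hf).real_inner_left hf
  rw [inner_add_left, φ.real_inner_op f', ← real_inner_comm f'] at h1
  linarith

/-! ### Weak evolution equations -/

theorem intervalIntegrable_of_continuousOn_Ioi {E : Type*} [NormedAddCommGroup E] {f : ℝ → E}
    (hf : ContinuousOn f (Set.Ioi 0)) {s t : ℝ} (hs : 0 < s) (ht : 0 < t) :
    IntervalIntegrable f volume s t :=
  (hf.mono fun x hx => by
    rcases Set.mem_uIcc.1 hx with h | h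
    · exact hs.trans_le h.1
    · exact ht.trans_le h.1).intervalIntegrable

theorem hasDerivAt_integral_of_continuousOn_Ioi {E : Type*} [NormedAddCommGroup E]
    [NormedSpace ℝ E] [CompleteSpace E] {f : ℝ → E} (hf : ContinuousOn f (Set.Ioi 0)) {s t : ℝ}
    (hs : 0 < s) (ht : 0 < t) : HasDerivAt (fun r => ∫ τ in s..r, f τ) (f t) t := by
  refine intervalIntegral.integral_hasDerivAt_right
    (intervalIntegrable_of_continuousOn_Ioi hf hs ht) ?_
    (hf.continuousAt (Ioi_mem_nhds ht))
  exact ContinuousOn.stronglyMeasurableAtFilter isOpen_Ioi hf t ht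

/-- A limit of differentiable functions with dominated convergence of the derivatives. -/
theorem hasDerivAt_of_tendsto {F G : ℕ → ℝ → ℝ} {f g B : ℝ → ℝ}
    (hF : ∀ k t, 0 < t → HasDerivAt (F k) (G k t) t)
    (hG : ∀ k, ContinuousOn (G k) (Set.Ioi 0))
    (hFf : ∀ t, 0 < t → Tendsto (fun k => F k t) atTop (𝓝 (f t)))
    (hGg : ∀ t, 0 < t → Tendsto (fun k => G k t) atTop (𝓝 (g t)))
    (hB : ∀ k t, 0 < t → |G k t| ≤ B t) (hBc : ContinuousOn B (Set.Ioi 0))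
    (hg : ContinuousOn g (Set.Ioi 0)) {t : ℝ} (ht : 0 < t) : HasDerivAt f (g t) t := by
  -- The integrated form of the derivative passes to the limit; continuity of g then returns the
  -- pointwise derivative.
  have key : ∀ r, 0 < r → f r = f t + ∫ τ in t..r, g τ := by
    intro r hr
    have hpos : ∀ x ∈ Set.uIoc t r, 0 < x := fun x hx => by
      rcases Set.mem_uIoc.1 hx with h | h
      · exact ht.trans h.1
      · exact hr.trans h.1
    have h1 : Tendsto (fun k => ∫ τ in t..r, G k τ) atTop (𝓝 (∫ τ in t..r, g τ)) := by
      refine intervalIntegral.tendsto_integral_filter_of_dominated_convergence B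
        (Eventually.of_forall fun k =>
          ((intervalIntegrable_of_continuousOn_Ioi (hG k) ht hr).def'.aestronglyMeasurable))
        (Eventually.of_forall fun k => Eventually.of_forall fun x hx => hB k x (hpos x hx))
        (intervalIntegrable_of_continuousOn_Ioi hBc ht hr)
        (Eventually.of_forall fun x hx => hGg x (hpos x hx))
    have h2 : ∀ k, ∫ τ in t..r, G k τ = F k r - F k t := fun k =>
      intervalIntegral.integral_eq_sub_of_hasDerivAt (fun x hx => hF k x (by
        rcases Set.mem_uIcc.1 hx with h | h
        · exact ht.trans_le h.1
        · exact hr.trans_le h.1)) (intervalIntegrable_of_continuousOn_Ioi (hG k) ht hr)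
    simp only [h2] at h1
    have := tendsto_nhds_unique h1 ((hFf r hr).sub (hFf t ht))
    linarith
  have h3 := (hasDerivAt_integral_of_continuousOn_Ioi hg ht ht).const_add (f t)
  refine h3.congr_of_eventuallyEq ?_
  filter_upwards [Ioi_mem_nhds ht] with r hr using key r hr

/-- The weak form of `f_t = -D a + b` for `t > 0`, tested against functions in `H¹`. -/
structure WeakEq (f a b : ℝ → L2 ℂ) : Prop where
  left : ContinuousOn f (Set.Ioi 0)
  flux : ContinuousOn a (Set.Ioi 0)
  source : ContinuousOn b (Set.Ioi 0)
  eq : ∀ s t, 0 < s → 0 < t → ∀ η : H1, ⟪H1.toL2 η, f t - f s⟫_ℂ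
    = ⟪H1.D η, ∫ τ in s..t, a τ⟫_ℂ + ⟪H1.toL2 η, ∫ τ in s..t, b τ⟫_ℂ

/-- The integrated equation is conjugate-linear and continuous in the test function for the H¹ norm,
so density extends it from test functions to H¹. The extension is needed because the resolvents will
serve as test functions, and their supports need not be compact. -/
theorem WeakEq.of_test {f a b : ℝ → L2 ℂ} (hf : ContinuousOn f (Set.Ioi 0))
    (ha : ContinuousOn a (Set.Ioi 0)) (hb : ContinuousOn b (Set.Ioi 0))
    (h : ∀ (η : ℝ → ℝ) (hη : IsTest η), ∀ t, 0 < t →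
      HasDerivAt (fun s => ⟪hη.toL2, f s⟫_ℂ) (⟪hη.deriv.toL2, a t⟫_ℂ + ⟪hη.toL2, b t⟫_ℂ) t) :
    WeakEq f a b := by
  refine ⟨hf, ha, hb, fun s t hs ht η => ?_⟩
  refine H1.test_induction (p := fun η => ⟪H1.toL2 η, f t - f s⟫_ℂ
    = ⟪H1.D η, ∫ τ in s..t, a τ⟫_ℂ + ⟪H1.toL2 η, ∫ τ in s..t, b τ⟫_ℂ) ?_ ?_ ?_ ?_ ?_ η
  · intro η hη
    change ⟪hη.toL2, f t - f s⟫_ℂ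
      = ⟪hη.deriv.toL2, ∫ τ in s..t, a τ⟫_ℂ + ⟪hη.toL2, ∫ τ in s..t, b τ⟫_ℂ
    have ia := intervalIntegrable_of_continuousOn_Ioi ha hs ht
    have ib := intervalIntegrable_of_continuousOn_Ioi hb hs ht
    have e1 := ((innerSL ℂ hη.deriv.toL2).restrictScalars ℝ).intervalIntegral_comp_comm ia
    have e2 := ((innerSL ℂ hη.toL2).restrictScalars ℝ).intervalIntegral_comp_comm ib
    simp only [ContinuousLinearMap.coe_restrictScalars', innerSL_apply_apply] at e1 e2
    have ca : ContinuousOn (fun τ => ⟪hη.deriv.toL2, a τ⟫_ℂ) (Set.Ioi 0) :=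
      (innerSL ℂ hη.deriv.toL2).continuous.comp_continuousOn ha
    have cb : ContinuousOn (fun τ => ⟪hη.toL2, b τ⟫_ℂ) (Set.Ioi 0) :=
      (innerSL ℂ hη.toL2).continuous.comp_continuousOn hb
    rw [← e1, ← e2, ← intervalIntegral.integral_add
      (intervalIntegrable_of_continuousOn_Ioi ca hs ht)
      (intervalIntegrable_of_continuousOn_Ioi cb hs ht),
      intervalIntegral.integral_eq_sub_of_hasDerivAt (f := fun s => ⟪hη.toL2, f s⟫_ℂ)
        (fun x hx => h η hη x (by
          rcases Set.mem_uIcc.1 hx with h | h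
          · exact hs.trans_le h.1
          · exact ht.trans_le h.1))
        (intervalIntegrable_of_continuousOn_Ioi (ca.add cb) hs ht), inner_sub_right]
  · have h0 : H1.toL2 0 = 0 := rfl
    have h1 : H1.D 0 = 0 := rfl
    simp [h0, h1]
  · intro x y hx hy
    have h0 : H1.toL2 (x + y) = H1.toL2 x + H1.toL2 y := rfl
    have h1 : H1.D (x + y) = H1.D x + H1.D y := rfl
    rw [h0, h1, inner_add_left, inner_add_left, inner_add_left, hx, hy]
    ring
  · intro c x hx
    have h0 : H1.toL2 (c • x) = c • H1.toL2 x := rfl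
    have h1 : H1.D (c • x) = c • H1.D x := rfl
    rw [h0, h1, inner_smul_left, inner_smul_left, inner_smul_left, hx]
    ring
  · refine isClosed_eq ?_ (Continuous.add ?_ ?_)
    · exact Continuous.inner (𝕜 := ℂ) H1.toL2L.continuous continuous_const
    · exact Continuous.inner (𝕜 := ℂ) H1.DL.continuous continuous_const
    · exact Continuous.inner (𝕜 := ℂ) H1.toL2L.continuous continuous_const

namespace WeakEq

variable {f a b : ℝ → L2 ℂ} {t : ℝ}

theorem hasDerivAt_real_inner (h : WeakEq f a b) (η : H1) (ht : 0 < t) :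
    HasDerivAt (fun s => ⟪H1.toL2 η, f s⟫_ℝ) (⟪H1.D η, a t⟫_ℝ + ⟪H1.toL2 η, b t⟫_ℝ) t := by
  have h1 := ((innerSL ℝ (H1.D η)).hasFDerivAt.comp_hasDerivAt t
    (hasDerivAt_integral_of_continuousOn_Ioi h.flux ht ht)).add
      ((innerSL ℝ (H1.toL2 η)).hasFDerivAt.comp_hasDerivAt t
        (hasDerivAt_integral_of_continuousOn_Ioi h.source ht ht))
  have h2 := h1.const_add ⟪H1.toL2 η, f t⟫_ℝ
  refine h2.congr_of_eventuallyEq ?_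
  filter_upwards [Ioi_mem_nhds ht] with r hr
  have := congrArg Complex.re (h.eq t r ht hr η)
  rw [Complex.add_re, ← L2.real_inner_eq_re, ← L2.real_inner_eq_re, ← L2.real_inner_eq_re,
    inner_sub_right] at this
  simp only [Pi.add_apply, Function.comp_apply, innerSL_apply_apply]
  linarith

/-- Using R_k g as test function and moving R_k and its derivative to the other side turns the weak
equation into a strong one in L². -/
theorem hasDerivAt_res (h : WeakEq f a b) (k : ℕ) (ht : 0 < t) :
    HasDerivAt (fun s => res k (f s)) (-resD k (a t) + res k (b t)) t := by
  have h1 := (((resD k).restrictScalars ℝ).hasFDerivAt.comp_hasDerivAt t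
    (hasDerivAt_integral_of_continuousOn_Ioi h.flux ht ht)).neg.add
      (((res k).restrictScalars ℝ).hasFDerivAt.comp_hasDerivAt t
        (hasDerivAt_integral_of_continuousOn_Ioi h.source ht ht))
  have h2 := h1.const_add (res k (f t))
  refine h2.congr_of_eventuallyEq ?_
  filter_upwards [Ioi_mem_nhds ht] with r hr
  simp only [Pi.add_apply, Pi.neg_apply, Function.comp_apply,
    ContinuousLinearMap.coe_restrictScalars']
  rw [← sub_eq_iff_eq_add', ← map_sub]
  refine ext_inner_left ℂ fun g => ?_
  rw [← inner_res, inner_add_right, inner_neg_right, ← inner_res, ← inner_resD]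
  exact h.eq t r ht hr (resH1 k g)

theorem inner_resDD (k : ℕ) (f g : L2 ℂ) : ⟪resDD k f, g⟫_ℂ = ⟪f, resDD k g⟫_ℂ := by
  rw [resDD_apply, resDD_apply, inner_smul_left, inner_smul_right, inner_sub_left, inner_sub_right,
    inner_res, Complex.conj_ofReal]

theorem hasDerivAt_resD (h : WeakEq f a b) (k : ℕ) (ht : 0 < t) :
    HasDerivAt (fun s => resD k (f s)) (-resDD k (a t) + resD k (b t)) t := by
  have h1 := (((resDD k).restrictScalars ℝ).hasFDerivAt.comp_hasDerivAt t
    (hasDerivAt_integral_of_continuousOn_Ioi h.flux ht ht)).neg.add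
      (((resD k).restrictScalars ℝ).hasFDerivAt.comp_hasDerivAt t
        (hasDerivAt_integral_of_continuousOn_Ioi h.source ht ht))
  have h2 := h1.const_add (resD k (f t))
  refine h2.congr_of_eventuallyEq ?_
  filter_upwards [Ioi_mem_nhds ht] with r hr
  simp only [Pi.add_apply, Pi.neg_apply, Function.comp_apply,
    ContinuousLinearMap.coe_restrictScalars']
  rw [← sub_eq_iff_eq_add', ← map_sub]
  refine ext_inner_left ℂ fun g => ?_
  have := h.eq t r ht hr (H1.mk (resD k g) (resDD k g) (isWeakDeriv_resD k g))
  rw [H1.toL2_mk, H1.D_mk] at this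
  rw [← neg_inj, ← inner_resD, inner_add_right, inner_neg_right, ← inner_resDD, neg_add, neg_neg,
    ← inner_resD]
  exact this

/-- The local `L²` identity for transport equations `f_t + σ f_x = b`. -/
theorem transport {σ : ℝ} (h : WeakEq f (fun t => ((σ : ℝ) : ℂ) • f t) b) {φ φ' : Weight}
    (hφ : φ.HasDeriv φ') (ht : 0 < t) :
    HasDerivAt (fun s => ⟪φ.op (f s), f s⟫_ℝ)
      (σ * ⟪φ'.op (f t), f t⟫_ℝ + 2 * ⟪φ.op (f t), b t⟫_ℝ) t := by
  obtain ⟨C, hC⟩ := φ.bound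
  obtain ⟨C', hC'⟩ := φ'.bound
  have hcf := h.left
  have hcb := h.source
  have hC0 : 0 ≤ C := (abs_nonneg _).trans (hC 0)
  have hC0' : 0 ≤ C' := (abs_nonneg _).trans (hC' 0)
  refine hasDerivAt_of_tendsto
    (F := fun k s => ⟪φ.op (res k (f s)), res k (f s)⟫_ℝ)
    (G := fun k s => σ * ⟪φ'.op (res k (f s)), res k (f s)⟫_ℝ
      + 2 * ⟪φ.op (res k (f s)), res k (b s)⟫_ℝ)
    (g := fun t => σ * ⟪φ'.op (f t), f t⟫_ℝ + 2 * ⟪φ.op (f t), b t⟫_ℝ)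
    (B := fun s => |σ| * (C' * ‖f s‖ * ‖f s‖) + 2 * (C * ‖f s‖ * ‖b s‖))
    ?_ ?_ ?_ ?_ ?_ ?_ ?_ ht
  · intro k s hs
    have h1 := h.hasDerivAt_res k hs
    have h2 := HasDerivAt.inner ℝ ((φ.op.restrictScalars ℝ).hasFDerivAt.comp_hasDerivAt s h1) h1
    refine h2.congr_deriv ?_
    simp only [Function.comp_apply, ContinuousLinearMap.coe_restrictScalars']
    -- Integration by parts moves the only spatial derivative to the weight, so the limit does not
    -- need any regularity of f in x.
    have h3 := hφ.two_mul_inner (isWeakDeriv_res k (f s))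
    rw [φ.real_inner_op (_ + _), real_inner_comm _ (_ + _), inner_add_right, inner_neg_right,
      map_smul, L2.real_inner_eq_re _ (((σ : ℝ) : ℂ) • _), inner_smul_right, Complex.re_ofReal_mul,
      ← L2.real_inner_eq_re]
    linear_combination (-σ) * h3
  · intro k
    fun_prop
  · intro s _
    have h1 := tendsto_res (f s)
    exact ((φ.op.continuous.tendsto _).comp h1).inner h1
  · intro s _
    have h1 := tendsto_res (f s)
    have h2 := tendsto_res (b s)
    exact ((((φ'.op.continuous.tendsto _).comp h1).inner h1).const_mul _).add
      ((((φ.op.continuous.tendsto _).comp h1).inner h2).const_mul _)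
  · intro k s _
    have h1 := norm_res_le k (f s)
    have h2 := norm_res_le k (b s)
    refine (abs_add_le _ _).trans ?_
    rw [abs_mul, abs_mul, abs_two]
    gcongr
    · refine (abs_real_inner_le_norm _ _).trans ?_
      gcongr
      exact (φ'.norm_op_le hC' _).trans (by gcongr)
    · refine (abs_real_inner_le_norm _ _).trans ?_
      gcongr
      exact (φ.norm_op_le hC _).trans (by gcongr)
  · fun_prop
  · fun_prop

end WeakEq

/-! ### Real potentials -/

theorem L2.ae_im_eq_zero {N : L2 ℂ} (hN : L2.conj N = N) : ∀ᵐ x, (N x).im = 0 := by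
  filter_upwards [L2.coeFn_conj N] with x hx
  rw [hN] at hx
  exact Complex.conj_eq_iff_im.1 hx.symm

theorem H1.inner_mul_symm {N : L2 ℂ} (hN : L2.conj N = N) (f g : H1) :
    ⟪H1.mul f N, H1.toL2 g⟫_ℝ = ⟪H1.mul g N, H1.toL2 f⟫_ℝ := by
  rw [L2.real_inner_eq_integral, L2.real_inner_eq_integral]
  refine integral_congr_ae ?_
  filter_upwards [H1.coeFn_mul f N, H1.coeFn_mul g N, L2.ae_im_eq_zero hN] with x h1 h2 h3
  rw [h1, h2]
  simp [h3]
  ring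

theorem Weight.inner_I_op (φ : Weight) (f : L2 ℂ) : ⟪f, Complex.I • φ.op f⟫_ℝ = 0 := by
  have := L2.inner_I_of_symm φ.real_inner_op f
  rwa [φ.real_inner_op, φ.op.map_smul] at this

theorem Weight.inner_op_I_mul (φ : Weight) {N : L2 ℂ} (hN : L2.conj N = N) (f : H1) :
    ⟪φ.op (H1.toL2 f), Complex.I • H1.mul f N⟫_ℝ = 0 := by
  rw [L2.real_inner_eq_integral]
  refine integral_eq_zero_of_ae ?_
  filter_upwards [φ.coeFn_op (H1.toL2 f), H1.coeFn_mul f N, L2.ae_im_eq_zero hN,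
    Lp.coeFn_smul Complex.I (H1.mul f N)] with x h1 h2 h3 h4
  rw [h4, Pi.smul_apply, h1, h2]
  simp [h3]
  ring

theorem Weight.tendsto_inner (φ : Weight) {a b : ℕ → L2 ℂ} {A B : L2 ℂ}
    (ha : Tendsto a atTop (𝓝 A)) (hb : Tendsto b atTop (𝓝 B)) :
    Tendsto (fun k => ⟪φ.op (a k), b k⟫_ℝ) atTop (𝓝 ⟪φ.op A, B⟫_ℝ) :=
  Tendsto.inner (𝕜 := ℝ) ((φ.op.continuous.tendsto A).comp ha) hb

theorem tendsto_I_smul_res (f : L2 ℂ) :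
    Tendsto (fun k => Complex.I • res k f) atTop (𝓝 (Complex.I • f)) :=
  (tendsto_res f).const_smul Complex.I

theorem Weight.abs_inner_le (φ : Weight) {C : ℝ} (hC : ∀ x, |φ.toFun x| ≤ C) {a b : L2 ℂ}
    {α β : ℝ} (ha : ‖a‖ ≤ α) (hb : ‖b‖ ≤ β) : |⟪φ.op a, b⟫_ℝ| ≤ C * α * β := by
  have hC0 : 0 ≤ C := (abs_nonneg _).trans (hC 0)
  have hα : 0 ≤ α := (norm_nonneg _).trans ha
  refine (abs_real_inner_le_norm _ _).trans (mul_le_mul ?_ hb (norm_nonneg _) (by positivity))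
  exact (φ.norm_op_le hC _).trans (mul_le_mul_of_nonneg_left ha hC0)

theorem norm_I_smul (f : L2 ℂ) : ‖Complex.I • f‖ = ‖f‖ := by
  rw [norm_smul, Complex.norm_I, one_mul]

/-! ### The Schrödinger equation -/

/-- `i u_t + u_xx = N u` with a real potential `N`, in the weak form. -/
structure SchrodingerEq (u : ℝ → H1) (N : ℝ → L2 ℂ) : Prop where
  continuousOn : ContinuousOn u (Set.Ioi 0)
  potential : ContinuousOn N (Set.Ioi 0)
  real : ∀ t, L2.conj (N t) = N t
  weakEq : WeakEq (fun t => H1.toL2 (u t)) (fun t => -Complex.I • H1.D (u t))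
    (fun t => -Complex.I • H1.mul (u t) (N t))

theorem resDD_eq_resD (k : ℕ) {f f' : L2 ℂ} (h : IsWeakDeriv f f') : resDD k f = resD k f' := by
  refine (isWeakDeriv_resD k f).unique ?_
  rw [resD_eq_res k h]
  exact isWeakDeriv_res k f'

namespace SchrodingerEq

variable {u : ℝ → H1} {N : ℝ → L2 ℂ} {t : ℝ}

theorem continuousOn_toL2 (h : SchrodingerEq u N) :
    ContinuousOn (fun t => H1.toL2 (u t)) (Set.Ioi 0) :=
  H1.toL2L.continuous.comp_continuousOn h.continuousOn

theorem continuousOn_D (h : SchrodingerEq u N) :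
    ContinuousOn (fun t => H1.D (u t)) (Set.Ioi 0) :=
  H1.DL.continuous.comp_continuousOn h.continuousOn

theorem continuousOn_mul (h : SchrodingerEq u N) :
    ContinuousOn (fun t => H1.mul (u t) (N t)) (Set.Ioi 0) :=
  (H1.mul.continuous.comp_continuousOn h.continuousOn).clm_apply h.potential

theorem hasDerivAt_res (h : SchrodingerEq u N) (k : ℕ) (ht : 0 < t) :
    HasDerivAt (fun s => res k (H1.toL2 (u s)))
      (Complex.I • (resDD k (H1.toL2 (u t)) - res k (H1.mul (u t) (N t)))) t := by
  refine (h.weakEq.hasDerivAt_res k ht).congr_deriv ?_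
  rw [map_smul, map_smul, ← resDD_eq_resD k (H1.isWeakDeriv (u t)), neg_smul, neg_smul, neg_neg,
    smul_sub, sub_eq_add_neg]

theorem hasDerivAt_resD (h : SchrodingerEq u N) (k : ℕ) (ht : 0 < t) :
    HasDerivAt (fun s => resD k (H1.toL2 (u s)))
      (Complex.I • (resDD k (H1.D (u t)) - resD k (H1.mul (u t) (N t)))) t := by
  refine (h.weakEq.hasDerivAt_resD k ht).congr_deriv ?_
  rw [map_smul, map_smul, neg_smul, neg_smul, neg_neg, smul_sub, sub_eq_add_neg]

theorem isWeakDeriv_resDD (k : ℕ) (f : H1) :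
    IsWeakDeriv (resDD k (H1.toL2 f)) (resDD k (H1.D f)) := by
  rw [resDD_eq_resD k (H1.isWeakDeriv f)]
  exact isWeakDeriv_resD k _

/-- Local conservation of mass. -/
theorem hasDerivAt_weight (h : SchrodingerEq u N) {φ φ' : Weight} (hφ : φ.HasDeriv φ')
    (ht : 0 < t) :
    HasDerivAt (fun s => ⟪φ.op (H1.toL2 (u s)), H1.toL2 (u s)⟫_ℝ)
      (-2 * ⟪φ'.op (H1.toL2 (u t)), Complex.I • H1.D (u t)⟫_ℝ) t := by
  obtain ⟨C, hC⟩ := φ.bound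
  obtain ⟨C', hC'⟩ := φ'.bound
  have hC0 : 0 ≤ C := (abs_nonneg _).trans (hC 0)
  have hC0' : 0 ≤ C' := (abs_nonneg _).trans (hC' 0)
  have c1 := h.continuousOn_toL2
  have c2 := h.continuousOn_D
  have c3 := h.continuousOn_mul
  refine hasDerivAt_of_tendsto
    (F := fun k s => ⟪φ.op (res k (H1.toL2 (u s))), res k (H1.toL2 (u s))⟫_ℝ)
    (G := fun k s => -2 * ⟪φ'.op (res k (H1.toL2 (u s))), Complex.I • res k (H1.D (u s))⟫_ℝ
      - 2 * ⟪φ.op (res k (H1.toL2 (u s))), Complex.I • res k (H1.mul (u s) (N s))⟫_ℝ)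
    (g := fun t => -2 * ⟪φ'.op (H1.toL2 (u t)), Complex.I • H1.D (u t)⟫_ℝ)
    (B := fun s => 2 * (C' * ‖H1.toL2 (u s)‖ * ‖H1.D (u s)‖)
      + 2 * (C * ‖H1.toL2 (u s)‖ * ‖H1.mul (u s) (N s)‖))
    ?_ ?_ ?_ ?_ ?_ ?_ ?_ ht
  · intro k s hs
    have h1 := h.hasDerivAt_res k hs
    have h2 := HasDerivAt.inner ℝ ((φ.op.restrictScalars ℝ).hasFDerivAt.comp_hasDerivAt s h1) h1
    refine h2.congr_deriv ?_
    simp only [Function.comp_apply, ContinuousLinearMap.coe_restrictScalars']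
    have e1 := resD_eq_res k (H1.isWeakDeriv (u s))
    have w1 := isWeakDeriv_res k (H1.toL2 (u s))
    have w2 := (isWeakDeriv_resD k (H1.toL2 (u s))).smul Complex.I
    have h3 := (hφ.isWeakDeriv w1).real_inner_left w2
    rw [inner_add_left, φ.real_inner_op (resD k _), e1, φ.op.map_smul, φ.inner_I_op]
      at h3
    rw [φ.real_inner_op (_ • _), real_inner_comm _ (_ • _), smul_sub, inner_sub_right]
    linear_combination 2 * h3
  · intro k
    fun_prop
  · intro s _
    have h1 := tendsto_res (H1.toL2 (u s))
    exact ((φ.op.continuous.tendsto _).comp h1).inner h1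
  · intro s _
    have h1 := tendsto_res (H1.toL2 (u s))
    have h2 := tendsto_I_smul_res (H1.D (u s))
    have h3 := tendsto_I_smul_res (H1.mul (u s) (N s))
    have h4 : Tendsto (fun k => ⟪φ'.op (res k (H1.toL2 (u s))),
        Complex.I • res k (H1.D (u s))⟫_ℝ) atTop
        (𝓝 ⟪φ'.op (H1.toL2 (u s)), Complex.I • H1.D (u s)⟫_ℝ) :=
      φ'.tendsto_inner h1 h2
    have h5 := φ.tendsto_inner h1 h3
    -- The resolvent need not commute with multiplication by N, so the potential term can survive at
    -- each fixed k. In the limit it vanishes since N is real.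
    rw [φ.inner_op_I_mul (h.real s) (u s)] at h5
    simpa using (h4.const_mul (-2)).sub (h5.const_mul 2)
  · intro k s _
    have h1 := norm_res_le k (H1.toL2 (u s))
    have h2 := norm_res_le k (H1.D (u s))
    have h3 := norm_res_le k (H1.mul (u s) (N s))
    refine (abs_sub _ _).trans ?_
    rw [abs_mul, abs_mul, abs_neg, abs_two]
    exact add_le_add
      (mul_le_mul_of_nonneg_left
        (φ'.abs_inner_le hC' h1 ((norm_I_smul _).trans_le h2)) zero_le_two)
      (mul_le_mul_of_nonneg_left
        (φ.abs_inner_le hC h1 ((norm_I_smul _).trans_le h3)) zero_le_two)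
  · fun_prop
  · exact (ContinuousOn.inner (𝕜 := ℝ) (φ'.op.continuous.comp_continuousOn c1)
      (c2.const_smul Complex.I)).const_smul (-2 : ℝ)

/-- The virial identity for the Schrödinger equation. -/
theorem hasDerivAt_momentum (h : SchrodingerEq u N) {φ φ' φ'' : Weight} (hφ : φ.HasDeriv φ')
    (hφ' : φ'.HasDeriv φ'') (ht : 0 < t) :
    HasDerivAt (fun s => ⟪Complex.I • H1.toL2 (u s), φ.op (H1.D (u s))⟫_ℝ)
      (2 * ⟪φ'.op (H1.D (u t)), H1.D (u t)⟫_ℝ + ⟪φ''.op (H1.toL2 (u t)), H1.D (u t)⟫_ℝ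
        + 2 * ⟪φ.op (H1.D (u t)), H1.mul (u t) (N t)⟫_ℝ
        + ⟪φ'.op (H1.toL2 (u t)), H1.mul (u t) (N t)⟫_ℝ) t := by
  obtain ⟨C, hC⟩ := φ.bound
  obtain ⟨C', hC'⟩ := φ'.bound
  obtain ⟨C'', hC''⟩ := φ''.bound
  have hC0 : 0 ≤ C := (abs_nonneg _).trans (hC 0)
  have hC0' : 0 ≤ C' := (abs_nonneg _).trans (hC' 0)
  have hC0'' : 0 ≤ C'' := (abs_nonneg _).trans (hC'' 0)
  have c1 := h.continuousOn_toL2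
  have c2 := h.continuousOn_D
  have c3 := h.continuousOn_mul
  refine hasDerivAt_of_tendsto
    (F := fun k s => ⟪Complex.I • res k (H1.toL2 (u s)), φ.op (resD k (H1.toL2 (u s)))⟫_ℝ)
    (G := fun k s => 2 * ⟪φ'.op (res k (H1.D (u s))), res k (H1.D (u s))⟫_ℝ
        + ⟪φ''.op (res k (H1.toL2 (u s))), res k (H1.D (u s))⟫_ℝ
        + 2 * ⟪φ.op (res k (H1.D (u s))), res k (H1.mul (u s) (N s))⟫_ℝ
        + ⟪φ'.op (res k (H1.toL2 (u s))), res k (H1.mul (u s) (N s))⟫_ℝ)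
    (g := fun t => 2 * ⟪φ'.op (H1.D (u t)), H1.D (u t)⟫_ℝ
        + ⟪φ''.op (H1.toL2 (u t)), H1.D (u t)⟫_ℝ
        + 2 * ⟪φ.op (H1.D (u t)), H1.mul (u t) (N t)⟫_ℝ
        + ⟪φ'.op (H1.toL2 (u t)), H1.mul (u t) (N t)⟫_ℝ)
    (B := fun s => 2 * (C' * ‖H1.D (u s)‖ * ‖H1.D (u s)‖)
      + C'' * ‖H1.toL2 (u s)‖ * ‖H1.D (u s)‖
      + 2 * (C * ‖H1.D (u s)‖ * ‖H1.mul (u s) (N s)‖)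
      + C' * ‖H1.toL2 (u s)‖ * ‖H1.mul (u s) (N s)‖)
    ?_ ?_ ?_ ?_ ?_ ?_ ?_ ht
  · intro k s hs
    have h1 := (h.hasDerivAt_res k hs).const_smul Complex.I
    have h2 := (φ.op.restrictScalars ℝ).hasFDerivAt.comp_hasDerivAt s (h.hasDerivAt_resD k hs)
    refine (HasDerivAt.inner ℝ h1 h2).congr_deriv ?_
    simp only [Function.comp_apply, ContinuousLinearMap.coe_restrictScalars', Pi.smul_apply]
    have e1 := resD_eq_res k (H1.isWeakDeriv (u s))
    have w1 := isWeakDeriv_res k (H1.toL2 (u s))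
    have w2 := isWeakDeriv_resD k (H1.toL2 (u s))
    have w3 := (isWeakDeriv_resDD k (u s)).sub (isWeakDeriv_res k (H1.mul (u s) (N s)))
    rw [e1] at w1 w2
    -- `h3` removes the third derivative of the regularized u, `h4` and `h5` the second derivatives.
    -- Only first derivatives of u remain, so the limit exists for u in H¹.
    have h3 := (hφ.isWeakDeriv w1).real_inner_left w3
    have h4 := hφ.two_mul_inner w2
    have h5 := (hφ'.isWeakDeriv w1).real_inner_left w2
    rw [e1, ← φ.real_inner_op, φ.op.map_smul, L2.inner_I_left, real_inner_comm (φ.op (res k _))]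
    simp only [smul_smul, Complex.I_mul_I, neg_one_smul, inner_neg_right, neg_neg]
    simp only [inner_add_left, inner_sub_right] at h3 h5 ⊢
    linear_combination h3 - h4 - h5
  · intro k
    fun_prop
  · intro s _
    have h1 := (tendsto_res (H1.toL2 (u s))).const_smul Complex.I
    have h2 := tendsto_res (H1.D (u s))
    have e1 : ∀ k, resD k (H1.toL2 (u s)) = res k (H1.D (u s)) := fun k =>
      resD_eq_res k (H1.isWeakDeriv (u s))
    simp only [e1]
    exact h1.inner ((φ.op.continuous.tendsto _).comp h2)
  · intro s _
    have h1 := tendsto_res (H1.toL2 (u s))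
    have h2 := tendsto_res (H1.D (u s))
    have h3 := tendsto_res (H1.mul (u s) (N s))
    exact ((((φ'.tendsto_inner h2 h2).const_mul 2).add (φ''.tendsto_inner h1 h2)).add
      ((φ.tendsto_inner h2 h3).const_mul 2)).add (φ'.tendsto_inner h1 h3)
  · intro k s _
    have h1 := norm_res_le k (H1.toL2 (u s))
    have h2 := norm_res_le k (H1.D (u s))
    have h3 := norm_res_le k (H1.mul (u s) (N s))
    refine (abs_add_le _ _).trans (add_le_add ((abs_add_le _ _).trans (add_le_add
      ((abs_add_le _ _).trans (add_le_add ?_ (φ''.abs_inner_le hC'' h1 h2))) ?_))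
      (φ'.abs_inner_le hC' h1 h3))
    · rw [abs_mul, abs_two]
      exact mul_le_mul_of_nonneg_left (φ'.abs_inner_le hC' h2 h2) zero_le_two
    · rw [abs_mul, abs_two]
      exact mul_le_mul_of_nonneg_left (φ.abs_inner_le hC h2 h3) zero_le_two
  · fun_prop
  · fun_prop

end SchrodingerEq

/-! ### The density `|f|²` -/

/-- Complex conjugation on `H¹`. -/
noncomputable def H1.conj (f : H1) : H1 :=
  H1.mk (L2.conj (H1.toL2 f)) (L2.conj (H1.D f)) (H1.isWeakDeriv f).conj

/-- The density `|f|²`, in `H¹`. -/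
noncomputable def H1.sq (f : H1) : H1 :=
  H1.mk _ _ (H1.isWeakDeriv_mul f (H1.conj f))

theorem H1.toL2_sq (f : H1) : H1.toL2 (H1.sq f) = H1.mul f (L2.conj (H1.toL2 f)) := rfl

theorem H1.D_sq (f : H1) :
    H1.D (H1.sq f) = H1.mul f (L2.conj (H1.D f)) + H1.mul (H1.conj f) (H1.D f) := rfl

theorem H1.tendsto_mul_left {a : ℕ → H1} {A : H1} (h : Tendsto a atTop (𝓝 A)) (g : L2 ℂ) :
    Tendsto (fun k => H1.mul (a k) g) atTop (𝓝 (H1.mul A g)) :=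
  ((H1.mul.flip g).continuous.tendsto A).comp h

theorem H1.continuous_conj : Continuous H1.conj := by
  rw [continuous_iff_continuousAt]
  intro f
  exact H1.tendsto_iff.2 ⟨(L2.conj.continuous.comp H1.toL2L.continuous).tendsto f,
    (L2.conj.continuous.comp H1.DL.continuous).tendsto f⟩

theorem H1.continuous_D_sq : Continuous fun f => H1.D (H1.sq f) := by
  simp only [H1.D_sq]
  exact (H1.mul.continuous.clm_apply (L2.conj.continuous.comp H1.DL.continuous)).add
    ((H1.mul.continuous.comp H1.continuous_conj).clm_apply H1.DL.continuous)

theorem H1.norm_conj (f : H1) : ‖H1.conj f‖ = ‖f‖ := by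
  refine (pow_left_inj₀ (norm_nonneg _) (norm_nonneg _) two_ne_zero).1 ?_
  rw [H1.norm_sq, H1.norm_sq f]
  simp only [H1.conj, H1.toL2_mk, H1.D_mk, L2.norm_conj]

theorem H1.norm_D_sq_le (f : H1) : ‖H1.D (H1.sq f)‖ ≤ 2 * ‖f‖ ^ 2 := by
  rw [H1.D_sq]
  have h1 := H1.norm_mul_le f (L2.conj (H1.D f))
  have h2 := H1.norm_mul_le (H1.conj f) (H1.D f)
  rw [L2.norm_conj] at h1
  rw [H1.norm_conj] at h2
  have h3 := H1.norm_D_le f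
  have := mul_le_mul_of_nonneg_left h3 (norm_nonneg f)
  calc _ ≤ _ := norm_add_le _ _
    _ ≤ _ := by nlinarith

theorem H1.coeFn_toL2_sq (f : H1) :
    H1.toL2 (H1.sq f) =ᵐ[volume] fun x => ((‖H1.toL2 f x‖ ^ 2 : ℝ) : ℂ) := by
  rw [H1.toL2_sq]
  filter_upwards [H1.coeFn_mul f (L2.conj (H1.toL2 f)), L2.coeFn_conj (H1.toL2 f)] with x h1 h2
  rw [h1, h2, Complex.star_def, Complex.mul_conj']
  push_cast; rfl

theorem H1.coeFn_D_sq (f : H1) :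
    H1.D (H1.sq f) =ᵐ[volume]
      fun x => ((2 * (star (H1.toL2 f x) * H1.D f x).re : ℝ) : ℂ) := by
  rw [H1.D_sq]
  filter_upwards [H1.coeFn_mul f (L2.conj (H1.D f)), L2.coeFn_conj (H1.D f),
    H1.coeFn_mul (H1.conj f) (H1.D f), L2.coeFn_conj (H1.toL2 f),
    Lp.coeFn_add (H1.mul f (L2.conj (H1.D f))) (H1.mul (H1.conj f) (H1.D f))] with x h1 h2 h3 h4 h5
  have h6 : H1.toL2 (H1.conj f) x = star (H1.toL2 f x) := h4
  rw [h5, Pi.add_apply, h1, h2, h3, h6]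
  apply Complex.ext <;> simp <;> ring

theorem H1.inner_sq_real {N : L2 ℂ} (hN : L2.conj N = N) (f : H1) :
    ⟪H1.toL2 (H1.sq f), N⟫_ℝ = ⟪H1.mul f N, H1.toL2 f⟫_ℝ := by
  rw [L2.real_inner_eq_integral, L2.real_inner_eq_integral]
  refine integral_congr_ae ?_
  filter_upwards [H1.coeFn_mul f N, H1.coeFn_toL2_sq f, L2.ae_im_eq_zero hN] with x h1 h2 h3
  rw [h1, h2, ← Complex.normSq_eq_norm_sq, Complex.normSq_apply]
  simp [h3]
  ring

/-- This matches the coupling term of the wave momentum with that of the Schrödinger momentum; their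
cancellation in the virial identity rests on it. -/
theorem H1.inner_D_mul_real (φ : Weight) {N : L2 ℂ} (hN : L2.conj N = N) (f : H1) :
    ⟪φ.op N, H1.D (H1.sq f)⟫_ℝ = 2 * ⟪φ.op (H1.D f), H1.mul f N⟫_ℝ := by
  rw [L2.real_inner_eq_integral, L2.real_inner_eq_integral, ← integral_const_mul]
  refine integral_congr_ae ?_
  filter_upwards [H1.coeFn_mul f N, H1.coeFn_D_sq f, L2.ae_im_eq_zero hN, φ.coeFn_op N,
    φ.coeFn_op (H1.D f)] with x h1 h2 h3 h4 h5
  rw [h1, h2, h4, h5]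
  simp [h3]
  ring

/-! ### The system -/

theorem WeakEq.congr {f a b a' b' : ℝ → L2 ℂ} (h : WeakEq f a b) (ha : ∀ t, a t = a' t)
    (hb : ∀ t, b t = b' t) : WeakEq f a' b' := by
  obtain rfl : a = a' := funext ha
  obtain rfl : b = b' := funext hb
  exact h

theorem WeakEq.add {f a b f' a' b' : ℝ → L2 ℂ} (h : WeakEq f a b) (h' : WeakEq f' a' b') :
    WeakEq (fun t => f t + f' t) (fun t => a t + a' t) (fun t => b t + b' t) := by
  refine ⟨h.left.add h'.left, h.flux.add h'.flux, h.source.add h'.source, fun s t hs ht η => ?_⟩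
  have e1 := h.eq s t hs ht η
  have e2 := h'.eq s t hs ht η
  rw [intervalIntegral.integral_add (intervalIntegrable_of_continuousOn_Ioi h.flux hs ht)
    (intervalIntegrable_of_continuousOn_Ioi h'.flux hs ht),
    intervalIntegral.integral_add (intervalIntegrable_of_continuousOn_Ioi h.source hs ht)
    (intervalIntegrable_of_continuousOn_Ioi h'.source hs ht)]
  simp only [inner_add_right, inner_sub_right] at e1 e2 ⊢
  linear_combination e1 + e2

theorem WeakEq.neg {f a b : ℝ → L2 ℂ} (h : WeakEq f a b) :
    WeakEq (fun t => -f t) (fun t => -a t) (fun t => -b t) := by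
  refine ⟨h.left.neg, h.flux.neg, h.source.neg, fun s t hs ht η => ?_⟩
  have e1 := h.eq s t hs ht η
  rw [intervalIntegral.integral_neg, intervalIntegral.integral_neg]
  simp only [inner_neg_right, inner_sub_right] at e1 ⊢
  linear_combination -e1

/-- The Zakharov system in the weak form, with complexified real densities. -/
structure System (u : ℝ → H1) (N V : ℝ → L2 ℂ) : Prop where
  schrodinger : SchrodingerEq u N
  density : WeakEq N V (fun _ => 0)
  velocity : WeakEq V N (fun t => -H1.D (H1.sq (u t)))

namespace System

variable {u : ℝ → H1} {N V : ℝ → L2 ℂ} {t : ℝ}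

/-- The sum N + V and the difference N − V solve transport equations with speeds 1 and −1 and
sources −D|u|² and +D|u|². The two wave identities below follow from them by polarization. -/
theorem hasDerivAt_characteristic (h : System u N V) {φ φ' : Weight} (hφ : φ.HasDeriv φ')
    (ht : 0 < t) :
    HasDerivAt (fun s => ⟪φ.op (N s + V s), N s + V s⟫_ℝ)
      (⟪φ'.op (N t + V t), N t + V t⟫_ℝ
        - 2 * ⟪φ.op (N t + V t), H1.D (H1.sq (u t))⟫_ℝ) t ∧
    HasDerivAt (fun s => ⟪φ.op (N s - V s), N s - V s⟫_ℝ)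
      (-⟪φ'.op (N t - V t), N t - V t⟫_ℝ
        + 2 * ⟪φ.op (N t - V t), H1.D (H1.sq (u t))⟫_ℝ) t := by
  constructor
  · have h1 : WeakEq (fun t => N t + V t) (fun t => ((1 : ℝ) : ℂ) • (N t + V t))
        (fun t => -H1.D (H1.sq (u t))) :=
      (h.density.add h.velocity).congr (fun t => by simp [add_comm]) (fun t => by simp)
    refine (h1.transport hφ ht).congr_deriv ?_
    rw [inner_neg_right]; ring
  · have h1 : WeakEq (fun t => N t - V t) (fun t => ((-1 : ℝ) : ℂ) • (N t - V t))
        (fun t => H1.D (H1.sq (u t))) := by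
      simp only [sub_eq_add_neg]
      exact (h.density.add h.velocity.neg).congr (fun t => by simp [add_comm]) (fun t => by simp)
    refine (h1.transport hφ ht).congr_deriv ?_
    ring

theorem hasDerivAt_wave_energy (h : System u N V) {φ φ' : Weight} (hφ : φ.HasDeriv φ')
    (ht : 0 < t) :
    HasDerivAt (fun s => ⟪φ.op (N s), N s⟫_ℝ + ⟪φ.op (V s), V s⟫_ℝ)
      (2 * ⟪φ'.op (N t), V t⟫_ℝ - 2 * ⟪φ.op (V t), H1.D (H1.sq (u t))⟫_ℝ) t := by
  obtain ⟨h1, h2⟩ := h.hasDerivAt_characteristic hφ ht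
  have h3 := (h1.add h2).const_mul (1 / 2 : ℝ)
  have c : ∀ (χ : Weight) (a b : L2 ℂ), ⟪χ.op a, b⟫_ℝ = ⟪χ.op b, a⟫_ℝ := fun χ a b => by
    rw [χ.real_inner_op, real_inner_comm]
  refine (h3.congr_deriv ?_).congr_of_eventuallyEq (Eventually.of_forall fun s => ?_)
  · simp only [map_add, map_sub, inner_add_left, inner_add_right, inner_sub_left, inner_sub_right]
    rw [c φ' (V t) (N t)]
    ring
  · simp only [Pi.add_apply, map_add, map_sub, inner_add_left, inner_add_right, inner_sub_left,
      inner_sub_right]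
    ring

theorem hasDerivAt_wave_momentum (h : System u N V) {φ φ' : Weight} (hφ : φ.HasDeriv φ')
    (ht : 0 < t) :
    HasDerivAt (fun s => ⟪φ.op (N s), V s⟫_ℝ)
      ((⟪φ'.op (N t), N t⟫_ℝ + ⟪φ'.op (V t), V t⟫_ℝ) / 2
        - ⟪φ.op (N t), H1.D (H1.sq (u t))⟫_ℝ) t := by
  obtain ⟨h1, h2⟩ := h.hasDerivAt_characteristic hφ ht
  have h3 := (h1.sub h2).const_mul (1 / 4 : ℝ)
  have c : ∀ (χ : Weight) (a b : L2 ℂ), ⟪χ.op a, b⟫_ℝ = ⟪χ.op b, a⟫_ℝ := fun χ a b => by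
    rw [χ.real_inner_op, real_inner_comm]
  refine (h3.congr_deriv ?_).congr_of_eventuallyEq (Eventually.of_forall fun s => ?_)
  · simp only [map_add, map_sub, inner_add_left, inner_add_right, inner_sub_left, inner_sub_right]
    ring
  · simp only [Pi.sub_apply, map_add, map_sub, inner_add_left, inner_add_right, inner_sub_left,
      inner_sub_right]
    rw [c φ (V s) (N s)]
    ring

end System

/-! ### Conservation of energy -/

/-- The constant weight. -/
noncomputable def Weight.one : Weight := ⟨fun _ => 1, measurable_const, 1, by simp⟩

/-- The zero weight. -/
noncomputable def Weight.zero : Weight := ⟨fun _ => 0, measurable_const, 1, by simp⟩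

theorem Weight.hasDeriv_one : Weight.one.HasDeriv Weight.zero :=
  IsPrimitive.of_hasDerivAt (fun x => by simpa [one, zero] using hasDerivAt_const x (1 : ℂ))
    (by simpa [zero] using continuous_const)

theorem Weight.op_one (f : L2 ℂ) : Weight.one.op f = f := by
  refine Lp.ext ?_
  filter_upwards [Weight.one.coeFn_op f] with x hx
  rw [hx]
  simp [one]

theorem Weight.op_zero (f : L2 ℂ) : Weight.zero.op f = 0 := by
  refine Lp.ext ?_
  filter_upwards [Weight.zero.coeFn_op f, Lp.coeFn_zero ℂ 2 (volume : Measure ℝ)] with x hx h0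
  rw [hx, h0]
  simp [zero]

/-- A factor vanishing at t makes continuity of the other factor sufficient. This serves for u and
N, of which only continuity in time is available. -/
theorem hasDerivAt_inner_sub {X Y : ℝ → L2 ℂ} {Y' : L2 ℂ} {t : ℝ} (hX : ContinuousAt X t)
    (hY : HasDerivAt Y Y' t) : HasDerivAt (fun s => ⟪X s, Y s - Y t⟫_ℝ) ⟪X t, Y'⟫_ℝ t := by
  rw [hasDerivAt_iff_tendsto_slope] at hY ⊢
  have h := Tendsto.inner (𝕜 := ℝ) (hX.tendsto.mono_left (nhdsWithin_le_nhds (s := {t}ᶜ))) hY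
  refine h.congr fun s => ?_
  simp only [slope, vsub_eq_sub, sub_self, inner_zero_right, sub_zero, smul_eq_mul,
    real_inner_smul_right]

theorem inner_res_I (k : ℕ) (f : L2 ℂ) : ⟪f, Complex.I • res k f⟫_ℝ = 0 := by
  have := L2.inner_I_of_symm (real_inner_res k) f
  rwa [real_inner_res, (res k).map_smul] at this

theorem H1.inner_mul_I {N : L2 ℂ} (hN : L2.conj N = N) (f : H1) :
    ⟪H1.mul f N, Complex.I • H1.toL2 f⟫_ℝ = 0 := by
  have h1 := H1.inner_mul_symm hN f (Complex.I • f)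
  have e1 : H1.toL2 (Complex.I • f) = Complex.I • H1.toL2 f := rfl
  rw [e1, map_smul, _root_.smul_apply, L2.inner_I_left] at h1
  linarith

namespace System

variable {u : ℝ → H1} {N V : ℝ → L2 ℂ} {t : ℝ}

/-- The energy of the regularized system. -/
noncomputable def regEnergy (u : ℝ → H1) (N V : ℝ → L2 ℂ) (k : ℕ) (t : ℝ) : ℝ :=
  (scale k ^ 2)⁻¹ * (‖H1.toL2 (u t)‖ ^ 2 - ⟪res k (H1.toL2 (u t)), H1.toL2 (u t)⟫_ℝ)
    + ⟪H1.mul (resH1 k (H1.toL2 (u t))) (N t), res k (H1.toL2 (u t))⟫_ℝ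
    + (‖N t‖ ^ 2 + ‖V t‖ ^ 2) / 2

/-- The energy. -/
noncomputable def energy (u : ℝ → H1) (N V : ℝ → L2 ℂ) (t : ℝ) : ℝ :=
  ‖H1.D (u t)‖ ^ 2 + ⟪H1.mul (u t) (N t), H1.toL2 (u t)⟫_ℝ + (‖N t‖ ^ 2 + ‖V t‖ ^ 2) / 2

/-- The first term of the regularized energy is −⟨D²R_k u, u⟩, which after integration by parts
equals ⟨R_k Du, Du⟩. -/
theorem tendsto_regEnergy (t : ℝ) :
    Tendsto (fun k => regEnergy u N V k t) atTop (𝓝 (energy u N V t)) := by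
  have e : ∀ k, (scale k ^ 2)⁻¹ * (‖H1.toL2 (u t)‖ ^ 2
      - ⟪res k (H1.toL2 (u t)), H1.toL2 (u t)⟫_ℝ) = ⟪res k (H1.D (u t)), H1.D (u t)⟫_ℝ := by
    intro k
    have h1 := (isWeakDeriv_resD k (H1.toL2 (u t))).real_inner_left (H1.isWeakDeriv (u t))
    rw [resD_eq_res k (H1.isWeakDeriv (u t)), resDD_apply, L2.real_inner_eq_re,
      inner_smul_left, Complex.conj_ofReal, Complex.re_ofReal_mul, ← L2.real_inner_eq_re,
      inner_sub_left, real_inner_self_eq_norm_sq] at h1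
    linarith
  unfold regEnergy energy
  simp only [e]
  refine Tendsto.add (Tendsto.add ?_ ?_) tendsto_const_nhds
  · rw [← real_inner_self_eq_norm_sq]
    exact Tendsto.inner (𝕜 := ℝ) (tendsto_res _) tendsto_const_nhds
  · have h1 := tendsto_resH1 (u t)
    exact Tendsto.inner (𝕜 := ℝ) (H1.tendsto_mul_left h1 _) (tendsto_res _)

theorem hasDerivAt_regEnergy (h : System u N V) (k : ℕ) (ht : 0 < t) :
    HasDerivAt (regEnergy u N V k)
      (-2 * ⟪H1.mul (resH1 k (H1.toL2 (u t))) (N t), Complex.I • res k (H1.mul (u t) (N t))⟫_ℝ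
        + ⟪H1.D (H1.sq (resH1 k (H1.toL2 (u t)))), V t⟫_ℝ - ⟪V t, H1.D (H1.sq (u t))⟫_ℝ) t := by
  have hs := h.schrodinger
  have mass := hs.hasDerivAt_weight Weight.hasDeriv_one ht
  have wave := h.hasDerivAt_wave_energy Weight.hasDeriv_one ht
  simp only [Weight.op_one, Weight.op_zero, inner_zero_left, mul_zero, zero_sub,
    real_inner_self_eq_norm_sq] at mass wave
  have cu : ContinuousAt u t := hs.continuousOn.continuousAt (Ioi_mem_nhds ht)
  have cN : ContinuousAt N t := hs.potential.continuousAt (Ioi_mem_nhds ht)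
  have cuL : ContinuousAt (fun s => H1.toL2 (u s)) t := H1.toL2L.continuous.continuousAt.comp cu
  have hres := hs.hasDerivAt_res k ht
  have cw : ContinuousAt (fun s => resH1 k (H1.toL2 (u s))) t :=
    (continuous_resH1 k).continuousAt.comp cuL
  set w : ℝ → H1 := fun s => resH1 k (H1.toL2 (u s)) with hw
  have hres' : HasDerivAt (fun s => H1.toL2 (w s))
      (Complex.I • (resDD k (H1.toL2 (u t)) - res k (H1.mul (u t) (N t)))) t := hres
  -- Only R_k u is known to be differentiable in L². Symmetry of R_k writes the increment from t to
  -- s as ⟨u(s) + u(t), R_k u(s) − R_k u(t)⟩.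
  have d1 : HasDerivAt (fun s => ⟪H1.toL2 (w s), H1.toL2 (u s)⟫_ℝ)
      ⟪H1.toL2 (u t) + H1.toL2 (u t),
        Complex.I • (resDD k (H1.toL2 (u t)) - res k (H1.mul (u t) (N t)))⟫_ℝ t := by
    have := (hasDerivAt_inner_sub (cuL.add (continuousAt_const (y := H1.toL2 (u t))))
      hres').const_add ⟪H1.toL2 (w t), H1.toL2 (u t)⟫_ℝ
    refine this.congr_of_eventuallyEq (Eventually.of_forall fun s => ?_)
    have e := real_inner_res k (H1.toL2 (u s)) (H1.toL2 (u t))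
    change ⟪res k _, _⟫_ℝ = ⟪res k _, _⟫_ℝ + ⟪H1.toL2 (u s) + H1.toL2 (u t), res k _ - res k _⟫_ℝ
    rw [inner_add_left, inner_sub_right, inner_sub_right, real_inner_comm (res k (H1.toL2 (u s))),
      ← e, real_inner_comm (res k (H1.toL2 (u s))) (H1.toL2 (u t)),
      real_inner_comm (res k (H1.toL2 (u t))) (H1.toL2 (u t))]
    ring
  -- The increment is ⟨(w(s) + w(t))N(s), w(s) − w(t)⟩ + ⟨|w(t)|², N(s) − N(t)⟩. The second pairing
  -- is differentiated with the density equation tested against the fixed H¹ function |w(t)|².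
  have d2 : HasDerivAt (fun s => ⟪H1.mul (w s) (N s), H1.toL2 (w s)⟫_ℝ)
      (⟪H1.mul (w t + w t) (N t),
        Complex.I • (resDD k (H1.toL2 (u t)) - res k (H1.mul (u t) (N t)))⟫_ℝ
        + ⟪H1.D (H1.sq (w t)), V t⟫_ℝ) t := by
    have c1 : ContinuousAt (fun s => H1.mul (w s + w t) (N s)) t :=
      (H1.mul.continuous.continuousAt.comp (cw.add continuousAt_const)).clm_apply cN
    have h1 := hasDerivAt_inner_sub c1 hres'
    have h2 := h.density.hasDerivAt_real_inner (H1.sq (w t)) ht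
    rw [inner_zero_right, add_zero] at h2
    refine (h1.add h2).congr_of_eventuallyEq (Eventually.of_forall fun s => ?_)
    have e := H1.inner_mul_symm (hs.real s) (w s) (w t)
    simp only [Pi.add_apply]
    rw [H1.inner_sq_real (hs.real s), map_add, _root_.add_apply, inner_add_left,
      inner_sub_right, inner_sub_right, e]
    ring
  have key := (((mass.sub d1).const_mul (scale k ^ 2)⁻¹).add d2).add (wave.div_const 2)
  refine key.congr_deriv ?_
  have f1 : ⟪H1.toL2 (u t), Complex.I • resDD k (H1.toL2 (u t))⟫_ℝ = 0 := by
    rw [resDD_apply, smul_comm, L2.real_inner_eq_re, inner_smul_right, Complex.re_ofReal_mul,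
      ← L2.real_inner_eq_re, smul_sub, inner_sub_right, inner_res_I, L2.inner_I_self]
    ring
  have f2 : ⟪H1.toL2 (u t), Complex.I • res k (H1.mul (u t) (N t))⟫_ℝ
      = ⟪H1.toL2 (w t), Complex.I • H1.mul (u t) (N t)⟫_ℝ := by
    rw [← (res k).map_smul, ← real_inner_res]
    rfl
  -- The singular factor s_k⁻² here cancels against the one produced by the first term of the
  -- regularized energy, so the derivative stays bounded as k grows.
  have f3 : ⟪H1.mul (w t) (N t), Complex.I • resDD k (H1.toL2 (u t))⟫_ℝ
      = -(scale k ^ 2)⁻¹ * ⟪H1.toL2 (w t), Complex.I • H1.mul (u t) (N t)⟫_ℝ := by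
    have g1 := H1.inner_mul_I (hs.real t) (w t)
    have g2 := H1.inner_mul_symm (hs.real t) (w t) (Complex.I • u t)
    have e1 : H1.toL2 (Complex.I • u t) = Complex.I • H1.toL2 (u t) := rfl
    rw [e1, map_smul, _root_.smul_apply, real_inner_comm (H1.toL2 (w t))] at g2
    rw [resDD_apply, smul_comm, L2.real_inner_eq_re, inner_smul_right, Complex.re_ofReal_mul,
      ← L2.real_inner_eq_re, smul_sub, inner_sub_right, g2]
    have e2 : ⟪H1.mul (w t) (N t), Complex.I • res k (H1.toL2 (u t))⟫_ℝ = 0 := g1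
    rw [e2]
    ring
  rw [map_add, _root_.add_apply]
  simp only [smul_sub, inner_add_left, inner_sub_right, f1, f2, f3]
  ring

/-- Conservation of energy. -/
theorem hasDerivAt_energy (h : System u N V) (ht : 0 < t) :
    HasDerivAt (energy u N V) 0 t := by
  have hs := h.schrodinger
  have c1 := hs.continuousOn_toL2
  have c2 := hs.continuousOn_mul
  have cN := hs.potential
  have cV := h.velocity.left
  have cw : ∀ k, ContinuousOn (fun s => resH1 k (H1.toL2 (u s))) (Set.Ioi 0) := fun k =>
    (continuous_resH1 k).comp_continuousOn c1
  have cwD : ∀ k, ContinuousOn (fun s => H1.D (H1.sq (resH1 k (H1.toL2 (u s))))) (Set.Ioi 0) :=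
    fun k => H1.continuous_D_sq.comp_continuousOn (cw k)
  have cuD : ContinuousOn (fun s => H1.D (H1.sq (u s))) (Set.Ioi 0) :=
    H1.continuous_D_sq.comp_continuousOn hs.continuousOn
  have cm : ∀ k, ContinuousOn (fun s => H1.mul (resH1 k (H1.toL2 (u s))) (N s)) (Set.Ioi 0) :=
    fun k => (H1.mul.continuous.comp_continuousOn (cw k)).clm_apply cN
  refine hasDerivAt_of_tendsto (F := regEnergy u N V) (g := fun _ => 0)
    (B := fun s => 2 * (‖u s‖ * ‖N s‖ * ‖H1.mul (u s) (N s)‖) + 2 * ‖u s‖ ^ 2 * ‖V s‖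
      + ‖V s‖ * ‖H1.D (H1.sq (u s))‖)
    (fun k s hs => h.hasDerivAt_regEnergy k hs) (fun k => ?_) (fun s _ => tendsto_regEnergy s)
    (fun s _ => ?_) (fun k s _ => ?_) ?_ continuousOn_const ht
  · refine ((ContinuousOn.const_smul ?_ (-2 : ℝ)).add ?_).sub ?_
    · exact ContinuousOn.inner (𝕜 := ℝ) (cm k)
        (((res k).continuous.comp_continuousOn c2).const_smul Complex.I)
    · exact ContinuousOn.inner (𝕜 := ℝ) (cwD k) cV
    · exact ContinuousOn.inner (𝕜 := ℝ) cV cuD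
  · have h1 := tendsto_resH1 (u s)
    have h2 : Tendsto (fun k => H1.mul (resH1 k (H1.toL2 (u s))) (N s)) atTop
        (𝓝 (H1.mul (u s) (N s))) :=
      H1.tendsto_mul_left h1 _
    have h3 : Tendsto (fun k => H1.D (H1.sq (resH1 k (H1.toL2 (u s))))) atTop
        (𝓝 (H1.D (H1.sq (u s)))) := (H1.continuous_D_sq.tendsto _).comp h1
    have h4 := Tendsto.inner (𝕜 := ℝ) h2 (tendsto_I_smul_res (H1.mul (u s) (N s)))
    -- Without regularization the first term is ⟨uN, i uN⟩ = 0, and the two wave terms become equal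
    -- and opposite.
    rw [L2.inner_I_self] at h4
    have h5 := Tendsto.inner (𝕜 := ℝ) h3 (tendsto_const_nhds (x := V s))
    have h6 := ((h4.const_mul (-2)).add h5).sub
      (tendsto_const_nhds (x := ⟪V s, H1.D (H1.sq (u s))⟫_ℝ))
    rw [real_inner_comm (V s), mul_zero, zero_add, sub_self] at h6
    exact h6
  · have b1 := norm_resH1_le k (u s)
    have b2 : ‖H1.mul (resH1 k (H1.toL2 (u s))) (N s)‖ ≤ ‖u s‖ * ‖N s‖ :=
      (H1.norm_mul_le _ _).trans (mul_le_mul_of_nonneg_right b1 (norm_nonneg _))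
    have b3 : ‖H1.D (H1.sq (resH1 k (H1.toL2 (u s))))‖ ≤ 2 * ‖u s‖ ^ 2 :=
      (H1.norm_D_sq_le _).trans (mul_le_mul_of_nonneg_left
        (pow_le_pow_left₀ (norm_nonneg _) b1 2) zero_le_two)
    refine (abs_sub _ _).trans (add_le_add ((abs_add_le _ _).trans (add_le_add ?_ ?_)) ?_)
    · rw [abs_mul, abs_neg, abs_two]
      refine mul_le_mul_of_nonneg_left ((abs_real_inner_le_norm _ _).trans ?_) zero_le_two
      exact mul_le_mul b2 ((norm_I_smul _).trans_le (norm_res_le k _)) (norm_nonneg _)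
        (by positivity)
    · exact (abs_real_inner_le_norm _ _).trans (mul_le_mul_of_nonneg_right b3 (norm_nonneg _))
    · exact abs_real_inner_le_norm _ _
  · have cu := hs.continuousOn.norm
    have n1 := c2.norm
    have n2 := cN.norm
    have n3 := cV.norm
    have n4 := cuD.norm
    exact ((((cu.mul n2).mul n1).const_smul (2 : ℝ)).add
      (((cu.pow 2).const_smul (2 : ℝ)).mul n3)).add (n3.mul n4)

end System

/-! ### Exponential weights -/

theorem measurable_sign : Measurable fun x : ℝ => (SignType.sign x : ℝ) := by
  have : (fun x : ℝ => (SignType.sign x : ℝ)) =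
      fun x => if x < 0 then -1 else if 0 < x then 1 else 0 := by
    funext x
    rcases lt_trichotomy x 0 with hx | hx | hx <;> simp [hx, not_lt_of_gt]
  rw [this]
  exact Measurable.ite measurableSet_Iio measurable_const
    (Measurable.ite measurableSet_Ioi measurable_const measurable_const)

theorem abs_sign_le_one (x : ℝ) : |(SignType.sign x : ℝ)| ≤ 1 := by
  rcases lt_trichotomy x 0 with hx | hx | hx <;> simp [hx]

theorem ae_sign_mul_sign : ∀ᵐ x : ℝ, (SignType.sign x : ℝ) * SignType.sign x = 1 := by
  have : ∀ᵐ t : ℝ, t ≠ 0 := by simp [ae_iff, measure_singleton]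
  filter_upwards [this] with x hx
  rcases lt_or_gt_of_ne hx with h | h <;> simp [h]

namespace Weight

theorem locallyIntegrable (φ : Weight) : LocallyIntegrable fun x => ((φ.toFun x : ℝ) : ℂ) :=
  φ.memLp.locallyIntegrable le_top

/-- The sign, as a weight. -/
noncomputable def sgn : Weight := ⟨fun x => SignType.sign x, measurable_sign, 1, abs_sign_le_one⟩

/-- The weight `exp (-a |x|)`. -/
noncomputable def expAbs (a : ℝ) (ha : 0 ≤ a) : Weight :=
  ⟨fun x => Real.exp (-a * |x|), by fun_prop, 1, fun x => by
    rw [abs_of_pos (Real.exp_pos _), Real.exp_le_one_iff]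
    nlinarith [abs_nonneg x]⟩

/-- The derivative of the weight `exp (-a |x|)`. -/
noncomputable def expAbs' (a : ℝ) (ha : 0 ≤ a) : Weight :=
  ⟨fun x => -a * (SignType.sign x * Real.exp (-a * |x|)),
    measurable_const.mul (measurable_sign.mul (by fun_prop)), a, fun x => by
    rw [abs_mul, abs_neg, abs_of_nonneg ha, abs_mul, abs_of_pos (Real.exp_pos _)]
    have h1 := abs_sign_le_one x
    have h2 : Real.exp (-a * |x|) ≤ 1 := by
      rw [Real.exp_le_one_iff]; nlinarith [abs_nonneg x]
    have h3 := (Real.exp_pos (-a * |x|)).le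
    calc a * (|(SignType.sign x : ℝ)| * Real.exp (-a * |x|)) ≤ a * (1 * 1) := by gcongr
      _ = a := by ring⟩

/-- The weight is continuous and its kink at the origin is a single point, which the fundamental
theorem of calculus tolerates. -/
theorem hasDeriv_expAbs (a : ℝ) (ha : 0 ≤ a) : (expAbs a ha).HasDeriv (expAbs' a ha) := by
  refine ⟨locallyIntegrable _, fun x => ?_⟩
  have hi : IntervalIntegrable (fun x => (((expAbs' a ha).toFun x : ℝ) : ℂ)) volume 0 x :=
    intervalIntegrable_iff.mpr <|
      ((locallyIntegrable (expAbs' a ha)).integrableOn_isCompact isCompact_uIcc).mono_set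
        Set.uIoc_subset_uIcc
  rw [MeasureTheory.integral_eq_of_hasDerivAt_off_countable
    (fun x => (((expAbs a ha).toFun x : ℝ) : ℂ)) _ (Set.countable_singleton (0 : ℝ))
    (Continuous.continuousOn (by simp only [expAbs]; fun_prop)) ?_ hi]
  · ring
  · rintro y ⟨-, hy⟩
    have hy0 : y ≠ 0 := hy
    refine HasDerivAt.ofReal_comp ?_
    simp only [expAbs, expAbs']
    have := ((hasDerivAt_abs hy0).const_mul (-a)).exp
    convert this using 1
    ring

end Weight

theorem IsPrimitive.const_mul_sub {F f : ℝ → ℂ} (h : IsPrimitive F f) (c : ℂ) :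
    IsPrimitive (fun x => c * (F x - F 0)) (fun x => c * f x) := by
  refine ⟨h.locallyIntegrable.continuous_mul continuous_const, fun x => ?_⟩
  rw [intervalIntegral.integral_const_mul, ← h.sub_eq]
  ring

namespace Weight

/-- The bounded primitive of `exp (-2 |x|)`. -/
noncomputable def psi : Weight :=
  ⟨fun x => SignType.sign x * (1 / 2 * (1 - Real.exp (-2 * |x|))),
    measurable_sign.mul (by fun_prop), 1, fun x => by
    have h2 : Real.exp (-2 * |x|) ≤ 1 := by
      rw [Real.exp_le_one_iff]; nlinarith [abs_nonneg x]
    have h3 := (Real.exp_pos (-2 * |x|)).le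
    rw [abs_mul]
    calc |(SignType.sign x : ℝ)| * |1 / 2 * (1 - Real.exp (-2 * |x|))| ≤ 1 * 1 :=
          mul_le_mul (abs_sign_le_one x) (abs_le.2 ⟨by linarith, by linarith⟩) (abs_nonneg _)
            zero_le_one
      _ = 1 := one_mul 1⟩

theorem hasDeriv_psi : psi.HasDeriv (expAbs 2 zero_le_two) := by
  -- The weight is the sign times (1 − e^{-2|x|})/2, which vanishes at the origin; its derivative is
  -- sgn² e^{-2|x|}, with sgn² = 1 almost everywhere.
  have h := ((hasDeriv_expAbs 2 zero_le_two).const_mul_sub (-(1 / 2))).sgn_mul (by simp)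
  have e : (fun x => ((psi.toFun x : ℝ) : ℂ)) = fun x : ℝ => ((SignType.sign x : ℝ) : ℂ) *
      (-(1 / 2) * ((((expAbs 2 zero_le_two).toFun x : ℝ) : ℂ)
        - (((expAbs 2 zero_le_two).toFun 0 : ℝ) : ℂ))) := by
    funext x
    simp only [psi, expAbs]
    push_cast
    simp
    ring
  unfold HasDeriv
  rw [e]
  refine h.congr ?_
  filter_upwards [ae_sign_mul_sign] with x hx
  simp only [expAbs', expAbs]
  have hx' : ((SignType.sign x : ℝ) : ℂ) * ((SignType.sign x : ℝ) : ℂ) = 1 := by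
    exact_mod_cast hx
  push_cast
  linear_combination Complex.exp (-2 * (|x| : ℝ)) * hx'

theorem expAbs_op_expAbs {a b c : ℝ} (ha : 0 ≤ a) (hb : 0 ≤ b) (hc : 0 ≤ c) (h : a + b = c)
    (f : L2 ℂ) : (expAbs a ha).op ((expAbs b hb).op f) = (expAbs c hc).op f := by
  refine op_op _ _ _ (fun x => ?_) f
  simp only [expAbs]
  rw [← Real.exp_add, ← h]
  congr 1; ring

theorem expAbs'_op {a : ℝ} (ha : 0 ≤ a) (f : L2 ℂ) :
    (expAbs' a ha).op f = -(((a : ℝ) : ℂ) • sgn.op ((expAbs a ha).op f)) := by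
  refine Lp.ext ?_
  filter_upwards [(expAbs' a ha).coeFn_op f, sgn.coeFn_op ((expAbs a ha).op f),
    (expAbs a ha).coeFn_op f, Lp.coeFn_neg (((a : ℝ) : ℂ) • sgn.op ((expAbs a ha).op f)),
    Lp.coeFn_smul ((a : ℝ) : ℂ) (sgn.op ((expAbs a ha).op f))] with x h1 h2 h3 h4 h5
  rw [h1, h4, Pi.neg_apply, h5, Pi.smul_apply, h2, h3]
  simp only [expAbs', expAbs, sgn, smul_eq_mul]
  push_cast; ring

theorem sgn_sgn (f : L2 ℂ) : sgn.op (sgn.op f) = f := by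
  refine Lp.ext ?_
  filter_upwards [sgn.coeFn_op (sgn.op f), sgn.coeFn_op f, ae_sign_mul_sign] with x h1 h2 h3
  have h3' : ((SignType.sign x : ℝ) : ℂ) * ((SignType.sign x : ℝ) : ℂ) = 1 := by
    exact_mod_cast h3
  rw [h1, h2]
  simp only [sgn]
  rw [← mul_assoc, h3', one_mul]

theorem norm_sgn (f : L2 ℂ) : ‖sgn.op f‖ = ‖f‖ := by
  refine le_antisymm ?_ ?_
  · simpa using sgn.norm_op_le abs_sign_le_one f
  · have := sgn.norm_op_le abs_sign_le_one (sgn.op f)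
    rw [sgn_sgn] at this
    simpa using this

theorem norm_expAbs_le {a : ℝ} (ha : 0 ≤ a) (f : L2 ℂ) : ‖(expAbs a ha).op f‖ ≤ ‖f‖ := by
  have := (expAbs a ha).norm_op_le (C := 1) (fun x => by
    simp only [expAbs]
    rw [abs_of_pos (Real.exp_pos _), Real.exp_le_one_iff]
    nlinarith [abs_nonneg x]) f
  simpa using this

/-- The weight `exp (-|x|)`. -/
noncomputable abbrev Z : Weight := expAbs 1 zero_le_one

theorem Z_Z (f : L2 ℂ) : Z.op (Z.op f) = (expAbs 2 zero_le_two).op f :=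
  expAbs_op_expAbs _ _ _ (by norm_num) f

theorem inner_expAbs_two (f g : L2 ℂ) :
    ⟪(expAbs 2 zero_le_two).op f, g⟫_ℝ = ⟪Z.op f, Z.op g⟫_ℝ := by
  rw [← Z_Z, Z.real_inner_op]

theorem inner_expAbs_four (f g : L2 ℂ) : ⟪(expAbs 4 (by norm_num)).op f, g⟫_ℝ
    = ⟪(expAbs 2 zero_le_two).op f, (expAbs 2 zero_le_two).op g⟫_ℝ := by
  rw [← expAbs_op_expAbs zero_le_two zero_le_two (c := 4) (by norm_num) (by norm_num),
    (expAbs 2 _).real_inner_op]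

end Weight

/-! ### Functions vanishing at the origin -/

open Weight

/-- The continuous representative of `f` vanishes at the origin. -/
def VanishesAtZero (f : H1) : Prop :=
  ∃ F, IsPrimitive F (H1.D f) ∧ H1.toL2 f =ᵐ[volume] F ∧ F 0 = 0

/-- Multiplication by `exp (-|x|)` in `H¹`. -/
noncomputable def expMul (f : H1) : H1 :=
  H1.mk _ _ ((hasDeriv_expAbs 1 zero_le_one).isWeakDeriv (H1.isWeakDeriv f))

theorem toL2_expMul (f : H1) : H1.toL2 (expMul f) = Z.op (H1.toL2 f) := rfl

theorem D_expMul (f : H1) :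
    H1.D (expMul f) = Z.op (H1.D f) - sgn.op (Z.op (H1.toL2 f)) := by
  change (expAbs' 1 zero_le_one).op (H1.toL2 f) + Z.op (H1.D f) = _
  rw [expAbs'_op, Complex.ofReal_one, one_smul]
  abel

theorem VanishesAtZero.expMul {f : H1} (h : VanishesAtZero f) : VanishesAtZero (expMul f) := by
  obtain ⟨F, hF, hf, h0⟩ := h
  refine ⟨fun x => ((Z.toFun x : ℝ) : ℂ) * F x, ?_, ?_, by simp [h0]⟩
  · refine (IsPrimitive.mul (hasDeriv_expAbs 1 zero_le_one) hF).congr ?_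
    filter_upwards [Lp.coeFn_add ((expAbs' 1 zero_le_one).op (H1.toL2 f)) (Z.op (H1.D f)),
      (expAbs' 1 zero_le_one).coeFn_op (H1.toL2 f), Z.coeFn_op (H1.D f), hf] with x h1 h2 h3 h4
    change _ = ((expAbs' 1 zero_le_one).op (H1.toL2 f) + Z.op (H1.D f) : L2 ℂ) x
    rw [h1, Pi.add_apply, h2, h3, h4]
  · filter_upwards [Z.coeFn_op (H1.toL2 f), hf] with x h1 h2
    rw [toL2_expMul, h1, h2]

theorem VanishesAtZero.sq {f : H1} (h : VanishesAtZero f) : VanishesAtZero (H1.sq f) := by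
  obtain ⟨F, hF, hf, h0⟩ := h
  refine ⟨fun x => star (F x) * F x, ?_, ?_, by simp [h0]⟩
  · refine (hF.conj_mul hF).congr ?_
    filter_upwards [H1.coeFn_D_sq f, hf] with x h1 h2
    rw [h1, h2]
    apply Complex.ext <;> simp <;> ring
  · filter_upwards [H1.coeFn_toL2_sq f, hf] with x h1 h2
    rw [h1, h2, Complex.star_def, Complex.conj_mul']
    push_cast; rfl

theorem VanishesAtZero.isWeakDeriv_sgn {f : H1} (h : VanishesAtZero f) :
    IsWeakDeriv (sgn.op (H1.toL2 f)) (sgn.op (H1.D f)) := by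
  obtain ⟨F, hF, hf, h0⟩ := h
  refine (hF.sgn_mul h0).isWeakDeriv ?_ (sgn.coeFn_op _)
  filter_upwards [sgn.coeFn_op (H1.toL2 f), hf] with x h1 h2
  rw [h1, h2]; rfl

namespace VanishesAtZero

variable {f : H1}

/-- The weighted Hardy identity. -/
theorem norm_sq_Z (h : VanishesAtZero f) :
    ‖Z.op (H1.toL2 f)‖ ^ 2 = ⟪sgn.op (Z.op (H1.toL2 f)), Z.op (H1.D f)⟫_ℝ := by
  -- Pair sgn·f with e^{-2|x|}f. The derivative of the weight yields 2‖e^{-|x|}f‖², and the other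
  -- two terms are the same inner product.
  have key := h.isWeakDeriv_sgn.real_inner_left
    ((hasDeriv_expAbs 2 zero_le_two).isWeakDeriv (H1.isWeakDeriv f))
  have e1 : ⟪sgn.op (H1.D f), (expAbs 2 zero_le_two).op (H1.toL2 f)⟫_ℝ
      = ⟪sgn.op (Z.op (H1.toL2 f)), Z.op (H1.D f)⟫_ℝ := by
    rw [← (expAbs 2 _).real_inner_op, inner_expAbs_two, real_inner_comm, op_comm Z sgn,
      ← sgn.real_inner_op]
  have e2 : ⟪sgn.op (H1.toL2 f), (expAbs 2 zero_le_two).op (H1.D f)⟫_ℝ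
      = ⟪sgn.op (Z.op (H1.toL2 f)), Z.op (H1.D f)⟫_ℝ := by
    rw [← (expAbs 2 _).real_inner_op, inner_expAbs_two, op_comm Z sgn]
  have e3 : ⟪sgn.op (H1.toL2 f), (expAbs' 2 zero_le_two).op (H1.toL2 f)⟫_ℝ
      = -2 * ‖Z.op (H1.toL2 f)‖ ^ 2 := by
    rw [expAbs'_op, inner_neg_right, L2.real_inner_eq_re, inner_smul_right, Complex.re_ofReal_mul,
      ← L2.real_inner_eq_re, ← sgn.real_inner_op, sgn_sgn, ← (expAbs 2 _).real_inner_op,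
      inner_expAbs_two, real_inner_self_eq_norm_sq]
    ring
  rw [inner_add_right, e1, e2, e3] at key
  linarith

theorem norm_Z_le (h : VanishesAtZero f) : ‖Z.op (H1.toL2 f)‖ ≤ ‖Z.op (H1.D f)‖ := by
  have h1 := h.norm_sq_Z
  have h2 := real_inner_le_norm (sgn.op (Z.op (H1.toL2 f))) (Z.op (H1.D f))
  rw [norm_sgn] at h2
  by_contra hlt
  rw [not_le] at hlt
  nlinarith [norm_nonneg (Z.op (H1.D f)), norm_nonneg (Z.op (H1.toL2 f))]

/-- Expanding the square of e^{-|x|}f' − sgn e^{-|x|}f, the Hardy identity replaces the cross term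
by −2‖e^{-|x|}f‖². -/
theorem norm_sq_D_expMul (h : VanishesAtZero f) :
    ‖H1.D (Zakharov.expMul f)‖ ^ 2 = ‖Z.op (H1.D f)‖ ^ 2 - ‖Z.op (H1.toL2 f)‖ ^ 2 := by
  rw [D_expMul, norm_sub_sq_real, norm_sgn, real_inner_comm, ← h.norm_sq_Z]
  ring

/-- The quadratic part of the virial identity is coercive. -/
theorem virial_quadratic (h : VanishesAtZero f) :
    2 * ⟪(expAbs 2 zero_le_two).op (H1.D f), H1.D f⟫_ℝ
      + ⟪(expAbs' 2 zero_le_two).op (H1.toL2 f), H1.D f⟫_ℝ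
      = 2 * ‖H1.D (Zakharov.expMul f)‖ ^ 2 := by
  rw [h.norm_sq_D_expMul, inner_expAbs_two, real_inner_self_eq_norm_sq, expAbs'_op, inner_neg_left,
    L2.real_inner_eq_re, inner_smul_left, Complex.conj_ofReal, Complex.re_ofReal_mul,
    ← L2.real_inner_eq_re, sgn.real_inner_op, inner_expAbs_two, op_comm Z sgn, ← sgn.real_inner_op,
    ← h.norm_sq_Z]
  ring

/-- This is the Hardy inequality for e^{-|x|}f. One further exponential is the price for controlling
f itself by the coercive quantity, which is why the local mass carries e^{-4|x|}. -/
theorem norm_expAbs_two_le (h : VanishesAtZero f) :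
    ‖(expAbs 2 zero_le_two).op (H1.toL2 f)‖ ≤ ‖H1.D (Zakharov.expMul f)‖ := by
  rw [← Z_Z]
  exact (h.expMul.norm_Z_le).trans (norm_expAbs_le _ _)

theorem norm_expAbs_two_D_le (h : VanishesAtZero f) :
    ‖(expAbs 2 zero_le_two).op (H1.D f)‖ ≤ 2 * ‖H1.D (Zakharov.expMul f)‖ := by
  have e : (expAbs 2 zero_le_two).op (H1.D f) = Z.op (H1.D (Zakharov.expMul f))
      + sgn.op ((expAbs 2 zero_le_two).op (H1.toL2 f)) := by
    rw [D_expMul, map_sub, Z_Z, op_comm Z sgn, Z_Z]; abel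
  rw [e]
  have h1 := norm_add_le (Z.op (H1.D (Zakharov.expMul f)))
    (sgn.op ((expAbs 2 zero_le_two).op (H1.toL2 f)))
  rw [norm_sgn] at h1
  have h2 := norm_expAbs_le zero_le_one (H1.D (Zakharov.expMul f))
  have h3 := h.norm_expAbs_two_le
  linarith

/-- The quartic term is controlled by the quadratic part of the virial identity. -/
theorem norm_Z_sq_le (h : VanishesAtZero f) :
    ‖Z.op (H1.toL2 (H1.sq f))‖ ≤ 2 * ‖f‖ * ‖H1.D (Zakharov.expMul f)‖ := by
  set w := H1.D (Zakharov.expMul f) with hw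
  set k := H1.mul f (L2.conj w) + H1.mul (H1.conj f) w with hk
  set a := H1.toL2 (H1.sq f) with ha
  -- Substitute e^{-|x|}f' = w + sgn e^{-|x|}f into 2 Re(f̄ e^{-|x|}f').
  have e : Z.op (H1.D (H1.sq f)) = k + (2 : ℝ) • sgn.op (Z.op a) := by
    refine Lp.ext ?_
    have hwe := D_expMul f
    rw [← hw] at hwe
    filter_upwards [Z.coeFn_op (H1.D (H1.sq f)), H1.coeFn_D_sq f, H1.coeFn_toL2_sq f,
      Lp.coeFn_add k ((2 : ℝ) • sgn.op (Z.op a)), Lp.coeFn_smul (2 : ℝ) (sgn.op (Z.op a)),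
      sgn.coeFn_op (Z.op a), Z.coeFn_op a,
      Lp.coeFn_add (H1.mul f (L2.conj w)) (H1.mul (H1.conj f) w), H1.coeFn_mul f (L2.conj w),
      H1.coeFn_mul (H1.conj f) w, L2.coeFn_conj w, L2.coeFn_conj (H1.toL2 f),
      Lp.coeFn_sub (Z.op (H1.D f)) (sgn.op (Z.op (H1.toL2 f))), Z.coeFn_op (H1.D f),
      sgn.coeFn_op (Z.op (H1.toL2 f)), Z.coeFn_op (H1.toL2 f)]
      with x h1 h2 h3 h4 h5 h6 h7 h8 h9 h10 h11 h12 h13 h14 h15 h16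
    have h17 : H1.toL2 (H1.conj f) x = star (H1.toL2 f x) := h12
    have h18 : w x = ((Z.toFun x : ℝ) : ℂ) * H1.D f x
        - ((sgn.toFun x : ℝ) : ℂ) * (((Z.toFun x : ℝ) : ℂ) * H1.toL2 f x) := by
      rw [hwe, h13, Pi.sub_apply, h14, h15, h16]
    rw [h4, Pi.add_apply, h5, Pi.smul_apply, h1, h2, h6, h7, hk, h8, Pi.add_apply, h9, h10, h11,
      h17, h18, ha, h3, ← Complex.normSq_eq_norm_sq, Complex.normSq_apply]
    apply Complex.ext <;> simp <;> ring
  have hk' : ‖k‖ ≤ 2 * ‖f‖ * ‖w‖ := by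
    have h1 := H1.norm_mul_le f (L2.conj w)
    have h2 := H1.norm_mul_le (H1.conj f) w
    rw [L2.norm_conj] at h1
    rw [H1.norm_conj] at h2
    have := norm_add_le (H1.mul f (L2.conj w)) (H1.mul (H1.conj f) w)
    linarith
  -- The Hardy identity for a = |f|² now reads ‖e^{-|x|}a‖² = ⟨sgn e^{-|x|}a, k⟩ + 2‖e^{-|x|}a‖², so
  -- ‖e^{-|x|}a‖ ≤ ‖k‖.
  have h1 := h.sq.norm_sq_Z
  rw [e, inner_add_right, real_inner_smul_right, real_inner_self_eq_norm_sq, norm_sgn] at h1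
  have h2 := neg_abs_le ⟪sgn.op (Z.op a), k⟫_ℝ
  have h3 := abs_real_inner_le_norm (sgn.op (Z.op a)) k
  rw [norm_sgn] at h3
  by_contra hlt
  rw [not_le] at hlt
  nlinarith [norm_nonneg k, norm_nonneg (Z.op a)]

end VanishesAtZero

/-! ### Weighted estimates -/

theorem Weight.op_mul (φ : Weight) (f : H1) (g : L2 ℂ) :
    φ.op (H1.mul f g) = H1.mul f (φ.op g) := by
  refine Lp.ext ?_
  filter_upwards [φ.coeFn_op (H1.mul f g), H1.coeFn_mul f g, H1.coeFn_mul f (φ.op g),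
    φ.coeFn_op g] with x h1 h2 h3 h4
  rw [h1, h2, h3, h4]
  ring

theorem Weight.op_conj (φ : Weight) (g : L2 ℂ) : φ.op (L2.conj g) = L2.conj (φ.op g) := by
  refine Lp.ext ?_
  filter_upwards [φ.coeFn_op (L2.conj g), L2.coeFn_conj g, L2.coeFn_conj (φ.op g),
    φ.coeFn_op g] with x h1 h2 h3 h4
  rw [h1, h2, h3, h4]
  simp

theorem Weight.norm_op_D_sq_le (φ : Weight) (f : H1) :
    ‖φ.op (H1.D (H1.sq f))‖ ≤ 2 * ‖f‖ * ‖φ.op (H1.D f)‖ := by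
  rw [H1.D_sq, map_add, φ.op_mul, φ.op_mul, φ.op_conj]
  have h1 := H1.norm_mul_le f (L2.conj (φ.op (H1.D f)))
  have h2 := H1.norm_mul_le (H1.conj f) (φ.op (H1.D f))
  rw [L2.norm_conj] at h1
  rw [H1.norm_conj] at h2
  have := norm_add_le (H1.mul f (L2.conj (φ.op (H1.D f)))) (H1.mul (H1.conj f) (φ.op (H1.D f)))
  linarith

theorem Weight.inner_op_mul_real (φ : Weight) {N : L2 ℂ} (hN : L2.conj N = N) (f : H1) :
    ⟪φ.op (H1.toL2 f), H1.mul f N⟫_ℝ = ⟪φ.op N, H1.toL2 (H1.sq f)⟫_ℝ := by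
  have hN' : L2.conj (φ.op N) = φ.op N := by rw [← φ.op_conj, hN]
  rw [real_inner_comm, ← φ.real_inner_op, φ.op_mul, ← H1.inner_sq_real hN', real_inner_comm]

theorem abs_inner_deriv_expAbs_four_le (f g : L2 ℂ) :
    |⟪(expAbs' 4 zero_le_four).op f, g⟫_ℝ|
      ≤ 4 * (‖(expAbs 2 zero_le_two).op f‖ * ‖(expAbs 2 zero_le_two).op g‖) := by
  have h := abs_real_inner_le_norm ((expAbs 2 zero_le_two).op f)
    (sgn.op ((expAbs 2 zero_le_two).op g))
  rw [norm_sgn] at h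
  rw [expAbs'_op, inner_neg_left, L2.real_inner_eq_re, inner_smul_left, Complex.conj_ofReal,
    Complex.re_ofReal_mul, ← L2.real_inner_eq_re, sgn.real_inner_op, inner_expAbs_four,
    op_comm _ sgn, abs_neg, abs_mul, abs_of_pos (by norm_num : (0 : ℝ) < 4)]
  exact mul_le_mul_of_nonneg_left h zero_le_four

theorem norm_expAbs_two_le_norm_Z (f : L2 ℂ) : ‖(expAbs 2 zero_le_two).op f‖ ≤ ‖Z.op f‖ := by
  rw [← Z_Z]
  exact norm_expAbs_le _ _

theorem norm_D_expMul_le (f : H1) : ‖H1.D (expMul f)‖ ≤ ‖H1.D f‖ + ‖H1.toL2 f‖ := by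
  rw [D_expMul]
  refine (norm_sub_le _ _).trans (add_le_add (norm_expAbs_le _ _) ?_)
  rw [norm_sgn]
  exact norm_expAbs_le _ _

/-- Agmon's inequality for e^{-2|x|}f. Each of the two multiplications by e^{-|x|} adds at most ‖f‖
to the norm of the derivative, which is thus at most 3‖f‖; Agmon's factor 2 makes it 6. -/
theorem ae_norm_sq_expAbs_two_le (f : H1) :
    ∀ᵐ x, ‖(expAbs 2 zero_le_two).op (H1.toL2 f) x‖ ^ 2
      ≤ 6 * ‖f‖ * ‖(expAbs 2 zero_le_two).op (H1.toL2 f)‖ := by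
  have e : H1.toL2 (expMul (expMul f)) = (expAbs 2 zero_le_two).op (H1.toL2 f) := Z_Z _
  obtain ⟨F, hF, hf⟩ := (H1.isWeakDeriv (expMul (expMul f))).exists_rep
  rw [e] at hf
  filter_upwards [hf] with x hx
  rw [hx]
  refine (hF.norm_sq_le hf x).trans ?_
  have h1 := norm_D_expMul_le (expMul f)
  have h2 := norm_D_expMul_le f
  have h3 : ‖H1.toL2 (expMul f)‖ ≤ ‖H1.toL2 f‖ := norm_expAbs_le _ _
  have h4 := H1.norm_toL2_le f
  have h5 := H1.norm_D_le f
  have h6 : ‖H1.D (expMul (expMul f))‖ ≤ 3 * ‖f‖ := by linarith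
  nlinarith [mul_le_mul_of_nonneg_left h6 (norm_nonneg ((expAbs 2 zero_le_two).op (H1.toL2 f)))]

namespace System

variable {u : ℝ → H1} {N V : ℝ → L2 ℂ} {t : ℝ}

/-! ### Boundedness -/

/-- The energy is constant and its cross term is at most ‖N‖/4, so it bounds ‖N‖² + ‖V‖². The same
constant bounds the norms because it is at least 1. -/
theorem exists_bound (h : System u N V) (hu : ∀ t, 0 < t → ‖u t‖ ≤ 1 / 2) :
    ∃ M, ∀ t, 0 < t → ‖N t‖ ≤ M ∧ ‖V t‖ ≤ M := by
  refine ⟨4 * |energy u N V 1| + 2, fun t ht => ?_⟩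
  have hE : energy u N V t = energy u N V 1 :=
    isOpen_Ioi.is_const_of_deriv_eq_zero (s := Set.Ioi (0 : ℝ)) isPreconnected_Ioi
      (fun s hs => (h.hasDerivAt_energy hs).differentiableAt.differentiableWithinAt)
      (fun s hs => (h.hasDerivAt_energy hs).deriv) ht (Set.mem_Ioi.2 one_pos)
  have h1 := abs_real_inner_le_norm (H1.mul (u t) (N t)) (H1.toL2 (u t))
  have h2 := H1.norm_mul_le (u t) (N t)
  have h3 := (H1.norm_toL2_le (u t)).trans (hu t ht)
  have h4 := hu t ht
  have h5 : ‖H1.mul (u t) (N t)‖ * ‖H1.toL2 (u t)‖ ≤ 1 / 2 * ‖N t‖ * (1 / 2) :=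
    mul_le_mul (h2.trans (mul_le_mul_of_nonneg_right h4 (norm_nonneg _))) h3 (norm_nonneg _)
      (by positivity)
  have h6 := neg_abs_le ⟪H1.mul (u t) (N t), H1.toL2 (u t)⟫_ℝ
  have h7 := le_abs_self (energy u N V 1)
  have h8 : ‖N t‖ ^ 2 + ‖V t‖ ^ 2 ≤ 4 * |energy u N V 1| + 2 := by
    rw [energy] at hE
    nlinarith [sq_nonneg ‖H1.D (u t)‖, sq_nonneg (‖N t‖ - 1), sq_nonneg ‖V t‖]
  constructor <;>
    nlinarith [sq_nonneg ‖N t‖, sq_nonneg ‖V t‖, norm_nonneg (N t), norm_nonneg (V t),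
      abs_nonneg (energy u N V 1)]

/-! ### The virial functional -/

/-- The virial functional. -/
noncomputable def virial (u : ℝ → H1) (N V : ℝ → L2 ℂ) (t : ℝ) : ℝ :=
  ⟪Complex.I • H1.toL2 (u t), psi.op (H1.D (u t))⟫_ℝ + ⟪psi.op (N t), V t⟫_ℝ

/-- The derivative of the virial functional. -/
noncomputable def virialDeriv (u : ℝ → H1) (N V : ℝ → L2 ℂ) (t : ℝ) : ℝ :=
  2 * ‖H1.D (expMul (u t))‖ ^ 2 + ⟪Z.op (N t), Z.op (H1.toL2 (H1.sq (u t)))⟫_ℝ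
    + (‖Z.op (N t)‖ ^ 2 + ‖Z.op (V t)‖ ^ 2) / 2

/-- The local energy dissipated by the flow. -/
noncomputable def dissipation (u : ℝ → H1) (N V : ℝ → L2 ℂ) (t : ℝ) : ℝ :=
  ‖H1.D (expMul (u t))‖ ^ 2 + (‖Z.op (N t)‖ ^ 2 + ‖Z.op (V t)‖ ^ 2) / 4

theorem dissipation_nonneg (t : ℝ) : 0 ≤ dissipation u N V t := by
  unfold dissipation; positivity

/-- In the sum of the two momentum identities the terms with the undifferentiated weight ψ cancel,
and the vanishing of u at the origin puts the quadratic part in coercive form. -/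
theorem hasDerivAt_virial (h : System u N V) (h0 : VanishesAtZero (u t)) (ht : 0 < t) :
    HasDerivAt (virial u N V) (virialDeriv u N V t) t := by
  have hN := h.schrodinger.real t
  refine ((h.schrodinger.hasDerivAt_momentum hasDeriv_psi (hasDeriv_expAbs 2 zero_le_two) ht).add
    (h.hasDerivAt_wave_momentum hasDeriv_psi ht)).congr_deriv ?_
  rw [h0.virial_quadratic, H1.inner_D_mul_real psi hN, (expAbs 2 _).inner_op_mul_real hN,
    inner_expAbs_two, inner_expAbs_two, inner_expAbs_two, real_inner_self_eq_norm_sq,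
    real_inner_self_eq_norm_sq, virialDeriv]
  ring

/-- With W = ‖(e^{-|x|}u)_x‖, the bound ‖u‖ ≤ 1/2 makes the cross term at most W‖e^{-|x|}N‖ ≤ W² +
‖e^{-|x|}N‖²/4. -/
theorem dissipation_le (h0 : VanishesAtZero (u t)) (hu : ‖u t‖ ≤ 1 / 2) :
    dissipation u N V t ≤ virialDeriv u N V t := by
  have h1 := h0.norm_Z_sq_le
  have h2 := neg_abs_le ⟪Z.op (N t), Z.op (H1.toL2 (H1.sq (u t)))⟫_ℝ
  have h3 := abs_real_inner_le_norm (Z.op (N t)) (Z.op (H1.toL2 (H1.sq (u t))))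
  have h4 : ‖Z.op (H1.toL2 (H1.sq (u t)))‖ ≤ ‖H1.D (expMul (u t))‖ :=
    h1.trans (by nlinarith [norm_nonneg (H1.D (expMul (u t)))])
  have h5 := mul_le_mul_of_nonneg_left h4 (norm_nonneg (Z.op (N t)))
  rw [dissipation, virialDeriv]
  nlinarith [sq_nonneg (‖H1.D (expMul (u t))‖ - ‖Z.op (N t)‖ / 2), sq_nonneg ‖Z.op (V t)‖]

theorem continuousOn_dissipation (h : System u N V) :
    ContinuousOn (dissipation u N V) (Set.Ioi 0) := by
  have c1 : ContinuousOn (fun t => H1.D (expMul (u t))) (Set.Ioi 0) := by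
    simp only [D_expMul]
    exact (Z.op.continuous.comp_continuousOn h.schrodinger.continuousOn_D).sub
      (sgn.op.continuous.comp_continuousOn
        (Z.op.continuous.comp_continuousOn h.schrodinger.continuousOn_toL2))
  have c2 := Z.op.continuous.comp_continuousOn h.schrodinger.potential
  have c3 := Z.op.continuous.comp_continuousOn h.velocity.left
  exact (c1.norm.pow 2).add (((c2.norm.pow 2).add (c3.norm.pow 2)).div_const 4)

theorem integrableOn_dissipation (h : System u N V) (hu : ∀ t, 0 < t → ‖u t‖ ≤ 1 / 2)
    (h0 : ∀ t, 0 < t → VanishesAtZero (u t)) :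
    IntegrableOn (dissipation u N V) (Set.Ioi 1) := by
  obtain ⟨M, hM⟩ := h.exists_bound hu
  obtain ⟨C, hC⟩ := psi.bound
  have hb : ∀ t, 0 < t → |virial u N V t| ≤ C * (1 / 2) * (1 / 2) + C * M * M := by
    intro t ht
    refine (abs_add_le _ _).trans (add_le_add ?_ (psi.abs_inner_le hC (hM t ht).1 (hM t ht).2))
    rw [← psi.real_inner_op]
    refine psi.abs_inner_le hC ?_ ((H1.norm_D_le _).trans (hu t ht))
    rw [norm_I_smul]
    exact (H1.norm_toL2_le _).trans (hu t ht)
  have hc := h.continuousOn_dissipation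
  have hsub : ∀ T : ℝ, Set.Icc 1 T ⊆ Set.Ioi 0 := fun T x hx => one_pos.trans_le hx.1
  -- The integral of the dissipation over [1, T] is at most the increment of the virial functional,
  -- hence at most twice its uniform bound. Starting at 1 keeps the closed intervals inside t > 0,
  -- where the equations hold.
  refine integrableOn_Ioi_of_intervalIntegral_norm_bounded
    (2 * (C * (1 / 2) * (1 / 2) + C * M * M)) 1 (b := id) (l := atTop) (fun T => ?_) tendsto_id ?_
  · exact ((hc.mono (hsub T)).integrableOn_Icc).mono_set Set.Ioc_subset_Icc_self
  · filter_upwards [eventually_ge_atTop 1] with T hT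
    have e : ∫ x in (1 : ℝ)..T, ‖dissipation u N V x‖ = ∫ x in (1 : ℝ)..T, dissipation u N V x :=
      intervalIntegral.integral_congr fun x _ => Real.norm_of_nonneg (dissipation_nonneg x)
    rw [id, e]
    have key := intervalIntegral.integral_le_sub_of_hasDeriv_right_of_le hT
      (g := virial u N V) (g' := virialDeriv u N V) (φ := dissipation u N V)
      (fun x hx => (h.hasDerivAt_virial (h0 x (hsub T hx))
        (hsub T hx)).continuousAt.continuousWithinAt)
      (fun x hx => (h.hasDerivAt_virial (h0 x (hsub T ⟨hx.1.le, hx.2.le⟩))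
        (hsub T ⟨hx.1.le, hx.2.le⟩)).hasDerivWithinAt)
      ((hc.mono (hsub T)).integrableOn_Icc)
      (fun x hx => dissipation_le (h0 x (hsub T ⟨hx.1.le, hx.2.le⟩))
        (hu x (hsub T ⟨hx.1.le, hx.2.le⟩)))
    have b1 := hb 1 one_pos
    have b2 := hb T (one_pos.trans_le hT)
    rw [abs_le] at b1 b2
    linarith [b1.1, b2.2]

/-! ### Decay of the local norms -/

/-- The local mass and wave energy. -/
noncomputable def localMass (u : ℝ → H1) (N V : ℝ → L2 ℂ) (t : ℝ) : ℝ :=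
  ⟪(expAbs 4 zero_le_four).op (H1.toL2 (u t)), H1.toL2 (u t)⟫_ℝ
    + (⟪(expAbs 4 zero_le_four).op (N t), N t⟫_ℝ + ⟪(expAbs 4 zero_le_four).op (V t), V t⟫_ℝ)

theorem localMass_eq (t : ℝ) : localMass u N V t
    = ‖(expAbs 2 zero_le_two).op (H1.toL2 (u t))‖ ^ 2
      + (‖(expAbs 2 zero_le_two).op (N t)‖ ^ 2 + ‖(expAbs 2 zero_le_two).op (V t)‖ ^ 2) := by
  simp only [localMass, inner_expAbs_four, real_inner_self_eq_norm_sq]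

theorem localMass_le (h0 : VanishesAtZero (u t)) :
    localMass u N V t ≤ 4 * dissipation u N V t := by
  have h1 := pow_le_pow_left₀ (norm_nonneg _) h0.norm_expAbs_two_le 2
  have h2 := pow_le_pow_left₀ (norm_nonneg _) (norm_expAbs_two_le_norm_Z (N t)) 2
  have h3 := pow_le_pow_left₀ (norm_nonneg _) (norm_expAbs_two_le_norm_Z (V t)) 2
  rw [localMass_eq, dissipation]
  nlinarith [sq_nonneg ‖H1.D (expMul (u t))‖]

/-- With W = ‖(e^{-|x|}u)_x‖, p = ‖e^{-|x|}N‖ and q = ‖e^{-|x|}V‖, the three flux terms are at most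
16W², 8pq and 4qW. Their sum is at most 18W² + 4p² + 6q², and the last coefficient forces 24. -/
theorem exists_hasDerivAt_localMass (h : System u N V) (h0 : VanishesAtZero (u t))
    (hu : ‖u t‖ ≤ 1 / 2) (ht : 0 < t) :
    ∃ d, HasDerivAt (localMass u N V) d t ∧ |d| ≤ 24 * dissipation u N V t := by
  refine ⟨_, (h.schrodinger.hasDerivAt_weight (hasDeriv_expAbs 4 zero_le_four) ht).add
    (h.hasDerivAt_wave_energy (hasDeriv_expAbs 4 zero_le_four) ht), ?_⟩
  have h1 := abs_inner_deriv_expAbs_four_le (H1.toL2 (u t)) (Complex.I • H1.D (u t))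
  have h2 := abs_inner_deriv_expAbs_four_le (N t) (V t)
  have h3 := abs_real_inner_le_norm ((expAbs 2 zero_le_two).op (V t))
    ((expAbs 2 zero_le_two).op (H1.D (H1.sq (u t))))
  rw [← inner_expAbs_four] at h3
  have h4 := (expAbs 2 zero_le_two).norm_op_D_sq_le (u t)
  have h5 := h0.norm_expAbs_two_le
  have h6 := h0.norm_expAbs_two_D_le
  have h7 := norm_expAbs_two_le_norm_Z (N t)
  have h8 := norm_expAbs_two_le_norm_Z (V t)
  rw [map_smul, norm_I_smul] at h1
  rw [dissipation]
  set W := ‖H1.D (expMul (u t))‖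
  have hW : 0 ≤ W := norm_nonneg _
  have g1 := mul_le_mul h5 h6 (norm_nonneg _) hW
  have g2 := mul_le_mul h7 h8 (norm_nonneg _) (norm_nonneg _)
  have g3 : ‖(expAbs 2 zero_le_two).op (H1.D (H1.sq (u t)))‖ ≤ 2 * W := by
    refine h4.trans ?_
    calc 2 * ‖u t‖ * ‖(expAbs 2 zero_le_two).op (H1.D (u t))‖ ≤ 1 * (2 * W) :=
          mul_le_mul (by linarith) h6 (norm_nonneg _) zero_le_one
      _ = 2 * W := one_mul _
  have g4 := mul_le_mul h8 g3 (norm_nonneg _) (norm_nonneg _)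
  have t1 := abs_add_le
    (-2 * ⟪(expAbs' 4 zero_le_four).op (H1.toL2 (u t)), Complex.I • H1.D (u t)⟫_ℝ)
    (2 * ⟪(expAbs' 4 zero_le_four).op (N t), V t⟫_ℝ
      - 2 * ⟪(expAbs 4 zero_le_four).op (V t), H1.D (H1.sq (u t))⟫_ℝ)
  have t2 := abs_sub (2 * ⟪(expAbs' 4 zero_le_four).op (N t), V t⟫_ℝ)
    (2 * ⟪(expAbs 4 zero_le_four).op (V t), H1.D (H1.sq (u t))⟫_ℝ)
  rw [abs_mul, abs_mul] at t2
  rw [abs_mul] at t1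
  simp only [abs_neg, abs_two] at t1 t2
  nlinarith [sq_nonneg (‖Z.op (N t)‖ - ‖Z.op (V t)‖), sq_nonneg (W - ‖Z.op (V t)‖)]

theorem continuousOn_localMass (h : System u N V) :
    ContinuousOn (localMass u N V) (Set.Ioi 0) := by
  have c1 := (expAbs 2 zero_le_two).op.continuous.comp_continuousOn h.schrodinger.continuousOn_toL2
  have c2 := (expAbs 2 zero_le_two).op.continuous.comp_continuousOn h.schrodinger.potential
  have c3 := (expAbs 2 zero_le_two).op.continuous.comp_continuousOn h.velocity.left
  exact ((c1.norm.pow 2).add ((c2.norm.pow 2).add (c3.norm.pow 2))).congr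
    fun t _ => localMass_eq t

/-- The function and its derivative are both integrable in time, being dominated by the dissipation;
such a function tends to 0. -/
theorem tendsto_localMass (h : System u N V) (hu : ∀ t, 0 < t → ‖u t‖ ≤ 1 / 2)
    (h0 : ∀ t, 0 < t → VanishesAtZero (u t)) :
    Tendsto (localMass u N V) atTop (𝓝 0) := by
  have hi := h.integrableOn_dissipation hu h0
  have hpos : ∀ t ∈ Set.Ioi (1 : ℝ), 0 < t := fun t ht => one_pos.trans ht
  have hd : ∀ t, 0 < t → HasDerivAt (localMass u N V) (deriv (localMass u N V) t) t ∧
      |deriv (localMass u N V) t| ≤ 24 * dissipation u N V t := by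
    intro t ht
    obtain ⟨d, h1, h2⟩ := h.exists_hasDerivAt_localMass (h0 t ht) (hu t ht) ht
    rw [h1.deriv]
    exact ⟨h1, h2⟩
  refine tendsto_zero_of_hasDerivAt_of_integrableOn_Ioi (a := 1)
    (f' := deriv (localMass u N V)) (fun t ht => (hd t (hpos t ht)).1) ?_ ?_
  · refine Integrable.mono' (hi.const_mul 24) (measurable_deriv _).aestronglyMeasurable ?_
    exact (ae_restrict_iff' measurableSet_Ioi).2 (ae_of_all _ fun t ht => (hd t (hpos t ht)).2)
  · refine Integrable.mono' (hi.const_mul 4)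
      ((h.continuousOn_localMass.mono hpos).aestronglyMeasurable measurableSet_Ioi) ?_
    refine (ae_restrict_iff' measurableSet_Ioi).2 (ae_of_all _ fun t ht => ?_)
    rw [Real.norm_of_nonneg (by rw [localMass_eq]; positivity)]
    exact localMass_le (h0 t (hpos t ht))

end System

/-! ### Complexification -/

/-- The inclusion of the real `L²` in the complex `L²`. -/
noncomputable def L2.ofReal : L2 ℝ →L[ℝ] L2 ℂ := Complex.ofRealCLM.compLpL 2 volume

theorem L2.coeFn_ofReal (f : L2 ℝ) : L2.ofReal f =ᵐ[volume] fun x => ((f x : ℝ) : ℂ) :=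
  Complex.ofRealCLM.coeFn_compLpL f

theorem L2.conj_ofReal (f : L2 ℝ) : L2.conj (L2.ofReal f) = L2.ofReal f := by
  refine Lp.ext ?_
  filter_upwards [L2.coeFn_conj (L2.ofReal f), L2.coeFn_ofReal f] with x h1 h2
  rw [h1, h2, Complex.star_def, Complex.conj_ofReal]

theorem IsTest.inner_ofReal {η : ℝ → ℝ} (h : IsTest η) (f : L2 ℝ) :
    ⟪h.toL2, L2.ofReal f⟫_ℂ = ((∫ x, η x * f x : ℝ) : ℂ) := by
  rw [h.inner_toL2, ← integral_complex_ofReal]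
  refine integral_congr_ae ?_
  filter_upwards [L2.coeFn_ofReal f] with x hx
  rw [hx]
  push_cast; rfl

namespace IsSolution

variable {u : ℝ → H1} {n v : ℝ → L2 ℝ}

theorem schrodingerEq (h : IsSolution u n v) (cu : ContinuousOn u (Set.Ioi 0))
    (cn : ContinuousOn n (Set.Ioi 0)) : SchrodingerEq u (fun t => L2.ofReal (n t)) := by
  have cN : ContinuousOn (fun t => L2.ofReal (n t)) (Set.Ioi 0) :=
    L2.ofReal.continuous.comp_continuousOn cn
  have c1 : ContinuousOn (fun t => H1.toL2 (u t)) (Set.Ioi 0) :=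
    H1.toL2L.continuous.comp_continuousOn cu
  have c2 : ContinuousOn (fun t => H1.D (u t)) (Set.Ioi 0) :=
    H1.DL.continuous.comp_continuousOn cu
  have c3 : ContinuousOn (fun t => H1.mul (u t) (L2.ofReal (n t))) (Set.Ioi 0) :=
    (H1.mul.continuous.comp_continuousOn cu).clm_apply cN
  refine ⟨cu, cN, fun t => L2.conj_ofReal _,
    WeakEq.of_test c1 (c2.const_smul (-Complex.I)) (c3.const_smul (-Complex.I)) fun η hη t ht => ?_⟩
  have e : (fun s => ⟪hη.toL2, H1.toL2 (u s)⟫_ℂ)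
      = fun s => ∫ x, ((η x : ℝ) : ℂ) * H1.toL2 (u s) x := funext fun s => hη.inner_toL2 _
  rw [e]
  refine (h.schrodinger η hη t ht).congr_deriv ?_
  have e1 : ∫ x, ((η x : ℝ) : ℂ) * (((n t x : ℝ) : ℂ) * H1.toL2 (u t) x)
      = ⟪hη.toL2, H1.mul (u t) (L2.ofReal (n t))⟫_ℂ := by
    rw [hη.inner_toL2]
    refine integral_congr_ae ?_
    filter_upwards [H1.coeFn_mul (u t) (L2.ofReal (n t)), L2.coeFn_ofReal (n t)] with x h1 h2
    rw [h1, h2, mul_comm (H1.toL2 (u t) x)]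
  rw [e1, ← hη.deriv.deriv.inner_toL2, isWeakDeriv_iff.1 (H1.isWeakDeriv (u t)) _ hη.deriv,
    inner_smul_right, inner_smul_right]
  ring

theorem system (h : IsSolution u n v) (cu : ContinuousOn u (Set.Ioi 0))
    (cn : ContinuousOn n (Set.Ioi 0)) (cv : ContinuousOn v (Set.Ioi 0)) :
    System u (fun t => L2.ofReal (n t)) (fun t => L2.ofReal (v t)) := by
  have cN : ContinuousOn (fun t => L2.ofReal (n t)) (Set.Ioi 0) :=
    L2.ofReal.continuous.comp_continuousOn cn
  have cV : ContinuousOn (fun t => L2.ofReal (v t)) (Set.Ioi 0) :=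
    L2.ofReal.continuous.comp_continuousOn cv
  refine ⟨h.schrodingerEq cu cn,
    WeakEq.of_test cN cV continuousOn_const fun η hη t ht => ?_,
    WeakEq.of_test cV cN (H1.continuous_D_sq.comp_continuousOn cu).neg fun η hη t ht => ?_⟩
  · simp only [hη.inner_ofReal, hη.deriv.inner_ofReal, inner_zero_right, add_zero]
    exact (h.density η hη t ht).ofReal_comp
  · have e : ⟪hη.deriv.toL2, L2.ofReal (n t)⟫_ℂ + ⟪hη.toL2, -H1.D (H1.sq (u t))⟫_ℂ
        = ((∫ x, deriv η x * (n t x + ‖H1.toL2 (u t) x‖ ^ 2) : ℝ) : ℂ) := by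
      rw [inner_neg_right, ← isWeakDeriv_iff.1 (H1.isWeakDeriv (H1.sq (u t))) _ hη,
        ← inner_add_right, hη.deriv.inner_toL2, ← integral_complex_ofReal]
      refine integral_congr_ae ?_
      filter_upwards [Lp.coeFn_add (L2.ofReal (n t)) (H1.toL2 (H1.sq (u t))),
        L2.coeFn_ofReal (n t), H1.coeFn_toL2_sq (u t)] with x h1 h2 h3
      rw [h1, Pi.add_apply, h2, h3]
      push_cast; rfl
    rw [e]
    simp only [hη.inner_ofReal]
    exact (h.velocity η hη t ht).ofReal_comp

end IsSolution

/-- The almost-everywhere oddness passes to the continuous representative at every point, in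
particular at 0. -/
theorem IsOdd.vanishesAtZero {f : H1} (h : IsOdd (H1.toL2 f)) : VanishesAtZero f := by
  obtain ⟨F, hF, hf⟩ := (H1.isWeakDeriv f).exists_rep
  refine ⟨F, hF, hf, ?_⟩
  have hneg : (fun x => F (-x)) =ᵐ[volume] fun x => -F x := by
    filter_upwards [h, hf, (Measure.measurePreserving_neg (volume : Measure ℝ)
      ).quasiMeasurePreserving.ae hf] with x h1 h2 h3
    rw [← h3, h1, h2]
  have := congrFun ((Continuous.ae_eq_iff_eq volume (hF.continuous.comp continuous_neg)
    hF.continuous.neg).1 hneg) 0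
  simp only [Function.comp, neg_zero] at this
  exact self_eq_neg.1 this

/-! ### Local norms -/

theorem norm_le_exp_mul_norm {a b x : ℝ} (hx : x ∈ Set.Icc a b) (z : ℂ) :
    ‖z‖ ≤ Real.exp (2 * max |a| |b|)
      * ‖(((expAbs 2 zero_le_two).toFun x : ℝ) : ℂ) * z‖ := by
  have h1 : |x| ≤ max |a| |b| := abs_le_max_abs_abs hx.1 hx.2
  simp only [expAbs]
  rw [norm_mul, Complex.norm_real, Real.norm_of_nonneg (Real.exp_pos _).le, ← mul_assoc,
    ← Real.exp_add]
  exact le_mul_of_one_le_left (norm_nonneg _) (Real.one_le_exp (by linarith))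

theorem eLpNorm_restrict_Icc_le (f : L2 ℂ) (a b : ℝ) :
    eLpNorm f 2 (volume.restrict (Set.Icc a b))
      ≤ ENNReal.ofReal (Real.exp (2 * max |a| |b|) * ‖(expAbs 2 zero_le_two).op f‖) := by
  rw [ENNReal.ofReal_mul (Real.exp_pos _).le, ofReal_norm, Lp.enorm_def]
  refine (eLpNorm_le_mul_eLpNorm_of_ae_le_mul (g := (expAbs 2 zero_le_two).op f) ?_ 2).trans
    (mul_le_mul_right (eLpNorm_mono_measure _ Measure.restrict_le_self) _)
  filter_upwards [ae_restrict_of_ae ((expAbs 2 zero_le_two).coeFn_op f),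
    ae_restrict_mem measurableSet_Icc] with x h1 h2
  rw [h1]
  exact norm_le_exp_mul_norm h2 _

theorem eLpNorm_top_restrict_Icc_le (f : H1) (a b : ℝ) :
    eLpNorm (H1.toL2 f) ∞ (volume.restrict (Set.Icc a b))
      ≤ ENNReal.ofReal (Real.exp (2 * max |a| |b|)
        * √(6 * ‖f‖ * ‖(expAbs 2 zero_le_two).op (H1.toL2 f)‖)) := by
  rw [eLpNorm_exponent_top]
  refine eLpNormEssSup_le_of_ae_bound ?_
  filter_upwards [ae_restrict_of_ae ((expAbs 2 zero_le_two).coeFn_op (H1.toL2 f)),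
    ae_restrict_of_ae (ae_norm_sq_expAbs_two_le f), ae_restrict_mem measurableSet_Icc]
    with x h1 h2 h3
  refine (norm_le_exp_mul_norm h3 _).trans ?_
  rw [← h1]
  exact mul_le_mul_of_nonneg_left (Real.le_sqrt_of_sq_le h2) (Real.exp_pos _).le

theorem eLpNorm_ofReal (f : L2 ℝ) (a b : ℝ) :
    eLpNorm f 2 (volume.restrict (Set.Icc a b))
      = eLpNorm (L2.ofReal f) 2 (volume.restrict (Set.Icc a b)) := by
  refine eLpNorm_congr_norm_ae (ae_restrict_of_ae ?_)
  filter_upwards [L2.coeFn_ofReal f] with x hx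
  rw [hx, Complex.norm_real]

theorem System.tendsto_local_norms {u : ℝ → H1} {n v : ℝ → L2 ℝ}
    (h : System u (fun t => L2.ofReal (n t)) (fun t => L2.ofReal (v t)))
    (hu : ∀ t, 0 < t → ‖u t‖ ≤ 1 / 2) (h0 : ∀ t, 0 < t → VanishesAtZero (u t)) (a b : ℝ) :
    Tendsto (fun t : ℝ =>
      eLpNorm (H1.toL2 (u t)) ∞ (volume.restrict (Set.Icc a b))
        + eLpNorm (H1.toL2 (u t)) 2 (volume.restrict (Set.Icc a b))
        + eLpNorm (n t) 2 (volume.restrict (Set.Icc a b))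
        + eLpNorm (v t) 2 (volume.restrict (Set.Icc a b))) atTop (𝓝 0) := by
  set C := Real.exp (2 * max |a| |b|) with hC
  have hC0 : 0 ≤ C := (Real.exp_pos _).le
  have hm := h.tendsto_localMass hu h0
  set m := System.localMass u (fun t => L2.ofReal (n t)) (fun t => L2.ofReal (v t)) with hm_def
  have hlim : Tendsto (fun t => ENNReal.ofReal (C * √(3 * √(m t))) + ENNReal.ofReal (C * √(m t))
      + ENNReal.ofReal (C * √(m t)) + ENNReal.ofReal (C * √(m t))) atTop (𝓝 0) := by
    have g : Continuous fun x : ℝ => ENNReal.ofReal (C * √(3 * √x)) + ENNReal.ofReal (C * √x)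
        + ENNReal.ofReal (C * √x) + ENNReal.ofReal (C * √x) := by
      have := ENNReal.continuous_ofReal
      fun_prop
    have := (g.tendsto 0).comp hm
    rwa [Real.sqrt_zero, mul_zero, Real.sqrt_zero, mul_zero, ENNReal.ofReal_zero, add_zero,
      add_zero, add_zero] at this
  refine tendsto_of_tendsto_of_tendsto_of_le_of_le' tendsto_const_nhds hlim
    (Eventually.of_forall fun t => zero_le) ?_
  filter_upwards [eventually_gt_atTop 0] with t ht
  have e := System.localMass_eq (u := u) (N := fun t => L2.ofReal (n t))
    (V := fun t => L2.ofReal (v t)) t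
  rw [← hm_def] at e
  set A := ‖(expAbs 2 zero_le_two).op (H1.toL2 (u t))‖
  set B := ‖(expAbs 2 zero_le_two).op (L2.ofReal (n t))‖
  set D := ‖(expAbs 2 zero_le_two).op (L2.ofReal (v t))‖
  have b1 : A ≤ √(m t) := Real.le_sqrt_of_sq_le (by nlinarith [sq_nonneg B, sq_nonneg D])
  have b2 : B ≤ √(m t) := Real.le_sqrt_of_sq_le (by nlinarith [sq_nonneg A, sq_nonneg D])
  have b3 : D ≤ √(m t) := Real.le_sqrt_of_sq_le (by nlinarith [sq_nonneg A, sq_nonneg B])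
  rw [eLpNorm_ofReal, eLpNorm_ofReal]
  refine add_le_add (add_le_add (add_le_add ?_ ?_) ?_) ?_
  · refine (eLpNorm_top_restrict_Icc_le (u t) a b).trans (ENNReal.ofReal_le_ofReal
      (mul_le_mul_of_nonneg_left (Real.sqrt_le_sqrt ?_) hC0))
    exact mul_le_mul (by linarith [hu t ht]) b1 (norm_nonneg _) (by norm_num)
  · exact (eLpNorm_restrict_Icc_le _ a b).trans
      (ENNReal.ofReal_le_ofReal (mul_le_mul_of_nonneg_left b1 hC0))
  · exact (eLpNorm_restrict_Icc_le _ a b).trans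
      (ENNReal.ofReal_le_ofReal (mul_le_mul_of_nonneg_left b2 hC0))
  · exact (eLpNorm_restrict_Icc_le _ a b).trans
      (ENNReal.ofReal_le_ofReal (mul_le_mul_of_nonneg_left b3 hC0))

end Zakharov

/-! ### The main theorem. -/

theorem theorem1 :
    ∃ ε : ℝ, 0 < ε ∧
      ∀ (u : ℝ → Zakharov.H1) (n v : ℝ → Zakharov.L2 ℝ),
        ContinuousOn (fun t => (u t, n t, v t)) (Set.Ici 0) →
        Zakharov.IsSolution u n v →
        (∀ t : ℝ, 0 ≤ t → Zakharov.IsOdd (Zakharov.H1.toL2 (u t))) →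
        (⨆ t : Set.Ici (0 : ℝ), ‖u t‖ₑ) < ENNReal.ofReal ε →
        ∀ a b : ℝ,
          Tendsto (fun t : ℝ =>
            eLpNorm (Zakharov.H1.toL2 (u t)) ∞ (volume.restrict (Set.Icc a b))
              + eLpNorm (Zakharov.H1.toL2 (u t)) 2 (volume.restrict (Set.Icc a b))
              + eLpNorm (n t) 2 (volume.restrict (Set.Icc a b))
              + eLpNorm (v t) 2 (volume.restrict (Set.Icc a b)))
            atTop (𝓝 0) := by
  -- The value 1/2 turns the factor 2‖u‖ in `norm_Z_sq_le` into at most 1, which is what absorbing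
  -- the cross term of the virial identity requires; it also suffices for the energy bound.
  refine ⟨1 / 2, by norm_num, fun u n v hc hs hodd hsmall a b => ?_⟩
  have hc' := hc.mono Set.Ioi_subset_Ici_self
  have hu : ∀ t, 0 < t → ‖u t‖ ≤ 1 / 2 := by
    intro t ht
    have h1 : ‖u t‖ₑ ≤ ⨆ t : Set.Ici (0 : ℝ), ‖u t‖ₑ :=
      le_iSup (fun t : Set.Ici (0 : ℝ) => ‖u t‖ₑ) ⟨t, ht.le⟩
    have h2 := h1.trans hsmall.le
    rw [← ofReal_norm, ENNReal.ofReal_le_ofReal_iff (by norm_num)] at h2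
    exact h2
  exact (hs.system hc'.fst hc'.snd.fst hc'.snd.snd).tendsto_local_norms hu
    (fun t ht => (hodd t ht.le).vanishesAtZero) a b
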